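/- **Setting.** Consider $\min_{x\in\mathbb R^{d_1}}\max_{y\in Y} f(x,y)$, $f=\frac1M\sum_{i=1}^M f_i$, $f_i(x,y)=\mathbb E_{\xi\sim\mathcal D_i}[f_i(x,y;\xi)]$, where the losses $f_i(\cdot,\cdot;\xi)$ are differentiable at the points of $\mathbb R^{d_1}\times Y$. Let $l,\sigma>0$, $\sigma_G,G_y\ge 0$, $0<\mu\le l$, $\kappa=l/\mu$. Assume: each $f_i$ is differentiable and $\|\nabla f_i(x_1,y_1)-\nabla f_i(x_2,y_2)\|\le l(\|x_1-x_2\|+\|y_1-y_2\|)$; $\mathbb E\nabla f_i(x,y;\xi)=\nabla f_i(x,y)$ and $\mathbb E\|\nabla f_i(x,y;\xi)-\nabla f_i(x,y)\|^2\le\sigma^2$ for $\xi\sim\mathcal D_i$; $\|\nabla f_i(x,y)-\nabla f(x,y)\|^2\le\sigma_G^2$; $\Phi(x)=\max_{y\in Y}f(x,y)\ge\Phi^*>-\infty$; $Y\subset\mathbb R^{d_2}$ is nonempty, convex and compact; $|f(x,y)-f(x,y')|\le G_y\|y-y'\|$; and $f(x,y)\le f(x,y')+\langle\nabla_yf(x,y'),y-y'\rangle-\frac\mu2\|y-y'\|^2$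 (all for $x,x_j\in\mathbb R^{d_1}$, $y,y',y_j\in Y$). Let $P_Y$ be the Euclidean projection onto $Y$. A point $(x,y)$ is an $(\epsilon_1,\epsilon_2)$-stationary point of $f$ if $\|\nabla_xf(x,y)\|\le\epsilon_1$ and $l\|P_Y(y+\frac1l\nabla_yf(x,y))-y\|\le\epsilon_2$. **Algorithm (FESS-GDA).** Start from $x_0,z_0\in\mathbb R^{d_1}$, $y_0\in Y$. In round $t=0,\dots,T-1$ the server draws a uniformly random set $S_t$ of $m$ of the $M$ clients ($1\le m\le M$). Each $i\in S_t$ sets $(x^1_{t,i},y^1_{t,i})=(x_t,y_t)$ and, for $k=1,\dots,K$, with fresh independent $\xi^k_{t,i}\sim\mathcal D_i$ and $g^k_{t,i}=\nabla f_i(x^k_{t,i},y^k_{t,i};\xi^k_{t,i})$, computes $x^{k+1}_{t,i}=x^k_{t,i}-\eta_{x,l}\,g^k_{x,t,i}$ and $y^{k+1}_{t,i}=P_Y(y^k_{t,i}+\eta_{y,l}\,g^k_{y,t,i})$. Then $$x_{t+1}=x_t-\eta_x K\Big[\tfrac1{mK}\sum_{i\in S_t}\sum_{k=1}^K g^k_{x,t,i}+p(x_t-z_t)\Big],\quad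 y_{t+1}=P_Y\Big(y_t+\eta_y K\,\tfrac1{mK}\sum_{i\in S_t}\sum_{k=1}^K g^k_{y,t,i}\Big),\quad z_{t+1}=z_t+\beta(x_{t+1}-z_t),$$ where $\eta_x=\eta_{x,g}\eta_{x,l}$ and $\eta_y=\eta_{y,g}\eta_{y,l}$. Put $\hat f(x,y,z)=f(x,y)+\frac p2\|x-z\|^2$ and $V(x,y,z)=\hat f(x,y,z)-2\min_{x'}\hat f(x',y,z)+2\min_{x'}\max_{y'\in Y}\hat f(x',y',z)$, and let $\Delta>0$ satisfy $V(x_0,y_0,z_0)-\Phi^*\le\Delta$. **Theorem.** Assume $m=M$ or $\sigma_G=0$. There are constants $0<a\le A$, $c>0$, $C>0$ that depend only on $l,\Delta,\sigma,\sigma_G,G_y$ (not on $\mu,\epsilon,m,M$, the dimensions or the problem) such that the following holds for every $\epsilon>0$. Let $T,K\in\mathbb N$ with $a\kappa\epsilon^{-2}\le T\le A\kappa\epsilon^{-2}$ and $a\kappa m^{-1}\epsilon^{-2}\le K\le A\kappa m^{-1}\epsilon^{-2}$; such $T,K$ exist whenever $m\epsilon^2\le\kappa$. Let $p=2l$, $\eta_x=\min\{\frac1{1000Kl},\frac{\sqrt{m\Delta}}{\sigma\sqrt{KTl}}\}$,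 $\eta_y=\eta_x/256$, $\beta=\eta_yK\mu/80000$, and let $$0<\eta_{x,l}\le\min\Big\{\tfrac1{2l\sqrt{2(2K-1)(K-1)}},\ \sqrt{\tfrac{\beta}{6144\,\eta_x p\,l^2K^3}},\ c\,\tfrac{\epsilon\sqrt{\kappa^{-1}(\sigma_G^2+\sigma^2)}}{Kl}\Big\},\qquad 0<\eta_{y,l}\le\min\Big\{\tfrac1{2l\sqrt{2(2K-1)(K-1)}},\ \sqrt{\tfrac{\eta_y}{3072\,\eta_x l^2K^2}},\ c\,\tfrac{\epsilon\sqrt{\kappa^{-1}(\sigma_G^2+\sigma^2)}}{Kl}\Big\}$$ (the first bound is void for $K=1$; such step sizes exist). Then FESS-GDA finds an $(\epsilon,\epsilon/\sqrt\kappa)$-stationary point of $f$, in the following sense: $$\frac1T\sum_{t=0}^{T-1}\mathbb E\|\nabla_xf(x_t,y_t)\|^2\le\epsilon^2,\qquad \frac1T\sum_{t=0}^{T-1}\mathbb E\Big[l^2\big\|P_Y(y_t+\tfrac1l\nabla_yf(x_t,y_t))-y_t\big\|^2\Big]\le\frac{\epsilon^2}{\kappa}$$ (with all these expectations finite), and an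 iterate $(x_\tau,y_\tau)$ with $\tau$ uniform on $\{0,\dots,T-1\}$ is an $(\epsilon,\epsilon/\sqrt\kappa)$-stationary point of $f$ with probability at least $1/2$. Each client uses at most $C\kappa^2m^{-1}\epsilon^{-4}$ samples, and there are at most $C\kappa\epsilon^{-2}$ communication rounds. -/

import Mathlib

open MeasureTheory ProbabilityTheory

noncomputable section

namespace FedMinimax

/-- Euclidean space `ℝ^d`. -/
abbrev E (d : ℕ) : Type := EuclideanSpace ℝ (Fin d)

variable {M d₁ d₂ : ℕ} {Ξ : Type*}

/-! ### Gradients, projection, stationarity -/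

/-- Partial gradient `∇_x g(x, y)`. -/
def gradX (g : E d₁ → E d₂ → ℝ) (x : E d₁) (y : E d₂) : E d₁ :=
  gradient (fun x' => g x' y) x

/-- Partial gradient `∇_y g(x, y)`. -/
def gradY (g : E d₁ → E d₂ → ℝ) (x : E d₁) (y : E d₂) : E d₂ :=
  gradient (fun y' => g x y') y

/-- Full gradient `∇g(x, y) = (∇_x g(x, y), ∇_y g(x, y))` in the Euclidean product space. -/
def grad (g : E d₁ → E d₂ → ℝ) (x : E d₁) (y : E d₂) : WithLp 2 (E d₁ × E d₂) :=
  WithLp.toLp 2 (gradX g x y, gradY g x y)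

/-- Euclidean projection `P_Y(y)`, a minimizer of `‖y - y'‖` over `y' ∈ Y`
(it exists and is unique when `Y` is nonempty, closed and convex). -/
def proj (Y : Set (E d₂)) (y : E d₂) : E d₂ :=
  Classical.epsilon fun v => v ∈ Y ∧ ∀ u ∈ Y, ‖y - v‖ ≤ ‖y - u‖

/-- The stationarity residual in `y`: `l ‖P_Y(y + (1/l) ∇_y f(x, y)) - y‖`. -/
def residualY (f : E d₁ → E d₂ → ℝ) (Y : Set (E d₂)) (l : ℝ) (x : E d₁) (y : E d₂) : ℝ :=
  l * ‖proj Y (y + (1 / l) • gradY f x y) - y‖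

/-- `(x, y)` is an `(ε₁, ε₂)`-stationary point of `f`. -/
def IsStationaryPoint (f : E d₁ → E d₂ → ℝ) (Y : Set (E d₂)) (l ε₁ ε₂ : ℝ)
    (x : E d₁) (y : E d₂) : Prop :=
  ‖gradX f x y‖ ≤ ε₁ ∧ residualY f Y l x y ≤ ε₂

/-! ### The federated minimax problem -/

/-- Data of `min_{x ∈ ℝ^{d₁}} max_{y ∈ Y} (1/M) ∑ᵢ 𝔼_{ξ ∼ Dᵢ} [lossᵢ(x, y; ξ)]`. -/
structure Problem (M d₁ d₂ : ℕ) (Ξ : Type*) [MeasurableSpace Ξ] where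
  Y : Set (E d₂)
  D : Fin M → Measure Ξ
  loss : Fin M → Ξ → E d₁ → E d₂ → ℝ

namespace Problem

variable [MeasurableSpace Ξ] (q : Problem M d₁ d₂ Ξ)

/-- Local objective `f_i(x, y) = 𝔼_{ξ ∼ D_i} [loss_i(x, y; ξ)]`. -/
def localObj (i : Fin M) (x : E d₁) (y : E d₂) : ℝ := ∫ ξ, q.loss i ξ x y ∂(q.D i)

/-- Global objective `f = (1/M) ∑ᵢ f_i`. -/
def obj (x : E d₁) (y : E d₂) : ℝ := (M : ℝ)⁻¹ * ∑ i, q.localObj i x y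

/-- `Φ(x) = max_{y ∈ Y} f(x, y)`. -/
def Phi (x : E d₁) : ℝ := ⨆ y : q.Y, q.obj x y

/-- `f̂(x, y, z) = f(x, y) + (p/2) ‖x - z‖²`. -/
def fHat (p : ℝ) (x : E d₁) (y : E d₂) (z : E d₁) : ℝ := q.obj x y + p / 2 * ‖x - z‖ ^ 2

/-- `Ψ(y, z) = min_x f̂(x, y, z)`. -/
def Psi (p : ℝ) (y : E d₂) (z : E d₁) : ℝ := ⨅ x : E d₁, q.fHat p x y z

/-- `P(z) = min_x max_{y ∈ Y} f̂(x, y, z)`. -/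
def PEnv (p : ℝ) (z : E d₁) : ℝ := ⨅ x : E d₁, ⨆ y : q.Y, q.fHat p x y z

/-- Potential `V(x, y, z) = f̂(x, y, z) - 2 Ψ(y, z) + 2 P(z)`. -/
def potential (p : ℝ) (x : E d₁) (y : E d₂) (z : E d₁) : ℝ :=
  q.fHat p x y z - 2 * q.Psi p y z + 2 * q.PEnv p z

/-- What the setting takes for granted: the `D_i` are probability laws, the losses have finite
means, are differentiable, and their gradients are jointly measurable in the point and the data. -/
structure WellPosed : Prop where
  prob : ∀ i, IsProbabilityMeasure (q.D i)
  integrable : ∀ i x, ∀ y ∈ q.Y, Integrable (fun ξ => q.loss i ξ x y) (q.D i)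
  differentiable : ∀ i ξ x, ∀ y ∈ q.Y,
    DifferentiableAt ℝ (fun w : E d₁ × E d₂ => q.loss i ξ w.1 w.2) (x, y)
  measurable_gradX : ∀ i,
    Measurable fun w : (E d₁ × q.Y) × Ξ => gradX (q.loss i w.2) w.1.1 (w.1.2 : E d₂)
  measurable_gradY : ∀ i,
    Measurable fun w : (E d₁ × q.Y) × Ξ => gradY (q.loss i w.2) w.1.1 (w.1.2 : E d₂)

/-- Each `f_i` is differentiable with `l`-Lipschitz gradient on `ℝ^{d₁} × Y`. -/
structure LipschitzSmooth (l : ℝ) : Prop where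
  differentiable : ∀ i x, ∀ y ∈ q.Y,
    DifferentiableAt ℝ (fun w : E d₁ × E d₂ => q.localObj i w.1 w.2) (x, y)
  lipschitz : ∀ i x₁ x₂, ∀ y₁ ∈ q.Y, ∀ y₂ ∈ q.Y,
    ‖grad (q.localObj i) x₁ y₁ - grad (q.localObj i) x₂ y₂‖ ≤ l * (‖x₁ - x₂‖ + ‖y₁ - y₂‖)

/-- Stochastic gradients are unbiased with variance at most `σ²`. -/
structure BoundedVariance (σ : ℝ) : Prop where
  integrable : ∀ i x, ∀ y ∈ q.Y, Integrable (fun ξ => grad (q.loss i ξ) x y) (q.D i)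
  unbiased : ∀ i x, ∀ y ∈ q.Y,
    ∫ ξ, grad (q.loss i ξ) x y ∂(q.D i) = grad (q.localObj i) x y
  integrable_sq : ∀ i x, ∀ y ∈ q.Y,
    Integrable (fun ξ => ‖grad (q.loss i ξ) x y - grad (q.localObj i) x y‖ ^ 2) (q.D i)
  variance : ∀ i x, ∀ y ∈ q.Y,
    ∫ ξ, ‖grad (q.loss i ξ) x y - grad (q.localObj i) x y‖ ^ 2 ∂(q.D i) ≤ σ ^ 2

/-- Heterogeneity bound: `‖∇f_i - ∇f‖² ≤ σ_G²` on `ℝ^{d₁} × Y`. -/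
def BoundedHeterogeneity (σG : ℝ) : Prop :=
  ∀ i x, ∀ y ∈ q.Y, ‖grad (q.localObj i) x y - grad q.obj x y‖ ^ 2 ≤ σG ^ 2

/-- `f` is `G_y`-Lipschitz in `y` on `Y`. -/
def LipschitzInY (Gy : ℝ) : Prop :=
  ∀ x, ∀ y ∈ q.Y, ∀ y' ∈ q.Y, |q.obj x y - q.obj x y'| ≤ Gy * ‖y - y'‖

/-- `f` is `μ`-strongly concave in `y` on `Y`. -/
def StronglyConcaveInY (μ : ℝ) : Prop :=
  ∀ x, ∀ y ∈ q.Y, ∀ y' ∈ q.Y,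
    q.obj x y ≤ q.obj x y' + inner ℝ (gradY q.obj x y') (y - y') - μ / 2 * ‖y - y'‖ ^ 2

end Problem

/-! ### The algorithm FESS-GDA -/

/-- Inputs of the algorithm: local rates `ηxl, ηyl`, global rates `ηxg, ηyg`, smoothing
parameters `β, p`, number `K` of local steps and number `m` of clients sampled per round. -/
structure Params where
  ηxl : ℝ
  ηyl : ℝ
  ηxg : ℝ
  ηyg : ℝ
  β : ℝ
  p : ℝ
  K : ℕ
  m : ℕ

/-- State of a client during its local loop: the local iterate `(x, y)`, the point `v` obtained
from the received `y_t` by adding up the local increments `η_{y,l} ∇_y f_i(x^k, y^k; ξ^k)`,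
and the number of data samples used. -/
structure LocalState (d₁ d₂ : ℕ) where
  x : E d₁
  y : E d₂
  v : E d₂
  samples : ℕ

/-- State of the system: server variables `(x_t, y_t, z_t)`, the number of communication rounds,
and the number of data samples each client has used. -/
structure State (M d₁ d₂ : ℕ) where
  x : E d₁
  y : E d₂
  z : E d₁
  comm : ℕ
  samples : Fin M → ℕ

variable [MeasurableSpace Ξ]

/-- The local loop of client `i`, after `k` steps with data `ξ 0, …, ξ (k - 1)`. -/
def localRun (q : Problem M d₁ d₂ Ξ) (par : Params) (i : Fin M) (x : E d₁) (y : E d₂)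
    (ξ : ℕ → Ξ) : ℕ → LocalState d₁ d₂
  | 0 => ⟨x, y, y, 0⟩
  | k + 1 =>
    let s := localRun q par i x y ξ k
    { x := s.x - par.ηxl • gradX (q.loss i (ξ k)) s.x s.y
      y := proj q.Y (s.y + par.ηyl • gradY (q.loss i (ξ k)) s.x s.y)
      v := s.v + par.ηyl • gradY (q.loss i (ξ k)) s.x s.y
      samples := s.samples + 1 }

/-- FESS-GDA after `t` rounds; `S t` is the set of clients sampled in round `t`, and `ξ t i k` the
`k`-th data point drawn by client `i` in round `t`. -/
def run (q : Problem M d₁ d₂ Ξ) (par : Params) (x₀ : E d₁) (y₀ : E d₂) (z₀ : E d₁)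
    (S : ℕ → Finset (Fin M)) (ξ : ℕ → Fin M → ℕ → Ξ) : ℕ → State M d₁ d₂
  | 0 => ⟨x₀, y₀, z₀, 0, fun _ => 0⟩
  | t + 1 =>
    let s := run q par x₀ y₀ z₀ S ξ t
    let loc := fun i => localRun q par i s.x s.y (ξ t i) par.K
    let x' := s.x + par.ηxg • ((par.m : ℝ)⁻¹ • (∑ i ∈ S t, (loc i).x) - s.x)
      - (par.ηxl * par.ηxg * par.K * par.p) • (s.x - s.z)
    { x := x'
      y := proj q.Y (s.y + par.ηyg • ((par.m : ℝ)⁻¹ • (∑ i ∈ S t, (loc i).v) - s.y))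
      z := s.z + par.β • (x' - s.z)
      comm := s.comm + 1
      samples := fun i => s.samples i + if i ∈ S t then (loc i).samples else 0 }

/-- The randomness of the algorithm: in every round a uniformly random `m`-element set of clients
and fresh data `ξ t i k ∼ D_i`, all independent. -/
structure IsSampling {Ω : Type*} [MeasurableSpace Ω] (P : Measure Ω) (q : Problem M d₁ d₂ Ξ)
    (m : ℕ) (S : ℕ → Ω → Finset (Fin M)) (ξ : ℕ → Fin M → ℕ → Ω → Ξ) : Prop where
  measurable_set : ∀ t, Measurable (S t)
  measurable_data : ∀ t i k, Measurable (ξ t i k)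
  set_law : ∀ t (s : Finset (Fin M)),
    P {ω | S t ω = s} = if s.card = m then ((M.choose m : ℕ) : ENNReal)⁻¹ else 0
  data_law : ∀ t i k, P.map (ξ t i k) = q.D i
  indep_rounds :
    iIndepFun (fun (t : ℕ) (ω : Ω) => (S t ω, fun (i : Fin M) (k : ℕ) => ξ t i k ω)) P
  indep_set_data : ∀ t, IndepFun (S t) (fun (ω : Ω) (i : Fin M) (k : ℕ) => ξ t i k ω) P
  indep_data : ∀ t, iIndepFun (fun (j : Fin M × ℕ) => ξ t j.1 j.2) P

/-! ### Parameter choice -/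

/-- `T` is between `a κ ε⁻²` and `A κ ε⁻²`, and `K` is between `a κ m⁻¹ ε⁻²` and `A κ m⁻¹ ε⁻²`. -/
structure LoopLengths (a A κ ε : ℝ) (m T K : ℕ) : Prop where
  T_lower : a * (κ / ε ^ 2) ≤ T
  T_upper : (T : ℝ) ≤ A * (κ / ε ^ 2)
  K_lower : a * (κ / (m * ε ^ 2)) ≤ K
  K_upper : (K : ℝ) ≤ A * (κ / (m * ε ^ 2))

/-- The prescribed step sizes, with `η_x = η_{x,g} η_{x,l}`, `η_y = η_{y,g} η_{y,l}`. The bound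
`η ≤ 1 / (2 l √(2 (2K - 1) (K - 1)))` is written without division, as it is void for `K = 1`. -/
structure StepRule (l μ Δ σ σG ε c : ℝ) (T : ℕ) (par : Params) : Prop where
  ηxl_pos : 0 < par.ηxl
  ηyl_pos : 0 < par.ηyl
  p_eq : par.p = 2 * l
  ηx_eq : par.ηxg * par.ηxl =
    min (1 / (1000 * par.K * l)) (√(par.m * Δ) / (σ * √(par.K * T * l)))
  ηy_eq : par.ηyg * par.ηyl = par.ηxg * par.ηxl / 256
  β_eq : par.β = par.ηyg * par.ηyl * par.K * μ / 80000
  ηxl_le₁ : par.ηxl * (2 * l * √(2 * (2 * par.K - 1) * (par.K - 1))) ≤ 1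
  ηxl_le₂ : par.ηxl ≤ √(par.β / (6144 * (par.ηxg * par.ηxl) * par.p * l ^ 2 * par.K ^ 3))
  ηxl_le₃ : par.ηxl ≤ c * (ε * √((l / μ)⁻¹ * (σG ^ 2 + σ ^ 2)) * (par.K * l)⁻¹)
  ηyl_le₁ : par.ηyl * (2 * l * √(2 * (2 * par.K - 1) * (par.K - 1))) ≤ 1
  ηyl_le₂ : par.ηyl ≤
    √(par.ηyg * par.ηyl / (3072 * (par.ηxg * par.ηxl) * l ^ 2 * par.K ^ 2))
  ηyl_le₃ : par.ηyl ≤ c * (ε * √((l / μ)⁻¹ * (σG ^ 2 + σ ^ 2)) * (par.K * l)⁻¹)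

end FedMinimax

end

/-! One round of FESS-GDA is an inexact step of smoothed gradient descent ascent on `f`. With `α =
η_x K`, the server moves `x` along `∇_x f + p(x - z)` plus an error, moves `y` by a projected ascent
step of length `γ = α / 256`, and pulls `z` towards `x`. The proof shows that the potential `V`
drops in each round by `α` times a stationarity gap, up to `α` times the squared error. It then
bounds the expected error and telescopes.

Deterministic part (`potential_step`). Since `p = 2l`, `f̂` is `l`-strongly convex and `3l`-smooth
in `x` although `f` need not be convex, so inner minimizers exist and are Lipschitz in `y` and in
`z`. Writing `V = (f̂ - Ψ) + (P - Ψ) + P` shows `V ≥ Φ*`. The `x` step lowers `f̂`. In the `y` step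
`f̂` changes by at most about `⟨∇_y f, y' - y⟩`, while `-2Ψ` changes by about minus twice that. The
net term `-⟨∇_y f, y' - y⟩` is at most `-‖y' - y‖² / γ` up to error, because the step is projected.
In the `z` step `f̂` loses `lβ‖x' - z‖²`, against a cross term containing the distance between the
minimizers that define `Ψ` and `P`. Strong concavity bounds the square of that distance by `1 /
(lμ)` times a squared projected-gradient residual (`obj_sub_le_of_proj_step` with the growth in
`exists_PEnv_eq`). Choosing `β` proportional to `αμ` lets Young's inequality absorb the cross term.
This is why `‖∇_x f‖²` enters the gap with weight `μ / l = 1 / κ`.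

Stochastic part. The error is averaged noise plus client drift; when `m = M` or `σ_G = 0` the
sampled clients' exact gradients at the server point average to `∇f`. The noise vectors of a round
are pairwise orthogonal in `L²`, so their average has second moment at most `σ² / (mK)`
(`maskedNoise_moments`, `integral_roundError_le`). Drift obeys a discrete Grönwall bound
(`localDrift_le`). It contains `‖∇_x f‖`, which has no a priori bound and is absorbed into the
descent through the smallness of `η_{x,l}`.

Telescoping bounds the mean gap by `Δ / (αT) + 2ρ` (`sum_integral_gap_le`). Both `αT` and `mK` are
at least of order `κ / ε²`, so for `a` large and `c` small the mean gap is a small multiple of `ε² /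
κ`. A spare factor 4 in both measures gives probability one half by Markov's inequality. -/

noncomputable section

namespace FedMinimax

/-! ### Smooth functions along segments -/

/-- A function on `[0, 1]` whose derivative grows at most linearly away from its value at `0`
is close to its first-order expansion. -/
theorem abs_sub_sub_deriv_le {g g' : ℝ → ℝ} {L : ℝ}
    (hg : ∀ t ∈ Set.Icc (0 : ℝ) 1, HasDerivAt g (g' t) t)
    (hL : ∀ t ∈ Set.Icc (0 : ℝ) 1, |g' t - g' 0| ≤ L * t) :
    |g 1 - g 0 - g' 0| ≤ L / 2 := by
  -- Both signs at once: subtracting `s` times the linearized error from `L t² / 2` leaves a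
  -- function with nonnegative derivative.
  have key : ∀ s : ℝ, (s = 1 ∨ s = -1) → s * (g 1 - g 0 - g' 0) ≤ L / 2 := by
    intro s hs
    have hmono : MonotoneOn (fun t => L / 2 * t ^ 2 - s * (g t - t * g' 0)) (Set.Icc 0 1) := by
      have hd : ∀ t ∈ Set.Icc (0 : ℝ) 1, HasDerivAt (fun t => L / 2 * t ^ 2 - s * (g t - t * g' 0))
          (L * t - s * (g' t - g' 0)) t := by
        intro t ht
        have h1 := (((hasDerivAt_pow 2 t).const_mul (L / 2)).sub
          (((hg t ht).sub ((hasDerivAt_id t).mul_const (g' 0))).const_mul s))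
        exact h1.congr_deriv (by push_cast; ring)
      refine monotoneOn_of_deriv_nonneg (convex_Icc 0 1)
        (fun t ht => (hd t ht).continuousAt.continuousWithinAt) ?_ ?_
      · intro t ht
        rw [interior_Icc] at ht
        exact (hd t (Set.Ioo_subset_Icc_self ht)).differentiableAt.differentiableWithinAt
      · intro t ht
        rw [interior_Icc] at ht
        have ht' := Set.Ioo_subset_Icc_self ht
        rw [(hd t ht').deriv]
        have := abs_le.1 (hL t ht')
        rcases hs with rfl | rfl <;> linarith [this.1, this.2]
    have := hmono (Set.left_mem_Icc.2 zero_le_one) (Set.right_mem_Icc.2 zero_le_one) zero_le_one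
    simp only at this
    linarith
  rw [abs_le]
  constructor
  · linarith [key (-1) (Or.inr rfl)]
  · linarith [key 1 (Or.inl rfl)]

/-- First-order expansion of a function with Lipschitz gradient on a convex set. -/
theorem abs_sub_sub_inner_gradient_le {F : Type*} [NormedAddCommGroup F] [InnerProductSpace ℝ F]
    [CompleteSpace F] {h : F → ℝ} {s : Set F} (hs : Convex ℝ s) {L : ℝ}
    (hd : ∀ w ∈ s, DifferentiableAt ℝ h w) {a b : F} (ha : a ∈ s) (hb : b ∈ s)
    (hL : ∀ w ∈ s, ‖gradient h w - gradient h a‖ ≤ L * ‖w - a‖) :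
    |h b - h a - inner ℝ (gradient h a) (b - a)| ≤ L / 2 * ‖b - a‖ ^ 2 := by
  have hmem : ∀ t ∈ Set.Icc (0 : ℝ) 1, a + t • (b - a) ∈ s := fun t ht =>
    hs.add_smul_sub_mem ha hb ht
  have hder : ∀ t ∈ Set.Icc (0 : ℝ) 1, HasDerivAt (fun t : ℝ => h (a + t • (b - a)))
      (inner ℝ (gradient h (a + t • (b - a))) (b - a)) t := by
    intro t ht
    have h1 := (hd _ (hmem t ht)).hasGradientAt.hasFDerivAt
    have h2 : HasDerivAt (fun t : ℝ => a + t • (b - a)) (b - a) t := by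
      simpa using ((hasDerivAt_id t).smul_const (b - a)).const_add a
    have h3 := h1.comp_hasDerivAt t h2
    rw [InnerProductSpace.toDual_apply_apply] at h3
    exact h3
  have := abs_sub_sub_deriv_le (L := L * ‖b - a‖ ^ 2) hder (by
    intro t ht
    rw [zero_smul, add_zero, ← inner_sub_left]
    refine (abs_real_inner_le_norm _ _).trans ?_
    have h3 := hL _ (hmem t ht)
    rw [add_sub_cancel_left, norm_smul, Real.norm_of_nonneg ht.1] at h3
    calc _ ≤ L * (t * ‖b - a‖) * ‖b - a‖ := by gcongr
      _ = _ := by ring)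
  simp only [one_smul, zero_smul, add_zero, add_sub_cancel] at this
  linarith

/-! ### Euclidean projection -/

section Projection

variable {d : ℕ} {Y : Set (E d)}

theorem proj_spec (hne : Y.Nonempty) (hc : IsCompact Y) (v : E d) :
    proj Y v ∈ Y ∧ ∀ u ∈ Y, ‖v - proj Y v‖ ≤ ‖v - u‖ := by
  have : ∃ w, w ∈ Y ∧ ∀ u ∈ Y, ‖v - w‖ ≤ ‖v - u‖ :=
    hc.exists_isMinOn hne (f := fun u => ‖v - u‖) (by fun_prop)
  exact Classical.epsilon_spec this

theorem proj_mem (hne : Y.Nonempty) (hc : IsCompact Y) (v : E d) : proj Y v ∈ Y :=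
  (proj_spec hne hc v).1

theorem inner_sub_proj_le (hne : Y.Nonempty) (hc : IsCompact Y) (hconv : Convex ℝ Y) (v : E d)
    {u : E d} (hu : u ∈ Y) : inner ℝ (v - proj Y v) (u - proj Y v) ≤ 0 := by
  obtain ⟨hm, hmin⟩ := proj_spec hne hc v
  refine (norm_eq_iInf_iff_real_inner_le_zero hconv hm).1 ?_ u hu
  have : Nonempty Y := hne.to_subtype
  refine le_antisymm (le_ciInf fun w => hmin w w.2) ?_
  exact ciInf_le ⟨0, by rintro _ ⟨w, rfl⟩; exact norm_nonneg _⟩ (⟨_, hm⟩ : Y)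

theorem norm_proj_sub_proj_le (hne : Y.Nonempty) (hc : IsCompact Y) (hconv : Convex ℝ Y)
    (v w : E d) : ‖proj Y v - proj Y w‖ ≤ ‖v - w‖ := by
  have h1 := inner_sub_proj_le hne hc hconv v (proj_mem hne hc w)
  have h2 := inner_sub_proj_le hne hc hconv w (proj_mem hne hc v)
  have h3 : ‖proj Y v - proj Y w‖ ^ 2 ≤ inner ℝ (v - w) (proj Y v - proj Y w) := by
    rw [← real_inner_self_eq_norm_sq]
    simp only [inner_sub_left, inner_sub_right] at *
    linarith [real_inner_comm (proj Y v) (proj Y w)]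
  have h4 := real_inner_le_norm (v - w) (proj Y v - proj Y w)
  by_contra! hlt
  nlinarith [norm_nonneg (v - w)]

theorem continuous_proj (hne : Y.Nonempty) (hc : IsCompact Y) (hconv : Convex ℝ Y) :
    Continuous (proj Y) :=
  (LipschitzWith.of_dist_le_mul (K := 1) fun v w => by
    simpa [dist_eq_norm] using norm_proj_sub_proj_le hne hc hconv v w).continuous

/-- A projected step moves by at least its squared length in the direction of the gradient. -/
theorem norm_sq_proj_step_le (hne : Y.Nonempty) (hc : IsCompact Y) (hconv : Convex ℝ Y)
    {y : E d} (hy : y ∈ Y) (g : E d) (γ : ℝ) :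
    ‖proj Y (y + γ • g) - y‖ ^ 2 ≤ γ * inner ℝ g (proj Y (y + γ • g) - y) := by
  have h := inner_sub_proj_le hne hc hconv (y + γ • g) hy
  set w := proj Y (y + γ • g)
  rw [show y + γ • g - w = γ • g - (w - y) by abel, show y - w = -(w - y) by abel, inner_neg_right,
    inner_sub_left, inner_smul_left, real_inner_self_eq_norm_sq] at h
  simp at h
  linarith

/-- The length of the gradient mapping is antitone in the step size. -/
theorem mul_norm_proj_step_le (hne : Y.Nonempty) (hc : IsCompact Y) (hconv : Convex ℝ Y)
    {y : E d} (g : E d) {γ δ : ℝ} (hγ : 0 < γ) (hγδ : γ ≤ δ) :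
    γ * ‖proj Y (y + δ • g) - y‖ ≤ δ * ‖proj Y (y + γ • g) - y‖ := by
  have hmd := proj_mem hne hc (y + δ • g)
  have hmg := proj_mem hne hc (y + γ • g)
  have h1 := inner_sub_proj_le hne hc hconv (y + δ • g) hmg
  have h2 := inner_sub_proj_le hne hc hconv (y + γ • g) hmd
  set w := proj Y (y + δ • g)
  set v := proj Y (y + γ • g)
  rw [show y + δ • g - w = δ • g - (w - y) by abel,
    show v - w = (v - y) - (w - y) by abel] at h1
  rw [show y + γ • g - v = γ • g - (v - y) by abel,
    show w - v = (w - y) - (v - y) by abel] at h2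
  generalize w - y = w' at *
  generalize v - y = v' at *
  simp only [inner_sub_left, inner_sub_right, inner_smul_left, real_inner_self_eq_norm_sq,
    conj_trivial] at h1 h2
  -- Weighting `h1` by `γ` and `h2` by `δ` cancels `g`; with Cauchy–Schwarz this gives `(γ‖w'‖ -
  -- δ‖v'‖)(‖w'‖ - ‖v'‖) ≤ 0`. The negated goal makes the first factor positive and, since `γ ≤ δ`,
  -- the second as well.
  have hcs := real_inner_le_norm v' w'
  have hcomm := real_inner_comm v' w'
  by_contra! hlt
  have hpos : 0 < ‖w'‖ := by
    by_contra! h0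
    have : ‖w'‖ = 0 := le_antisymm h0 (norm_nonneg _)
    rw [this, mul_zero] at hlt
    have : 0 ≤ δ * ‖v'‖ := mul_nonneg (hγ.le.trans hγδ) (norm_nonneg _)
    linarith
  have hlt' : ‖v'‖ < ‖w'‖ := by
    by_contra! h0
    nlinarith [mul_le_mul hγδ h0 hpos.le (hγ.le.trans hγδ)]
  nlinarith [mul_pos (sub_pos.2 hlt) (sub_pos.2 hlt'),
    mul_le_mul_of_nonneg_left hcs (add_pos hγ (hγ.trans_le hγδ)).le]

end Projection

/-! ### Smooth, strongly concave objectives -/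

theorem norm_gradX_sub_le {d₁ d₂ : ℕ} (g h : E d₁ → E d₂ → ℝ) (x x' : E d₁) (y y' : E d₂) :
    ‖gradX g x y - gradX h x' y'‖ ≤ ‖grad g x y - grad h x' y'‖ := by
  refine le_of_sq_le_sq ?_ (norm_nonneg _)
  rw [WithLp.prod_norm_sq_eq_of_L2]
  exact le_add_of_nonneg_right (sq_nonneg _)

theorem norm_gradY_sub_le {d₁ d₂ : ℕ} (g h : E d₁ → E d₂ → ℝ) (x x' : E d₁) (y y' : E d₂) :
    ‖gradY g x y - gradY h x' y'‖ ≤ ‖grad g x y - grad h x' y'‖ := by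
  refine le_of_sq_le_sq ?_ (norm_nonneg _)
  rw [WithLp.prod_norm_sq_eq_of_L2]
  exact le_add_of_nonneg_left (sq_nonneg _)

/-- A continuous function on `ℝ^d` that dominates a strongly convex quadratic has a minimizer. -/
theorem exists_forall_le_of_quadratic_le {d : ℕ} {F : E d → ℝ} (hF : Continuous F) {a G : E d}
    {c l : ℝ} (hl : 0 < l)
    (hq : ∀ x, c + inner ℝ G (x - a) + l / 2 * ‖x - a‖ ^ 2 ≤ F x) : ∃ u, ∀ x, F u ≤ F x := by
  refine hF.exists_forall_le' a ?_
  have ht : Filter.Tendsto (fun x : E d => ‖x - a‖) (Filter.cocompact _) Filter.atTop :=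
    tendsto_norm_cocompact_atTop.comp
      (Homeomorph.subRight a).isClosedEmbedding.tendsto_cocompact
  -- Beyond this radius the quadratic term beats the linear one by at least `|F a - c| * ‖x - a‖`,
  -- and `‖x - a‖ ≥ 1` turns that into `F x ≥ F a`.
  filter_upwards [ht.eventually_ge_atTop 1,
    ht.eventually_ge_atTop (2 / l * (‖G‖ + |F a - c|))] with x h1 h2
  have h3 := (abs_le.1 (abs_real_inner_le_norm G (x - a))).1
  have h4 : ‖G‖ + |F a - c| ≤ l / 2 * ‖x - a‖ := by
    have := mul_le_mul_of_nonneg_left h2 (half_pos hl).le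
    rwa [← mul_assoc, show l / 2 * (2 / l) = 1 by field_simp, one_mul] at this
  nlinarith [hq x, le_abs_self (F a - c), abs_nonneg (F a - c), norm_nonneg G,
    mul_le_mul_of_nonneg_right h4 (norm_nonneg (x - a))]

namespace Problem

variable {M d₁ d₂ : ℕ} {Ξ : Type*} [MeasurableSpace Ξ]

/-- The deterministic assumptions on the global objective: `l`-smooth on `ℝ^{d₁} × Y`, and
`μ`-strongly concave in `y` over the nonempty compact convex set `Y`. -/
structure Regular (q : Problem M d₁ d₂ Ξ) (l μ : ℝ) : Prop where
  l_pos : 0 < l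
  μ_pos : 0 < μ
  μ_le : μ ≤ l
  nonempty : q.Y.Nonempty
  convex : Convex ℝ q.Y
  compact : IsCompact q.Y
  differentiable : ∀ x, ∀ y ∈ q.Y,
    DifferentiableAt ℝ (fun w : E d₁ × E d₂ => q.obj w.1 w.2) (x, y)
  lipschitz : ∀ x₁ x₂, ∀ y₁ ∈ q.Y, ∀ y₂ ∈ q.Y,
    ‖grad q.obj x₁ y₁ - grad q.obj x₂ y₂‖ ≤ l * (‖x₁ - x₂‖ + ‖y₁ - y₂‖)
  concave : q.StronglyConcaveInY μ

namespace Regular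

variable {q : Problem M d₁ d₂ Ξ} {l μ : ℝ} (h : q.Regular l μ)

include h

theorem differentiableAt_x (x : E d₁) {y : E d₂} (hy : y ∈ q.Y) :
    DifferentiableAt ℝ (fun x' => q.obj x' y) x :=
  (h.differentiable x y hy).comp (f := fun x' : E d₁ => (x', y)) x (by fun_prop)

theorem differentiableAt_y (x : E d₁) {y : E d₂} (hy : y ∈ q.Y) :
    DifferentiableAt ℝ (fun y' => q.obj x y') y :=
  (h.differentiable x y hy).comp (f := fun y' : E d₂ => (x, y')) y (by fun_prop)

theorem continuous_obj : Continuous fun w : E d₁ × q.Y => q.obj w.1 w.2 := by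
  rw [continuous_iff_continuousAt]
  intro w
  exact ContinuousAt.comp (f := fun w : E d₁ × q.Y => (w.1, (w.2 : E d₂)))
    (h.differentiable w.1 w.2 w.2.2).continuousAt (by fun_prop)

theorem norm_gradX_sub_le {x x' : E d₁} {y y' : E d₂} (hy : y ∈ q.Y) (hy' : y' ∈ q.Y) :
    ‖gradX q.obj x y - gradX q.obj x' y'‖ ≤ l * (‖x - x'‖ + ‖y - y'‖) :=
  (FedMinimax.norm_gradX_sub_le _ _ _ _ _ _).trans (h.lipschitz _ _ _ hy _ hy')

theorem norm_gradY_sub_le {x x' : E d₁} {y y' : E d₂} (hy : y ∈ q.Y) (hy' : y' ∈ q.Y) :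
    ‖gradY q.obj x y - gradY q.obj x' y'‖ ≤ l * (‖x - x'‖ + ‖y - y'‖) :=
  (FedMinimax.norm_gradY_sub_le _ _ _ _ _ _).trans (h.lipschitz _ _ _ hy _ hy')

theorem abs_expansion_x (x u : E d₁) {y : E d₂} (hy : y ∈ q.Y) :
    |q.obj u y - q.obj x y - inner ℝ (gradX q.obj x y) (u - x)| ≤ l / 2 * ‖u - x‖ ^ 2 :=
  abs_sub_sub_inner_gradient_le (h := fun x' => q.obj x' y) convex_univ
    (fun w _ => h.differentiableAt_x w hy) (Set.mem_univ x) (Set.mem_univ u) fun w _ => by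
      simpa [gradX] using h.norm_gradX_sub_le (x := w) (x' := x) hy hy

theorem abs_expansion_y (x : E d₁) {y y' : E d₂} (hy : y ∈ q.Y) (hy' : y' ∈ q.Y) :
    |q.obj x y' - q.obj x y - inner ℝ (gradY q.obj x y) (y' - y)| ≤ l / 2 * ‖y' - y‖ ^ 2 :=
  abs_sub_sub_inner_gradient_le (h := fun y' => q.obj x y') h.convex
    (fun w hw => h.differentiableAt_y x hw) hy hy' fun w hw => by
      simpa [gradY] using h.norm_gradY_sub_le (x := x) (x' := x) hw hy

/-! ### The proximal objective `f̂` with `p = 2 l` -/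

/-- The smoothness of `f` costs `l / 2` and the proximal term contributes `p / 2 = l`; what remains
is strong convexity with modulus `l`. -/
theorem fHat_ge (x u z : E d₁) {y : E d₂} (hy : y ∈ q.Y) :
    q.fHat (2 * l) x y z + inner ℝ (gradX q.obj x y + (2 * l) • (x - z)) (u - x)
      + l / 2 * ‖u - x‖ ^ 2 ≤ q.fHat (2 * l) u y z := by
  have h1 := (abs_le.1 (h.abs_expansion_x x u hy)).1
  have h2 : ‖u - z‖ ^ 2 = ‖x - z‖ ^ 2 + 2 * inner ℝ (x - z) (u - x) + ‖u - x‖ ^ 2 := by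
    rw [← norm_add_sq_real]; congr 2; abel
  simp only [fHat, inner_add_left, inner_smul_left, conj_trivial, h2]
  linarith

theorem fHat_le (x u z : E d₁) {y : E d₂} (hy : y ∈ q.Y) :
    q.fHat (2 * l) u y z ≤ q.fHat (2 * l) x y z
      + inner ℝ (gradX q.obj x y + (2 * l) • (x - z)) (u - x) + 3 * l / 2 * ‖u - x‖ ^ 2 := by
  have h1 := (abs_le.1 (h.abs_expansion_x x u hy)).2
  have h2 : ‖u - z‖ ^ 2 = ‖x - z‖ ^ 2 + 2 * inner ℝ (x - z) (u - x) + ‖u - x‖ ^ 2 := by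
    rw [← norm_add_sq_real]; congr 2; abel
  simp only [fHat, inner_add_left, inner_smul_left, conj_trivial, h2]
  linarith

theorem continuous_fHat (z : E d₁) :
    Continuous fun w : E d₁ × q.Y => q.fHat (2 * l) w.1 w.2 z := by
  unfold fHat
  exact h.continuous_obj.add (by fun_prop)

/-- `Ψ(y, z)` is attained, at a critical point of `f̂(·, y, z)`. -/
theorem exists_Psi_eq {y : E d₂} (hy : y ∈ q.Y) (z : E d₁) :
    ∃ u, q.Psi (2 * l) y z = q.fHat (2 * l) u y z ∧
      gradX q.obj u y + (2 * l) • (u - z) = 0 := by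
  obtain ⟨u, hu⟩ := exists_forall_le_of_quadratic_le (F := fun x => q.fHat (2 * l) x y z)
    ((h.continuous_fHat z).comp (f := fun x : E d₁ => (x, (⟨y, hy⟩ : q.Y))) (by fun_prop))
    h.l_pos (fun x => h.fHat_ge 0 x z hy)
  refine ⟨u, le_antisymm (ciInf_le ⟨_, by rintro _ ⟨x, rfl⟩; exact hu x⟩ u) (le_ciInf hu), ?_⟩
  set G := gradX q.obj u y + (2 * l) • (u - z) with hG
  -- A gradient step of length `1 / (3l)`, the inverse smoothness constant of `f̂`, would lower the
  -- minimum by `‖G‖² / (6l)`; hence `G = 0`.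
  have h1 := (hu (u - (1 / (3 * l)) • G)).trans (h.fHat_le u _ z hy)
  have hl := h.l_pos
  rw [← hG, show u - (1 / (3 * l)) • G - u = -((1 / (3 * l)) • G) by abel, inner_neg_right,
    inner_smul_right, real_inner_self_eq_norm_sq, norm_neg, norm_smul, mul_pow,
    Real.norm_of_nonneg (by positivity)] at h1
  have h2 : 3 * l / 2 * ((1 / (3 * l)) ^ 2 * ‖G‖ ^ 2) = 1 / (6 * l) * ‖G‖ ^ 2 := by
    field_simp; ring
  have h3 : 1 / (3 * l) * ‖G‖ ^ 2 = 2 * (1 / (6 * l) * ‖G‖ ^ 2) := by field_simp; ring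
  have h4 : 1 / (6 * l) * ‖G‖ ^ 2 ≤ 0 := by linarith
  have h5 : 0 < 1 / (6 * l) := by positivity
  have h6 : ‖G‖ ^ 2 ≤ 0 := by
    by_contra! hc
    exact absurd h4 (not_le.2 (mul_pos h5 hc))
  simpa using le_antisymm h6 (sq_nonneg _)

theorem Psi_le (x : E d₁) {y : E d₂} (hy : y ∈ q.Y) (z : E d₁) :
    q.Psi (2 * l) y z ≤ q.fHat (2 * l) x y z := by
  obtain ⟨u, hu, h0⟩ := h.exists_Psi_eq hy z
  have h1 := h.fHat_ge u x z hy
  rw [h0, inner_zero_left] at h1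
  have := h.l_pos
  have : 0 ≤ l / 2 * ‖x - u‖ ^ 2 := by positivity
  linarith

/-- Distance to the minimizer of `f̂(·, y, z)` in terms of the gradient. -/
theorem mul_norm_sub_le {x u z : E d₁} {y : E d₂} (hy : y ∈ q.Y)
    (hu : gradX q.obj u y + (2 * l) • (u - z) = 0) :
    l * ‖u - x‖ ≤ ‖gradX q.obj x y + (2 * l) • (x - z)‖ := by
  have h1 := h.fHat_ge u x z hy
  have h2 := h.fHat_ge x u z hy
  rw [hu, inner_zero_left, norm_sub_rev] at h1
  have h3 := (abs_le.1 (abs_real_inner_le_norm (gradX q.obj x y + (2 * l) • (x - z)) (u - x))).1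
  rcases (norm_nonneg (u - x)).eq_or_lt with h0 | h0
  · rw [← h0, mul_zero]; exact norm_nonneg _
  · refine le_of_mul_le_mul_right ?_ h0
    nlinarith

/-- At the old minimizer `u` the gradient of the new objective is `∇_x f(u, y') - ∇_x f(u, y)`, of
norm at most `l‖y' - y‖`; strong convexity divides by `l`. -/
theorem norm_argmin_sub_le_y {u u' z : E d₁} {y y' : E d₂} (hy : y ∈ q.Y) (hy' : y' ∈ q.Y)
    (hu : gradX q.obj u y + (2 * l) • (u - z) = 0)
    (hu' : gradX q.obj u' y' + (2 * l) • (u' - z) = 0) : ‖u' - u‖ ≤ ‖y' - y‖ := by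
  have h1 := h.mul_norm_sub_le (x := u) hy' hu'
  rw [← sub_zero (_ + _), ← hu, add_sub_add_right_eq_sub] at h1
  have h2 := h1.trans (h.norm_gradX_sub_le (x := u) (x' := u) hy' hy)
  rw [sub_self, norm_zero, zero_add] at h2
  exact le_of_mul_le_mul_left h2 h.l_pos

/-- The same argument in `z`: the gradient at `u` is now `2l(z - z')`. -/
theorem norm_argmin_sub_le_z {u u' z z' : E d₁} {y : E d₂} (hy : y ∈ q.Y)
    (hu : gradX q.obj u y + (2 * l) • (u - z) = 0)
    (hu' : gradX q.obj u' y + (2 * l) • (u' - z') = 0) : ‖u' - u‖ ≤ 2 * ‖z' - z‖ := by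
  have h1 := h.mul_norm_sub_le (x := u) hy hu'
  rw [← sub_zero (_ + _), ← hu, add_sub_add_left_eq_sub, ← smul_sub, sub_sub_sub_cancel_left,
    norm_smul, Real.norm_of_nonneg (by linarith [h.l_pos]), norm_sub_rev z] at h1
  exact le_of_mul_le_mul_left (by linarith) h.l_pos

/-! ### The envelope `P` -/

theorem bddAbove_fHat (x z : E d₁) :
    BddAbove (Set.range fun y : q.Y => q.fHat (2 * l) x y z) := by
  have : CompactSpace q.Y := isCompact_iff_compactSpace.1 h.compact
  exact (isCompact_range ((h.continuous_fHat z).comp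
    (f := fun y : q.Y => (x, y)) (by fun_prop))).bddAbove

theorem le_iSup_fHat (x z : E d₁) {y : E d₂} (hy : y ∈ q.Y) :
    q.fHat (2 * l) x y z ≤ ⨆ y : q.Y, q.fHat (2 * l) x y z :=
  le_ciSup (h.bddAbove_fHat x z) (⟨y, hy⟩ : q.Y)

/-- `P(z)` is attained, and `max_y f̂(·, y, z)` grows quadratically around the minimizer. -/
theorem exists_PEnv_eq (z : E d₁) :
    ∃ u, q.PEnv (2 * l) z = ⨆ y : q.Y, q.fHat (2 * l) u y z ∧
      ∀ x, q.PEnv (2 * l) z + l / 4 * ‖x - u‖ ^ 2 ≤ ⨆ y : q.Y, q.fHat (2 * l) x y z := by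
  have hne : Nonempty q.Y := h.nonempty.to_subtype
  have hcs : CompactSpace q.Y := isCompact_iff_compactSpace.1 h.compact
  obtain ⟨y₀, hy₀⟩ := h.nonempty
  have hcont : Continuous fun x => ⨆ y : q.Y, q.fHat (2 * l) x y z := by
    have := isCompact_univ.continuous_sSup (f := fun (x : E d₁) (y : q.Y) => q.fHat (2 * l) x y z)
      (K := Set.univ) (h.continuous_fHat z)
    simpa only [Set.image_univ, sSup_range] using this
  obtain ⟨u, hu⟩ := exists_forall_le_of_quadratic_le hcont h.l_pos
    (fun x => (h.fHat_ge 0 x z hy₀).trans (h.le_iSup_fHat x z hy₀))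
  have hP : q.PEnv (2 * l) z = ⨆ y : q.Y, q.fHat (2 * l) u y z :=
    le_antisymm (ciInf_le ⟨_, by rintro _ ⟨x, rfl⟩; exact hu x⟩ u) (le_ciInf hu)
  refine ⟨u, hP, fun x => ?_⟩
  -- The midpoint argument: each `f̂(·, y, z)` lies below its chord at `w` by `l / 8 * ‖x - u‖²`,
  -- and this survives the supremum. Minimality at `u` then doubles it to `l / 4`.
  set w := (1 / 2 : ℝ) • (x + u) with hw
  have h1 : (⨆ y : q.Y, q.fHat (2 * l) w y z) ≤
      ((⨆ y : q.Y, q.fHat (2 * l) x y z) + ⨆ y : q.Y, q.fHat (2 * l) u y z) / 2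
        - l / 8 * ‖x - u‖ ^ 2 := by
    refine ciSup_le fun y => ?_
    have a1 := h.fHat_ge w x z y.2
    have a2 := h.fHat_ge w u z y.2
    have a3 := h.le_iSup_fHat x z y.2
    have a4 := h.le_iSup_fHat u z y.2
    have e1 : x - w = (1 / 2 : ℝ) • (x - u) := by rw [hw]; module
    have e2 : u - w = -((1 / 2 : ℝ) • (x - u)) := by rw [hw]; module
    rw [e1, norm_smul] at a1
    rw [e2, inner_neg_right, norm_neg, norm_smul] at a2
    norm_num at a1 a2
    nlinarith
  have h2 := hu w
  rw [hP]
  linarith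

theorem Psi_le_PEnv {y : E d₂} (hy : y ∈ q.Y) (z : E d₁) :
    q.Psi (2 * l) y z ≤ q.PEnv (2 * l) z :=
  le_ciInf fun x => (h.Psi_le x hy z).trans (h.le_iSup_fHat x z hy)

/-- The potential is bounded below by any lower bound of `Φ`. -/
theorem le_potential {Φstar : ℝ} (hΦ : ∀ x, Φstar ≤ q.Phi x) (x z : E d₁) {y : E d₂}
    (hy : y ∈ q.Y) : Φstar ≤ q.potential (2 * l) x y z := by
  have hne : Nonempty q.Y := h.nonempty.to_subtype
  have h1 : Φstar ≤ q.PEnv (2 * l) z := by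
    refine le_ciInf fun u => (hΦ u).trans (ciSup_mono (h.bddAbove_fHat u z) fun y => ?_)
    have := h.l_pos
    exact le_add_of_nonneg_right (by positivity)
  have h2 := h.Psi_le_PEnv hy z
  have h3 := h.Psi_le x hy z
  unfold potential
  linarith

end Regular

end Problem

/-! ### Decrease of the potential in one inexact step -/

/-- Scalar bookkeeping for one step of the potential. -/
theorem potential_step_scalar {a e₁ e₂ δ W D R r N g lam ρ β : ℝ}
    (ha : 0 ≤ a) (he₁ : 0 ≤ e₁) (hδ : 0 ≤ δ) (hR0 : 0 ≤ R)
    (hr0 : 0 ≤ r) (hN0 : 0 ≤ N) (hg0 : 0 ≤ g)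
    (hlam0 : 0 ≤ lam) (hlam : lam ≤ 1 / 1000) (hρ0 : 0 ≤ ρ) (hρ1 : ρ ≤ 1) (hβ : β ≤ 1 / 1000)
    (hD : ρ * D ^ 2 ≤ 2 * R ^ 2) (hR : R ≤ (1 + 2 * lam / 256) * δ + a + e₂)
    (hr : r ≤ δ + e₂) (hN : N ≤ W + lam * (a + e₁)) (hg : g ≤ a + 2 * N) :
    -a ^ 2 + a * e₁ + 3 * lam * (a ^ 2 + e₁ ^ 2) - δ ^ 2 / 256 + e₂ * δ / 256
      + lam * (a + e₁) * δ / 256 + 2 * a * δ / 256 + 2 * lam * δ ^ 2 / 256 ^ 2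
      - ρ * W ^ 2 / 20480000 + 4 * ρ * W * (2 * β * W + D) / 20480000
    ≤ -(1 / 500000000 * ρ * g ^ 2 + r ^ 2 / 2000) + 2 * (e₁ ^ 2 + e₂ ^ 2) := by
  have h1 : a * e₁ ≤ a ^ 2 / 4 + e₁ ^ 2 := by nlinarith [sq_nonneg (a / 2 - e₁)]
  have h2 : 3 * lam * (a ^ 2 + e₁ ^ 2) ≤ 3 / 1000 * (a ^ 2 + e₁ ^ 2) := by
    have : 0 ≤ a ^ 2 + e₁ ^ 2 := by positivity
    nlinarith
  have h3 : e₂ * δ ≤ δ ^ 2 / 4 + e₂ ^ 2 := by nlinarith [sq_nonneg (δ / 2 - e₂)]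
  have h4 : lam * (a + e₁) * δ ≤ 1 / 1000 * (a ^ 2 + e₁ ^ 2 + δ ^ 2) := by
    have h41 : (a + e₁) * δ ≤ a ^ 2 + e₁ ^ 2 + δ ^ 2 := by
      linarith [sq_nonneg (a - δ), sq_nonneg (e₁ - δ), sq_nonneg a, sq_nonneg e₁]
    have h42 : 0 ≤ (a + e₁) * δ := by positivity
    have h43 := mul_le_mul_of_nonneg_right hlam h42
    linarith
  have h5 : 2 * a * δ ≤ δ ^ 2 / 4 + 4 * a ^ 2 := by nlinarith [sq_nonneg (δ / 2 - 2 * a)]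
  have h6 : lam * δ ^ 2 ≤ 1 / 1000 * δ ^ 2 := by nlinarith [sq_nonneg δ]
  -- Young's inequality with weight 6: a third of the `W²` budget is spent, and `ρD²` is traded for
  -- the residual `R²` through the error bound `hD`.
  have h7 : 4 * ρ * W * D ≤ ρ * W ^ 2 / 3 + 24 * R ^ 2 := by
    have := mul_nonneg hρ0 (sq_nonneg (W - 6 * D))
    nlinarith
  have h8 : ρ * W ^ 2 * β ≤ ρ * W ^ 2 / 1000 := by
    have : 0 ≤ ρ * W ^ 2 := by positivity
    nlinarith
  have h9 : R ^ 2 ≤ 4 * (δ ^ 2 + a ^ 2 + e₂ ^ 2) := by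
    have hR' : R ≤ 101 / 100 * δ + a + e₂ := by nlinarith
    have : R ^ 2 ≤ (101 / 100 * δ + a + e₂) ^ 2 := by gcongr
    have h91 : (101 / 100 * δ + a + e₂) ^ 2 ≤ 3 * ((101 / 100 * δ) ^ 2 + a ^ 2 + e₂ ^ 2) := by
      linarith [sq_nonneg (101 / 100 * δ - a), sq_nonneg (101 / 100 * δ - e₂), sq_nonneg (a - e₂)]
    linarith [sq_nonneg δ, sq_nonneg a, sq_nonneg e₂]
  have h10 : r ^ 2 ≤ 2 * δ ^ 2 + 2 * e₂ ^ 2 := by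
    have : r ^ 2 ≤ (δ + e₂) ^ 2 := by gcongr
    linarith [sq_nonneg (δ - e₂)]
  have h11 : N ^ 2 ≤ 2 * W ^ 2 + 4 / 1000000 * (a ^ 2 + e₁ ^ 2) := by
    have h111 : lam * (a + e₁) ≤ 1 / 1000 * (a + e₁) := by gcongr
    have : N ^ 2 ≤ (W + lam * (a + e₁)) ^ 2 := by gcongr
    have h112 : (lam * (a + e₁)) ^ 2 ≤ (1 / 1000 * (a + e₁)) ^ 2 := by gcongr
    linarith [sq_nonneg (W - lam * (a + e₁)), sq_nonneg (a - e₁)]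
  have h12 : g ^ 2 ≤ 2 * a ^ 2 + 8 * N ^ 2 := by
    have : g ^ 2 ≤ (a + 2 * N) ^ 2 := by gcongr
    linarith [sq_nonneg (a - 2 * N)]
  -- The factor 16 fixes the rate in the goal: after `h7` and `h8` the share `1 - 1/3 - 8/1000` of
  -- `ρW² / 20480000` remains, just above `16 / 500000000`.
  have h13 : ρ * g ^ 2 ≤ 16 * (ρ * W ^ 2) + 3 * (a ^ 2 + e₁ ^ 2) := by
    have h131 : g ^ 2 ≤ 16 * W ^ 2 + 3 * (a ^ 2 + e₁ ^ 2) := by linarith [sq_nonneg a, sq_nonneg e₁]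
    have h132 := mul_le_mul_of_nonneg_left h131 hρ0
    have h133 := mul_le_mul_of_nonneg_right hρ1 (show 0 ≤ 3 * (a ^ 2 + e₁ ^ 2) by positivity)
    linarith
  linarith [sq_nonneg a, sq_nonneg e₁, sq_nonneg e₂, sq_nonneg δ, mul_nonneg hρ0 (sq_nonneg W)]

namespace Problem.Regular

variable {M d₁ d₂ : ℕ} {Ξ : Type*} [MeasurableSpace Ξ] {q : Problem M d₁ d₂ Ξ} {l μ : ℝ}
  (h : q.Regular l μ)

include h

/-- Optimality gap in `y` after a projected step. -/
theorem obj_sub_le_of_proj_step (u : E d₁) {y y' : E d₂} (hy' : y' ∈ q.Y) (g : E d₂) {γ : ℝ}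
    (hγ : 0 < γ) :
    q.obj u y' - q.obj u (proj q.Y (y + γ • g)) ≤ 1 / (2 * μ) *
      ‖gradY q.obj u (proj q.Y (y + γ • g)) - g + (1 / γ) • (proj q.Y (y + γ • g) - y)‖ ^ 2 := by
  have hm := proj_mem h.nonempty h.compact (y + γ • g)
  have h1 := inner_sub_proj_le h.nonempty h.compact h.convex (y + γ • g) hy'
  set w := proj q.Y (y + γ • g)
  have h2 := h.concave u y' hy' w hm
  set v := gradY q.obj u w - g + (1 / γ) • (w - y) with hv
  have h3 : inner ℝ (gradY q.obj u w) (y' - w) ≤ inner ℝ v (y' - w) := by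
    have : v = gradY q.obj u w - (1 / γ) • (y + γ • g - w) := by
      rw [hv, show y + γ • g - w = γ • g - (w - y) by abel, smul_sub (1 / γ) (γ • g), smul_smul,
        one_div_mul_cancel hγ.ne', one_smul]
      abel
    rw [this, inner_sub_left, inner_smul_left, conj_trivial]
    have := mul_nonpos_of_nonneg_of_nonpos (one_div_pos.2 hγ).le h1
    linarith
  have h4 := real_inner_le_norm v (y' - w)
  have hμ := h.μ_pos
  have h5 : ‖v‖ * ‖y' - w‖ ≤ 1 / (2 * μ) * ‖v‖ ^ 2 + μ / 2 * ‖y' - w‖ ^ 2 := by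
    have : 0 ≤ 1 / (2 * μ) * (‖v‖ - μ * ‖y' - w‖) ^ 2 := by positivity
    have e : 1 / (2 * μ) * (‖v‖ - μ * ‖y' - w‖) ^ 2 =
      1 / (2 * μ) * ‖v‖ ^ 2 + μ / 2 * ‖y' - w‖ ^ 2 - ‖v‖ * ‖y' - w‖ := by field_simp; ring
    linarith
  linarith

/-- `Ψ` increases at least by its first-order expansion in `y`, up to a quadratic error. -/
theorem le_Psi_y {u z : E d₁} {y y' : E d₂} (hy : y ∈ q.Y) (hy' : y' ∈ q.Y)
    (hu : gradX q.obj u y + (2 * l) • (u - z) = 0) :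
    q.Psi (2 * l) y z + inner ℝ (gradY q.obj u y) (y' - y) - l * ‖y' - y‖ ^ 2
      ≤ q.Psi (2 * l) y' z := by
  obtain ⟨u', hu', -⟩ := h.exists_Psi_eq hy' z
  have h1 := (abs_le.1 (h.abs_expansion_y u' hy hy')).1
  have h2 := h.fHat_ge u u' z hy
  rw [hu, inner_zero_left, add_zero] at h2
  have h3 := h.Psi_le u hy z
  have h4 : -(l * ‖u' - u‖ * ‖y' - y‖) ≤
      inner ℝ (gradY q.obj u' y) (y' - y) - inner ℝ (gradY q.obj u y) (y' - y) := by
    rw [← inner_sub_left]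
    have h5 := h.norm_gradY_sub_le (x := u') (x' := u) hy hy
    rw [sub_self, norm_zero, add_zero] at h5
    have := (abs_le.1 (abs_real_inner_le_norm (gradY q.obj u' y - gradY q.obj u y) (y' - y))).1
    linarith [mul_le_mul_of_nonneg_right h5 (norm_nonneg (y' - y))]
  -- The cross term caused by the moving minimizer is paid for by the growth of `f̂(·, y, z)` at
  -- `u`. This leaves `l / 2 * ‖y' - y‖²`, and the `y`-expansion adds another `l / 2`.
  have h6 : 0 ≤ l / 2 * (‖u' - u‖ - ‖y' - y‖) ^ 2 := by
    have := h.l_pos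
    positivity
  rw [hu']
  unfold fHat at *
  nlinarith

/-- Change of `P - Ψ` when the proximal center moves from `z` to `z'`. -/
theorem PEnv_sub_Psi_le {u' ubar z z' : E d₁} {y : E d₂} (hy : y ∈ q.Y)
    (hu' : q.Psi (2 * l) y z' = q.fHat (2 * l) u' y z')
    (hubar : q.PEnv (2 * l) z = ⨆ y : q.Y, q.fHat (2 * l) ubar y z) :
    q.PEnv (2 * l) z' - q.Psi (2 * l) y z' ≤ q.PEnv (2 * l) z - q.Psi (2 * l) y z
      + 2 * l * inner ℝ (z' - z) (u' - ubar) := by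
  have hne : Nonempty q.Y := h.nonempty.to_subtype
  -- Each minimizer is tested in the other problem: `u'` at the old center, `ubar` at the new one.
  -- Only the proximal squares change, and their differences combine to a single inner product.
  have h1 := h.Psi_le u' hy z
  have h2 : q.PEnv (2 * l) z' ≤ ⨆ y : q.Y, q.fHat (2 * l) ubar y z' := by
    refine ciInf_le ⟨q.Psi (2 * l) y z', ?_⟩ ubar
    rintro _ ⟨x, rfl⟩
    exact (h.Psi_le x hy z').trans (h.le_iSup_fHat x z' hy)
  have h3 : (⨆ y : q.Y, q.fHat (2 * l) ubar y z') ≤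
      q.PEnv (2 * l) z + l * (‖ubar - z'‖ ^ 2 - ‖ubar - z‖ ^ 2) := by
    refine ciSup_le fun y => ?_
    have := h.le_iSup_fHat ubar z y.2
    rw [← hubar] at this
    unfold fHat at *
    linarith
  have h4 : (‖u' - z‖ ^ 2 - ‖u' - z'‖ ^ 2) + (‖ubar - z'‖ ^ 2 - ‖ubar - z‖ ^ 2)
      = 2 * inner ℝ (z' - z) (u' - ubar) := by
    simp only [← real_inner_self_eq_norm_sq, inner_sub_left, inner_sub_right]
    rw [real_inner_comm z u', real_inner_comm z' u', real_inner_comm z ubar,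
      real_inner_comm z' ubar]
    ring
  have h5 := congrArg (l * ·) h4
  rw [hu']
  unfold fHat at *
  linarith

/-- The stationarity residual is controlled by an inexact projected gradient step. -/
theorem residualY_le {x : E d₁} {y : E d₂} (e : E d₂) {γ : ℝ} (hγ : 0 < γ)
    (hγl : γ * l ≤ 1) :
    residualY q.obj q.Y l x y ≤
      ‖proj q.Y (y + γ • (gradY q.obj x y + e)) - y‖ / γ + ‖e‖ := by
  have hl := h.l_pos
  have h1 := mul_norm_proj_step_le h.nonempty h.compact h.convex (y := y) (gradY q.obj x y) hγ
    (δ := 1 / l) (by rw [le_div_iff₀ hl]; exact hγl)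
  have h2 := norm_proj_sub_proj_le h.nonempty h.compact h.convex (y + γ • gradY q.obj x y)
    (y + γ • (gradY q.obj x y + e))
  rw [show y + γ • gradY q.obj x y - (y + γ • (gradY q.obj x y + e)) = -(γ • e) by
    rw [smul_add]; abel, norm_neg, norm_smul, Real.norm_of_nonneg hγ.le] at h2
  have h3 := norm_sub_le_norm_sub_add_norm_sub (proj q.Y (y + γ • gradY q.obj x y))
    (proj q.Y (y + γ • (gradY q.obj x y + e))) y
  unfold residualY
  rw [div_add' _ _ _ hγ.ne', le_div_iff₀ hγ]
  rw [one_div_mul_eq_div, le_div_iff₀ hl] at h1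
  linarith

set_option maxHeartbeats 2000000 in
/-- One inexact step decreases the potential. -/
theorem potential_step {x z x' z' : E d₁} {y y' : E d₂} (hy : y ∈ q.Y) {α : ℝ} (hα : 0 < α)
    (hαl : α * l ≤ 1 / 1000) (e₁ : E d₁) (e₂ : E d₂)
    (hx' : x' = x - α • (gradX q.obj x y + e₁ + (2 * l) • (x - z)))
    (hy' : y' = proj q.Y (y + (α / 256) • (gradY q.obj x y + e₂)))
    (hz' : z' = z + (α / 256 * μ / 80000) • (x' - z)) :
    q.potential (2 * l) x' y' z' ≤ q.potential (2 * l) x y z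
      - α * (1 / 500000000 * (μ / l) * ‖gradX q.obj x y‖ ^ 2
        + residualY q.obj q.Y l x y ^ 2 / 2000) + 2 * α * (‖e₁‖ ^ 2 + ‖e₂‖ ^ 2) := by
  have hl := h.l_pos
  have hμ := h.μ_pos
  have hμl := h.μ_le
  set γ := α / 256 with hγ
  set β := γ * μ / 80000 with hβ
  have hγ0 : 0 < γ := by positivity
  have hβ0 : 0 < β := by positivity
  have hym : y' ∈ q.Y := hy' ▸ proj_mem h.nonempty h.compact _
  obtain ⟨u, hu, hu0⟩ := h.exists_Psi_eq hy z
  obtain ⟨u₁, hu₁, hu₁0⟩ := h.exists_Psi_eq hym z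
  obtain ⟨u₂, hu₂, hu₂0⟩ := h.exists_Psi_eq hym z'
  obtain ⟨ub, hub, hubq⟩ := h.exists_PEnv_eq z
  set G := gradX q.obj x y + (2 * l) • (x - z) with hG
  set δ := ‖y' - y‖ / γ with hδ
  have hyδ : ‖y' - y‖ = γ * δ := by rw [hδ]; field_simp
  have hδ0 : 0 ≤ δ := by positivity
  have hxx : x' - x = -(α • (G + e₁)) := by rw [hx', hG]; module
  have hs : ‖x' - x‖ ≤ α * (‖G‖ + ‖e₁‖) := by
    rw [hxx, norm_neg, norm_smul, Real.norm_of_nonneg hα.le]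
    gcongr
    exact norm_add_le _ _
  -- the `x` step
  have hX : q.fHat (2 * l) x' y z ≤ q.fHat (2 * l) x y z - α * ‖G‖ ^ 2 + α * (‖G‖ * ‖e₁‖)
      + 3 * l * α ^ 2 * (‖G‖ ^ 2 + ‖e₁‖ ^ 2) := by
    have h1 := h.fHat_le x x' z hy
    rw [← hG, hxx, inner_neg_right, inner_smul_right, inner_add_right,
      real_inner_self_eq_norm_sq, norm_neg, norm_smul, mul_pow, Real.norm_of_nonneg hα.le] at h1
    have h2 := (abs_le.1 (abs_real_inner_le_norm G e₁)).1
    have h3 : ‖G + e₁‖ ^ 2 ≤ 2 * (‖G‖ ^ 2 + ‖e₁‖ ^ 2) := by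
      have : ‖G + e₁‖ ^ 2 ≤ (‖G‖ + ‖e₁‖) ^ 2 := by gcongr; exact norm_add_le _ _
      nlinarith [sq_nonneg (‖G‖ - ‖e₁‖)]
    have h4 := mul_le_mul_of_nonneg_left h3 (show 0 ≤ 3 * l / 2 * α ^ 2 by positivity)
    have h5 := mul_le_mul_of_nonneg_left h2 hα.le
    linarith
  -- the `y` step
  have hY : q.fHat (2 * l) x' y' z ≤ q.fHat (2 * l) x' y z
      + inner ℝ (gradY q.obj x' y) (y' - y) := by
    have h1 := h.concave x' y' hym y hy
    have : 0 ≤ μ / 2 * ‖y' - y‖ ^ 2 := by positivity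
    unfold fHat
    linarith
  have hstep : γ * δ ^ 2 ≤ inner ℝ (gradY q.obj x y) (y' - y) + ‖e₂‖ * (γ * δ) := by
    have h1 := norm_sq_proj_step_le h.nonempty h.compact h.convex hy (gradY q.obj x y + e₂) γ
    rw [← hy', inner_add_left, hyδ] at h1
    have h2 := real_inner_le_norm e₂ (y' - y)
    rw [hyδ] at h2
    refine le_of_mul_le_mul_left ?_ hγ0
    have h3 := mul_le_mul_of_nonneg_left h2 hγ0.le
    linarith
  have hY1 : inner ℝ (gradY q.obj x' y) (y' - y) - inner ℝ (gradY q.obj x y) (y' - y)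
      ≤ l * ‖x' - x‖ * (γ * δ) := by
    rw [← inner_sub_left, ← hyδ]
    refine (real_inner_le_norm _ _).trans ?_
    gcongr
    simpa using h.norm_gradY_sub_le (x := x') (x' := x) hy hy
  -- `Ψ` has its `y`-gradient at the minimizer `u` rather than at `x`; strong convexity in `x` turns
  -- that mismatch into `‖G‖`.
  have hY2 : inner ℝ (gradY q.obj x y) (y' - y) - inner ℝ (gradY q.obj u y) (y' - y)
      ≤ ‖G‖ * (γ * δ) := by
    rw [← inner_sub_left, ← hyδ]
    refine (real_inner_le_norm _ _).trans ?_
    gcongr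
    refine (?_ : _ ≤ l * ‖u - x‖).trans (h.mul_norm_sub_le hy hu0)
    simpa [norm_sub_rev] using h.norm_gradY_sub_le (x := x) (x' := u) hy hy
  have hPsi := h.le_Psi_y hy hym hu0
  rw [hyδ] at hPsi
  -- the `z` step
  have hzz : z' - z = β • (x' - z) := by rw [hz']; abel
  have hβ1 : β ≤ 1 / 1000 := by
    rw [hβ, hγ]
    linarith [mul_le_mul_of_nonneg_left hμl hα.le]
  have hZ : q.fHat (2 * l) x' y' z' ≤ q.fHat (2 * l) x' y' z - l * β * ‖x' - z‖ ^ 2 := by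
    have h1 : ‖x' - z'‖ ^ 2 = (1 - β) ^ 2 * ‖x' - z‖ ^ 2 := by
      rw [hz', show x' - (z + β • (x' - z)) = (1 - β) • (x' - z) by module, norm_smul, mul_pow,
        Real.norm_eq_abs, sq_abs]
    unfold fHat
    rw [h1]
    have h2 : (1 - β) ^ 2 ≤ 1 - β := by linarith [mul_le_mul_of_nonneg_left hβ1 hβ0.le]
    have h3 := mul_le_mul_of_nonneg_right h2 (show 0 ≤ l * ‖x' - z‖ ^ 2 by positivity)
    linarith
  have hPP := h.PEnv_sub_Psi_le hym hu₂ hub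
  have hin : inner ℝ (z' - z) (u₂ - ub) ≤ β * ‖x' - z‖ * (2 * β * ‖x' - z‖ + ‖u₁ - ub‖) := by
    refine (real_inner_le_norm _ _).trans ?_
    have h1 := h.norm_argmin_sub_le_z hym hu₁0 hu₂0
    rw [hzz, norm_smul, Real.norm_of_nonneg hβ0.le] at h1
    rw [hzz, norm_smul, Real.norm_of_nonneg hβ0.le]
    have h2 := norm_sub_le_norm_sub_add_norm_sub u₂ u₁ ub
    gcongr
    linarith
  -- the error bound
  have hD : μ / l * (l * ‖u₁ - ub‖) ^ 2 ≤ 2 *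
      ‖gradY q.obj u₁ y' - (gradY q.obj x y + e₂) + (1 / γ) • (y' - y)‖ ^ 2 := by
    have h1 := hubq u₁
    have h2 : (⨆ v : q.Y, q.fHat (2 * l) u₁ v z) ≤ q.fHat (2 * l) u₁ y' z + 1 / (2 * μ) *
        ‖gradY q.obj u₁ y' - (gradY q.obj x y + e₂) + (1 / γ) • (y' - y)‖ ^ 2 := by
      have hne : Nonempty q.Y := h.nonempty.to_subtype
      refine ciSup_le fun v => ?_
      have h3 := h.obj_sub_le_of_proj_step u₁ (y := y) v.2 (gradY q.obj x y + e₂) hγ0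
      rw [← hy'] at h3
      unfold fHat
      linarith
    have h3 := h.Psi_le_PEnv hym z
    rw [hu₁] at h3
    have h4 : l / 4 * ‖u₁ - ub‖ ^ 2 ≤ 1 / (2 * μ) *
        ‖gradY q.obj u₁ y' - (gradY q.obj x y + e₂) + (1 / γ) • (y' - y)‖ ^ 2 := by linarith
    have h5 := mul_le_mul_of_nonneg_left h4 (show 0 ≤ 4 * μ by positivity)
    calc μ / l * (l * ‖u₁ - ub‖) ^ 2 = 4 * μ * (l / 4 * ‖u₁ - ub‖ ^ 2) := by field_simp
      _ ≤ _ := h5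
      _ = _ := by field_simp; ring
  set R := ‖gradY q.obj u₁ y' - (gradY q.obj x y + e₂) + (1 / γ) • (y' - y)‖ with hRdef
  have hR : R ≤ (1 + 2 * (l * α) / 256) * δ + ‖G‖ + ‖e₂‖ := by
    have h1 := h.norm_gradY_sub_le (x := u₁) (x' := x) hym hy
    have h2 := norm_sub_le_norm_sub_add_norm_sub u₁ u x
    have h3 := h.norm_argmin_sub_le_y hy hym hu0 hu₁0
    have h4 := h.mul_norm_sub_le (x := x) hy hu0
    rw [← hG] at h4
    have h5 : R ≤ ‖gradY q.obj u₁ y' - gradY q.obj x y‖ + ‖e₂‖ + δ := by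
      rw [hRdef, show gradY q.obj u₁ y' - (gradY q.obj x y + e₂) + (1 / γ) • (y' - y)
        = (gradY q.obj u₁ y' - gradY q.obj x y) - e₂ + (1 / γ) • (y' - y) by abel]
      refine (norm_add_le _ _).trans (add_le_add (norm_sub_le _ _) ?_)
      rw [norm_smul, Real.norm_of_nonneg (by positivity), hδ, one_div_mul_eq_div]
    have h6 : l * ‖u₁ - x‖ ≤ l * (γ * δ) + ‖G‖ := by
      rw [hyδ] at h3
      linarith [mul_le_mul_of_nonneg_left h2 hl.le, mul_le_mul_of_nonneg_left h3 hl.le]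
    rw [hyδ] at h1
    have h7 : 2 * (l * α) / 256 = 2 * (l * γ) := by rw [hγ]; ring
    rw [h7]
    linarith
  have hr : residualY q.obj q.Y l x y ≤ δ + ‖e₂‖ := by
    have := h.residualY_le (x := x) (y := y) e₂ hγ0 (by rw [hγ]; linarith)
    rwa [← hy'] at this
  have hN : l * ‖x - z‖ ≤ l * ‖x' - z‖ + l * α * (‖G‖ + ‖e₁‖) := by
    have h1 := norm_sub_le_norm_sub_add_norm_sub x x' z
    rw [norm_sub_rev x x'] at h1
    linarith [mul_le_mul_of_nonneg_left h1 hl.le, mul_le_mul_of_nonneg_left hs hl.le]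
  have hg : ‖gradX q.obj x y‖ ≤ ‖G‖ + 2 * (l * ‖x - z‖) := by
    have h1 : gradX q.obj x y = G - (2 * l) • (x - z) := by rw [hG]; abel
    rw [h1]
    refine (norm_sub_le _ _).trans ?_
    rw [norm_smul, Real.norm_of_nonneg (by positivity)]
    linarith
  have hr0 : 0 ≤ residualY q.obj q.Y l x y := mul_nonneg hl.le (norm_nonneg _)
  have key := potential_step_scalar (norm_nonneg G) (norm_nonneg e₁) hδ0
    (norm_nonneg _) hr0 (by positivity) (norm_nonneg _)
    (show 0 ≤ l * α by positivity) (by linarith) (show 0 ≤ μ / l by positivity)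
    ((div_le_one hl).2 hμl) hβ1 hD hR hr hN hg
  have key' := mul_le_mul_of_nonneg_left key hα.le
  -- `20480000 = 256 * 80000`, the product of the ratio `η_x / η_y` and the divisor in `β`.
  have hβl : l * β = α * (μ / l) * l ^ 2 / 20480000 := by rw [hβ, hγ]; field_simp; ring
  have hsl : l * ‖x' - x‖ * (γ * δ) ≤ l * (α * (‖G‖ + ‖e₁‖)) * (γ * δ) := by gcongr
  have hz4 : 2 * (2 * l * inner ℝ (z' - z) (u₂ - ub)) ≤
      4 * (l * β) * (‖x' - z‖ * (2 * β * ‖x' - z‖ + ‖u₁ - ub‖)) := by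
    have := mul_le_mul_of_nonneg_left hin (show 0 ≤ 4 * l by positivity)
    linarith
  rw [hβl] at hz4 hZ
  unfold potential
  have e1 : l * (γ * δ) ^ 2 = l * α ^ 2 * δ ^ 2 / 256 ^ 2 := by rw [hγ]; ring
  rw [e1] at hPsi
  have e2 : γ * δ = α * δ / 256 := by rw [hγ]; ring
  have e3 : γ * δ ^ 2 = α * δ ^ 2 / 256 := by rw [hγ]; ring
  rw [e2] at hsl hY1 hY2 hstep
  rw [e3] at hstep
  linarith

end Problem.Regular

variable {M d₁ d₂ : ℕ} {Ξ : Type*} [MeasurableSpace Ξ]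

/-! ### From the local objectives to the global one -/

namespace Problem

variable {q : Problem M d₁ d₂ Ξ} {l : ℝ}

/-- Linearity of the derivative. Differentiability of every `f_i` is essential, since `gradient`
defaults to zero at points of non-differentiability. -/
theorem LipschitzSmooth.grad_obj (h : q.LipschitzSmooth l) (x : E d₁) {y : E d₂} (hy : y ∈ q.Y) :
    grad q.obj x y = (M : ℝ)⁻¹ • ∑ i, grad (q.localObj i) x y := by
  have hX : gradX q.obj x y = (M : ℝ)⁻¹ • ∑ i, gradX (q.localObj i) x y := by
    refine HasGradientAt.gradient ?_
    have h1 : ∀ i, HasFDerivAt (fun x' => q.localObj i x' y)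
        (InnerProductSpace.toDual ℝ _ (gradX (q.localObj i) x y)) x := fun i =>
      ((h.differentiable i x y hy).comp (f := fun x' : E d₁ => (x', y)) x
        (by fun_prop)).hasGradientAt.hasFDerivAt
    have h2 := (HasFDerivAt.fun_sum fun i (_ : i ∈ Finset.univ) => h1 i).const_mul (M : ℝ)⁻¹
    rw [hasGradientAt_iff_hasFDerivAt, map_smul, map_sum]
    exact h2
  have hY : gradY q.obj x y = (M : ℝ)⁻¹ • ∑ i, gradY (q.localObj i) x y := by
    refine HasGradientAt.gradient ?_
    have h1 : ∀ i, HasFDerivAt (fun y' => q.localObj i x y')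
        (InnerProductSpace.toDual ℝ _ (gradY (q.localObj i) x y)) y := fun i =>
      ((h.differentiable i x y hy).comp (f := fun y' : E d₂ => (x, y')) y
        (by fun_prop)).hasGradientAt.hasFDerivAt
    have h2 := (HasFDerivAt.fun_sum fun i (_ : i ∈ Finset.univ) => h1 i).const_mul (M : ℝ)⁻¹
    rw [hasGradientAt_iff_hasFDerivAt, map_smul, map_sum]
    exact h2
  have hs : ∀ s : Finset (Fin M), ∑ i ∈ s, grad (q.localObj i) x y =
      WithLp.toLp 2 (∑ i ∈ s, gradX (q.localObj i) x y, ∑ i ∈ s, gradY (q.localObj i) x y) := by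
    intro s
    induction s using Finset.induction_on with
    | empty => simp; rfl
    | insert i s hi ih => rw [Finset.sum_insert hi, Finset.sum_insert hi, Finset.sum_insert hi, ih]; rfl
  rw [hs]
  unfold grad
  rw [hX, hY]
  rfl

theorem LipschitzSmooth.regular (h : q.LipschitzSmooth l) {μ : ℝ} (hM : 0 < M) (hl : 0 < l)
    (hμ : 0 < μ) (hμl : μ ≤ l) (hne : q.Y.Nonempty) (hconv : Convex ℝ q.Y) (hc : IsCompact q.Y)
    (hsc : q.StronglyConcaveInY μ) : q.Regular l μ where
  l_pos := hl
  μ_pos := hμ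
  μ_le := hμl
  nonempty := hne
  convex := hconv
  compact := hc
  differentiable x y hy :=
    (DifferentiableAt.fun_sum fun i _ => h.differentiable i x y hy).const_mul _
  lipschitz x₁ x₂ y₁ hy₁ y₂ hy₂ := by
    have hM' : (0 : ℝ) < M := by exact_mod_cast hM
    rw [h.grad_obj x₁ hy₁, h.grad_obj x₂ hy₂, ← smul_sub, ← Finset.sum_sub_distrib, norm_smul,
      Real.norm_of_nonneg (by positivity), inv_mul_le_iff₀ hM']
    refine (norm_sum_le _ _).trans ?_
    refine (Finset.sum_le_sum fun i _ => h.lipschitz i x₁ x₂ y₁ hy₁ y₂ hy₂).trans ?_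
    simp
  concave := hsc

/-- Projected gradient steps in `y` are no longer than the Lipschitz constant allows. -/
theorem Regular.norm_proj_step_le {μ Gy : ℝ} (h : q.Regular l μ) (hG : q.LipschitzInY Gy)
    (hGy : 0 ≤ Gy) (x : E d₁) {y : E d₂} (hy : y ∈ q.Y) {η : ℝ} (hη : 0 ≤ η) :
    ‖proj q.Y (y + η • gradY q.obj x y) - y‖ ≤ η * Gy := by
  have hm := proj_mem h.nonempty h.compact (y + η • gradY q.obj x y)
  have h1 := norm_sq_proj_step_le h.nonempty h.compact h.convex hy (gradY q.obj x y) η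
  set w := proj q.Y (y + η • gradY q.obj x y)
  -- Lipschitz continuity on `Y` bounds only feasible directional derivatives, not `‖∇_y f‖`. A
  -- fraction `t` of the feasible step is taken, small enough that the quadratic remainder divided
  -- by `t` is at most `δ`.
  have h2 : inner ℝ (gradY q.obj x y) (w - y) ≤ Gy * ‖w - y‖ := by
    refine le_of_forall_pos_le_add fun δ hδ => ?_
    have hl := h.l_pos
    obtain ⟨t, ht0, ht1, ht⟩ : ∃ t : ℝ, 0 < t ∧ t ≤ 1 ∧ l / 2 * t * ‖w - y‖ ^ 2 ≤ δ := by
      refine ⟨min 1 (δ / (l / 2 * ‖w - y‖ ^ 2 + 1)), by positivity, min_le_left _ _, ?_⟩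
      calc l / 2 * min 1 (δ / (l / 2 * ‖w - y‖ ^ 2 + 1)) * ‖w - y‖ ^ 2
          ≤ l / 2 * (δ / (l / 2 * ‖w - y‖ ^ 2 + 1)) * ‖w - y‖ ^ 2 := by
            gcongr; exact min_le_right _ _
        _ = δ * (l / 2 * ‖w - y‖ ^ 2) / (l / 2 * ‖w - y‖ ^ 2 + 1) := by ring
        _ ≤ δ := by rw [div_le_iff₀ (by positivity)]; linarith
    have hyt := h.convex.add_smul_sub_mem hy hm ⟨ht0.le, ht1⟩
    have h3 := (abs_le.1 (h.abs_expansion_y x hy hyt)).1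
    have h4 := (abs_le.1 (hG x _ hyt y hy)).2
    rw [add_sub_cancel_left, inner_smul_right, norm_smul, mul_pow, Real.norm_of_nonneg ht0.le] at h3
    rw [add_sub_cancel_left, norm_smul, Real.norm_of_nonneg ht0.le] at h4
    refine le_of_mul_le_mul_left ?_ ht0
    have h5 := mul_le_mul_of_nonneg_left ht ht0.le
    linarith
  rcases (norm_nonneg (w - y)).eq_or_lt with h0 | h0
  · rw [← h0]; positivity
  · refine le_of_mul_le_mul_right ?_ h0
    have h3 := mul_le_mul_of_nonneg_left h2 hη
    linarith

/-- Noise of the stochastic gradient of client `i` at `(x, y)` with data `ξ`. -/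
def noise (q : Problem M d₁ d₂ Ξ) (i : Fin M) (x : E d₁) (y : E d₂) (ξ : Ξ) :
    WithLp 2 (E d₁ × E d₂) :=
  grad (q.loss i ξ) x y - grad (q.localObj i) x y

end Problem

/-! ### The local loop -/

section LocalLoop

variable (q : Problem M d₁ d₂ Ξ) (par : Params) (i : Fin M) (x : E d₁) (y : E d₂) (ξ : ℕ → Ξ)

/-- The stochastic gradient used in local step `k`. -/
def localGrad (k : ℕ) : WithLp 2 (E d₁ × E d₂) :=
  grad (q.loss i (ξ k)) (localRun q par i x y ξ k).x (localRun q par i x y ξ k).y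

/-- The noise of the stochastic gradient used in local step `k`. -/
def localNoise (k : ℕ) : WithLp 2 (E d₁ × E d₂) :=
  q.noise i (localRun q par i x y ξ k).x (localRun q par i x y ξ k).y (ξ k)

theorem localRun_x (k : ℕ) : (localRun q par i x y ξ k).x =
    x - par.ηxl • ∑ j ∈ Finset.range k, (localGrad q par i x y ξ j).fst := by
  induction k with
  | zero => simp [localRun]
  | succ k ih =>
    rw [Finset.sum_range_succ, smul_add, ← sub_sub, ← ih]
    rfl

/-- `v` collects the increments without projection, so it has a closed form even though the
gradients are evaluated at the projected iterates `y`. -/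
theorem localRun_v (k : ℕ) : (localRun q par i x y ξ k).v =
    y + par.ηyl • ∑ j ∈ Finset.range k, (localGrad q par i x y ξ j).snd := by
  induction k with
  | zero => simp [localRun]
  | succ k ih =>
    rw [Finset.sum_range_succ, smul_add, ← add_assoc, ← ih]
    rfl

theorem localRun_samples (k : ℕ) : (localRun q par i x y ξ k).samples = k := by
  induction k with
  | zero => rfl
  | succ k ih => exact congrArg (· + 1) ih

theorem localRun_y_mem {q : Problem M d₁ d₂ Ξ} (hne : q.Y.Nonempty) (hc : IsCompact q.Y)
    {y : E d₂} (hy : y ∈ q.Y) (k : ℕ) : (localRun q par i x y ξ k).y ∈ q.Y := by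
  cases k with
  | zero => exact hy
  | succ k => exact proj_mem hne hc _

/-- Distance of the local iterate from the point received from the server. -/
def localDrift (k : ℕ) : ℝ :=
  ‖(localRun q par i x y ξ k).x - x‖ + ‖(localRun q par i x y ξ k).y - y‖

variable {q par i x y ξ}

theorem norm_localGrad_sub_le {l : ℝ} (hls : q.LipschitzSmooth l) (hne : q.Y.Nonempty)
    (hc : IsCompact q.Y) (hy : y ∈ q.Y) (k : ℕ) :
    ‖localGrad q par i x y ξ k - grad (q.localObj i) x y‖ ≤
      ‖localNoise q par i x y ξ k‖ + l * localDrift q par i x y ξ k :=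
  (norm_sub_le_norm_sub_add_norm_sub _ (grad (q.localObj i) (localRun q par i x y ξ k).x
    (localRun q par i x y ξ k).y) _).trans (add_le_add le_rfl
      (hls.lipschitz i _ _ _ (localRun_y_mem par i x ξ hne hc hy k) _ hy))

theorem localDrift_succ_le {l μ σG Gy : ℝ} (h : q.Regular l μ) (hls : q.LipschitzSmooth l)
    (hσG : 0 ≤ σG) (hhet : q.BoundedHeterogeneity σG) (hG : q.LipschitzInY Gy) (hGy : 0 ≤ Gy)
    (hy : y ∈ q.Y) (hηx : 0 ≤ par.ηxl) (hηy : 0 ≤ par.ηyl) (k : ℕ) :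
    localDrift q par i x y ξ (k + 1) ≤ (1 + (par.ηxl + par.ηyl) * l) * localDrift q par i x y ξ k
      + ((par.ηxl + par.ηyl) * ‖localNoise q par i x y ξ k‖ + ((par.ηxl + par.ηyl) * σG
        + par.ηxl * ‖gradX q.obj x y‖ + par.ηyl * Gy)) := by
  have h0 : ‖localGrad q par i x y ξ k - grad q.obj x y‖ ≤
      ‖localNoise q par i x y ξ k‖ + l * localDrift q par i x y ξ k + σG := by
    refine (norm_sub_le_norm_sub_add_norm_sub _ (grad (q.localObj i) x y) _).trans ?_
    exact add_le_add (norm_localGrad_sub_le hls h.nonempty h.compact hy k)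
      (le_of_sq_le_sq (hhet i x y hy) hσG)
  set s := localRun q par i x y ξ k with hs
  set g := localGrad q par i x y ξ k with hg
  set B := ‖localNoise q par i x y ξ k‖ + l * localDrift q par i x y ξ k + σG with hB
  have hx1 : (localRun q par i x y ξ (k + 1)).x = s.x - par.ηxl • g.fst := rfl
  have hy1 : (localRun q par i x y ξ (k + 1)).y = proj q.Y (s.y + par.ηyl • g.snd) := rfl
  have hgx : ‖g.fst - gradX q.obj x y‖ ≤ B := (norm_gradX_sub_le _ _ _ _ _ _).trans h0
  have hgy : ‖g.snd - gradY q.obj x y‖ ≤ B := (norm_gradY_sub_le _ _ _ _ _ _).trans h0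
  have hX : ‖(localRun q par i x y ξ (k + 1)).x - x‖ ≤
      ‖s.x - x‖ + par.ηxl * (B + ‖gradX q.obj x y‖) := by
    rw [hx1, show s.x - par.ηxl • g.fst - x = (s.x - x) - par.ηxl • g.fst by abel]
    refine (norm_sub_le _ _).trans ?_
    rw [norm_smul, Real.norm_of_nonneg hηx]
    gcongr
    have := norm_le_norm_sub_add g.fst (gradX q.obj x y)
    linarith
  have hY : ‖(localRun q par i x y ξ (k + 1)).y - y‖ ≤
      ‖s.y - y‖ + par.ηyl * B + par.ηyl * Gy := by
    rw [hy1]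
    -- The comparison point is the projected step with the exact global gradient from `y`: it moves
    -- by at most `η_{y,l} G_y`, and nonexpansiveness handles the difference.
    refine (norm_sub_le_norm_sub_add_norm_sub _
      (proj q.Y (y + par.ηyl • gradY q.obj x y)) _).trans ?_
    refine add_le_add ?_ (h.norm_proj_step_le hG hGy x hy hηy)
    refine (norm_proj_sub_proj_le h.nonempty h.compact h.convex _ _).trans ?_
    rw [show s.y + par.ηyl • g.snd - (y + par.ηyl • gradY q.obj x y)
      = (s.y - y) + par.ηyl • (g.snd - gradY q.obj x y) by module]
    refine (norm_add_le _ _).trans ?_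
    rw [norm_smul, Real.norm_of_nonneg hηy]
    gcongr
  have hd : localDrift q par i x y ξ k = ‖s.x - x‖ + ‖s.y - y‖ := rfl
  have hd' : localDrift q par i x y ξ (k + 1) = ‖(localRun q par i x y ξ (k + 1)).x - x‖ +
    ‖(localRun q par i x y ξ (k + 1)).y - y‖ := rfl
  rw [hd']
  rw [hB] at hX hY
  rw [hd] at hX hY ⊢
  linarith

/-- Bound of the local drift by the accumulated noise. -/
theorem localDrift_le {l μ σG Gy : ℝ} (h : q.Regular l μ) (hls : q.LipschitzSmooth l)
    (hσG : 0 ≤ σG) (hhet : q.BoundedHeterogeneity σG) (hG : q.LipschitzInY Gy) (hGy : 0 ≤ Gy)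
    (hy : y ∈ q.Y) (hηx : 0 ≤ par.ηxl) (hηy : 0 ≤ par.ηyl)
    (hK : (par.ηxl + par.ηyl) * l * par.K ≤ 1 / 2) {k : ℕ} (hk : k ≤ par.K) :
    localDrift q par i x y ξ k ≤ 2 * ((par.ηxl + par.ηyl) *
        ∑ j ∈ Finset.range par.K, ‖localNoise q par i x y ξ j‖ +
      par.K * ((par.ηxl + par.ηyl) * σG + par.ηxl * ‖gradX q.obj x y‖ + par.ηyl * Gy)) := by
  have hl := h.l_pos
  set η := par.ηxl + par.ηyl with hη
  have hη0 : 0 ≤ η := by positivity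
  set B := η * σG + par.ηxl * ‖gradX q.obj x y‖ + par.ηyl * Gy with hB
  have hB0 : 0 ≤ B := by positivity
  -- Discrete Grönwall. The small-step condition `hK` then keeps the growth factor below `e^(1/2) <
  -- 2` throughout the local loop.
  have h1 : ∀ k, localDrift q par i x y ξ k ≤ (1 + η * l) ^ k *
      (η * ∑ j ∈ Finset.range k, ‖localNoise q par i x y ξ j‖ + k * B) := by
    intro k
    induction k with
    | zero => simp [localDrift, localRun]
    | succ k ih =>
      refine (localDrift_succ_le h hls hσG hhet hG hGy hy hηx hηy k).trans ?_
      rw [← hη, ← hB, Finset.sum_range_succ]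
      have h2 := mul_le_mul_of_nonneg_left ih (show 0 ≤ 1 + η * l by positivity)
      have h3 : 1 ≤ (1 + η * l) ^ (k + 1) := one_le_pow₀ (by nlinarith)
      have h4 := mul_le_mul_of_nonneg_right h3
        (show 0 ≤ η * ‖localNoise q par i x y ξ k‖ + B by positivity)
      rw [← mul_assoc, ← pow_succ'] at h2
      push_cast
      linarith
  have h2 : (1 + η * l) ^ k ≤ 2 := by
    have h3 : 1 + η * l ≤ Real.exp (η * l) := by linarith [Real.add_one_le_exp (η * l)]
    have h4 : η * l * k ≤ 1 / 2 := le_trans (by gcongr) hK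
    calc (1 + η * l) ^ k ≤ Real.exp (η * l) ^ k := by gcongr
      _ = Real.exp (η * l * k) := by rw [← Real.exp_nat_mul]; ring_nf
      _ ≤ Real.exp (1 / 2) := Real.exp_le_exp.2 h4
      _ ≤ 2 := by
        have h5 : Real.exp (1 / 2) ^ 2 = Real.exp 1 := by rw [← Real.exp_nat_mul]; norm_num
        have h6 := Real.exp_one_lt_d9
        refine le_of_sq_le_sq ?_ (by norm_num)
        rw [h5]; linarith
  refine (h1 k).trans ?_
  gcongr

end LocalLoop

/-! ### One round of the algorithm -/

section Round

variable (q : Problem M d₁ d₂ Ξ) (par : Params) (x : E d₁) (y : E d₂) (S : Finset (Fin M))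
  (ξ : Fin M → ℕ → Ξ)

/-- The averaged stochastic gradient of a round. -/
def roundGrad : WithLp 2 (E d₁ × E d₂) :=
  ((par.m : ℝ) * par.K)⁻¹ •
    ∑ i ∈ S, ∑ k ∈ Finset.range par.K, localGrad q par i x y (ξ i) k

/-- The averaged noise of a round. -/
def roundNoise : WithLp 2 (E d₁ × E d₂) :=
  ((par.m : ℝ) * par.K)⁻¹ •
    ∑ i ∈ S, ∑ k ∈ Finset.range par.K, localNoise q par i x y (ξ i) k

/-- The total squared noise of a round. -/
def roundNoiseSq : ℝ :=
  ∑ i ∈ S, ∑ k ∈ Finset.range par.K, ‖localNoise q par i x y (ξ i) k‖ ^ 2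

variable {q par x y S ξ}

theorem sum_fst {ι : Type*} (s : Finset ι) (g : ι → WithLp 2 (E d₁ × E d₂)) :
    (∑ i ∈ s, g i).fst = ∑ i ∈ s, (g i).fst := by
  classical
  induction s using Finset.induction_on with
  | empty => simp
  | insert i s hi ih => rw [Finset.sum_insert hi, Finset.sum_insert hi, ← ih]; rfl

theorem sum_snd {ι : Type*} (s : Finset ι) (g : ι → WithLp 2 (E d₁ × E d₂)) :
    (∑ i ∈ s, g i).snd = ∑ i ∈ s, (g i).snd := by
  classical
  induction s using Finset.induction_on with
  | empty => simp
  | insert i s hi ih => rw [Finset.sum_insert hi, Finset.sum_insert hi, ← ih]; rfl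

/-- Since `|S| = m`, the copies of `x` cancel in the average; `η_{x,g}` times the mean local
displacement is `η_x K` times the averaged gradient. -/
theorem server_step_x (hm : 0 < par.m) (hK : 0 < par.K) (hS : S.card = par.m) (z : E d₁) :
    x + par.ηxg • ((par.m : ℝ)⁻¹ • (∑ i ∈ S, (localRun q par i x y (ξ i) par.K).x) - x)
      - (par.ηxl * par.ηxg * par.K * par.p) • (x - z)
    = x - (par.ηxg * par.ηxl * par.K) • ((roundGrad q par x y S ξ).fst + par.p • (x - z)) := by
  have hm' : (par.m : ℝ) ≠ 0 := by exact_mod_cast hm.ne'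
  have hK' : (par.K : ℝ) ≠ 0 := by exact_mod_cast hK.ne'
  have h1 : (roundGrad q par x y S ξ).fst = ((par.m : ℝ) * par.K)⁻¹ •
      ∑ i ∈ S, ∑ k ∈ Finset.range par.K, (localGrad q par i x y (ξ i) k).fst := by
    simp only [roundGrad, WithLp.smul_fst, sum_fst]
  have h2 : ∑ i ∈ S, (localRun q par i x y (ξ i) par.K).x = (par.m : ℝ) • x - par.ηxl •
      ∑ i ∈ S, ∑ k ∈ Finset.range par.K, (localGrad q par i x y (ξ i) k).fst := by
    simp only [localRun_x, Finset.sum_sub_distrib, Finset.sum_const, hS, Finset.smul_sum]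
    rw [Nat.cast_smul_eq_nsmul]
  rw [h1, h2]
  generalize ∑ i ∈ S, ∑ k ∈ Finset.range par.K, (localGrad q par i x y (ξ i) k).fst = G
  match_scalars <;> field_simp <;> ring

theorem server_step_y (hm : 0 < par.m) (hK : 0 < par.K) (hS : S.card = par.m) :
    y + par.ηyg • ((par.m : ℝ)⁻¹ • (∑ i ∈ S, (localRun q par i x y (ξ i) par.K).v) - y)
    = y + (par.ηyg * par.ηyl * par.K) • (roundGrad q par x y S ξ).snd := by
  have hm' : (par.m : ℝ) ≠ 0 := by exact_mod_cast hm.ne'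
  have hK' : (par.K : ℝ) ≠ 0 := by exact_mod_cast hK.ne'
  have h1 : (roundGrad q par x y S ξ).snd = ((par.m : ℝ) * par.K)⁻¹ •
      ∑ i ∈ S, ∑ k ∈ Finset.range par.K, (localGrad q par i x y (ξ i) k).snd := by
    simp only [roundGrad, WithLp.smul_snd, sum_snd]
  have h2 : ∑ i ∈ S, (localRun q par i x y (ξ i) par.K).v = (par.m : ℝ) • y + par.ηyl •
      ∑ i ∈ S, ∑ k ∈ Finset.range par.K, (localGrad q par i x y (ξ i) k).snd := by
    simp only [localRun_v, Finset.sum_add_distrib, Finset.sum_const, hS, Finset.smul_sum]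
    rw [Nat.cast_smul_eq_nsmul]
  rw [h1, h2]
  generalize ∑ i ∈ S, ∑ k ∈ Finset.range par.K, (localGrad q par i x y (ξ i) k).snd = G
  match_scalars <;> field_simp <;> ring

/-- Without client drift or noise, the round gradient is exact. -/
theorem sum_grad_localObj {l σG : ℝ} (hls : q.LipschitzSmooth l)
    (hhet : q.BoundedHeterogeneity σG) (hy : y ∈ q.Y) (hm : 0 < par.m) (hS : S.card = par.m)
    (hfull : par.m = M ∨ σG = 0) :
    ∑ i ∈ S, grad (q.localObj i) x y = (par.m : ℝ) • grad q.obj x y := by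
  rcases hfull with hM | h0
  · have : S = Finset.univ := by
      rw [← Finset.card_eq_iff_eq_univ, hS, hM, Fintype.card_fin]
    have hm' : (M : ℝ) ≠ 0 := by rw [← hM]; exact_mod_cast hm.ne'
    rw [hls.grad_obj x hy, this, hM, smul_smul, mul_inv_cancel₀ hm', one_smul]
  · have : ∀ i, grad (q.localObj i) x y = grad q.obj x y := fun i => by
      have := hhet i x y hy
      rw [h0, zero_pow two_ne_zero] at this
      exact sub_eq_zero.1 (norm_eq_zero.1 (pow_eq_zero_iff two_ne_zero |>.1
        (le_antisymm this (sq_nonneg _))))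
    simp only [this, Finset.sum_const, hS]
    rw [Nat.cast_smul_eq_nsmul]

/-- The noise is kept inside one norm, so that orthogonality can later give the factor `1 / (mK)`.
Drift is bounded term by term, with the noise it has accumulated entering only through norms
multiplied by the small local rates. -/
theorem norm_roundGrad_sub_le {l μ σG Gy : ℝ} (h : q.Regular l μ) (hls : q.LipschitzSmooth l)
    (hσG : 0 ≤ σG) (hhet : q.BoundedHeterogeneity σG) (hG : q.LipschitzInY Gy) (hGy : 0 ≤ Gy)
    (hy : y ∈ q.Y) (hηx : 0 ≤ par.ηxl) (hηy : 0 ≤ par.ηyl)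
    (hηK : (par.ηxl + par.ηyl) * l * par.K ≤ 1 / 2)
    (hm : 0 < par.m) (hK : 0 < par.K) (hS : S.card = par.m) (hfull : par.m = M ∨ σG = 0) :
    ‖roundGrad q par x y S ξ - grad q.obj x y‖ ≤ ‖roundNoise q par x y S ξ‖ +
      2 * l * (par.K * ((par.ηxl + par.ηyl) * σG + par.ηxl * ‖gradX q.obj x y‖ + par.ηyl * Gy) +
      (par.ηxl + par.ηyl) * ((par.m : ℝ)⁻¹ *
        ∑ i ∈ S, ∑ k ∈ Finset.range par.K, ‖localNoise q par i x y (ξ i) k‖)) := by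
  have hm' : (0 : ℝ) < par.m := by exact_mod_cast hm
  have hK' : (0 : ℝ) < par.K := by exact_mod_cast hK
  have hl := h.l_pos
  set B := (par.ηxl + par.ηyl) * σG + par.ηxl * ‖gradX q.obj x y‖ + par.ηyl * Gy
  set drift : Fin M → ℕ → WithLp 2 (E d₁ × E d₂) := fun i k =>
    grad (q.localObj i) (localRun q par i x y (ξ i) k).x (localRun q par i x y (ξ i) k).y
      - grad (q.localObj i) x y with hdrift
  have hdec : roundGrad q par x y S ξ - grad q.obj x y = roundNoise q par x y S ξ +
      ((par.m : ℝ) * par.K)⁻¹ • ∑ i ∈ S, ∑ k ∈ Finset.range par.K, drift i k := by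
    have h1 : grad q.obj x y = ((par.m : ℝ) * par.K)⁻¹ •
        ∑ i ∈ S, ∑ _k ∈ Finset.range par.K, grad (q.localObj i) x y := by
      simp only [Finset.sum_const, Finset.card_range]
      rw [← Finset.smul_sum, sum_grad_localObj hls hhet hy hm hS hfull,
        ← Nat.cast_smul_eq_nsmul ℝ, smul_smul, smul_smul]
      rw [show ((par.m : ℝ) * par.K)⁻¹ * par.K * par.m = 1 by field_simp, one_smul]
    rw [h1, roundGrad, roundNoise, ← smul_sub, ← smul_add, ← Finset.sum_sub_distrib,
      ← Finset.sum_add_distrib]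
    congr 1
    refine Finset.sum_congr rfl fun i _ => ?_
    rw [← Finset.sum_sub_distrib, ← Finset.sum_add_distrib]
    refine Finset.sum_congr rfl fun k _ => ?_
    simp only [hdrift, localNoise, Problem.noise, localGrad]
    abel
  have hd : ∀ i, ∀ k ∈ Finset.range par.K, ‖drift i k‖ ≤ 2 * l * (par.K * B +
      (par.ηxl + par.ηyl) * ∑ j ∈ Finset.range par.K, ‖localNoise q par i x y (ξ i) j‖) := by
    intro i k hk
    have h1 : ‖drift i k‖ ≤ l * localDrift q par i x y (ξ i) k :=
      hls.lipschitz i _ _ _ (localRun_y_mem par i x _ h.nonempty h.compact hy k) _ hy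
    have h2 := localDrift_le (ξ := ξ i) (i := i) (x := x) h hls hσG hhet hG hGy hy hηx hηy hηK
      (Finset.mem_range.1 hk).le
    have h3 := mul_le_mul_of_nonneg_left h2 hl.le
    linarith
  rw [hdec]
  refine (norm_add_le _ _).trans (add_le_add le_rfl ?_)
  rw [norm_smul, norm_inv, Real.norm_of_nonneg (by positivity), inv_mul_le_iff₀ (by positivity)]
  calc ‖∑ i ∈ S, ∑ k ∈ Finset.range par.K, drift i k‖
      ≤ ∑ i ∈ S, ∑ k ∈ Finset.range par.K, ‖drift i k‖ :=
        (norm_sum_le _ _).trans (Finset.sum_le_sum fun i _ => norm_sum_le _ _)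
    _ ≤ ∑ i ∈ S, ∑ _k ∈ Finset.range par.K, 2 * l * (par.K * B +
        (par.ηxl + par.ηyl) * ∑ j ∈ Finset.range par.K, ‖localNoise q par i x y (ξ i) j‖) :=
        Finset.sum_le_sum fun i _ => Finset.sum_le_sum fun k hk => hd i k hk
    _ = _ := by
        simp only [Finset.sum_const, Finset.card_range, nsmul_eq_mul, ← Finset.mul_sum,
          Finset.sum_add_distrib, hS]
        field_simp

/-- Cauchy–Schwarz over the `mK` local steps of the round. -/
theorem sq_sum_noise_le (hm : 0 < par.m) (hS : S.card = par.m) :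
    ((par.m : ℝ)⁻¹ * ∑ i ∈ S, ∑ k ∈ Finset.range par.K, ‖localNoise q par i x y (ξ i) k‖) ^ 2
      ≤ (par.K / par.m : ℝ) * roundNoiseSq q par x y S ξ := by
  have hm' : (0 : ℝ) < par.m := by exact_mod_cast hm
  rw [roundNoiseSq, ← Finset.sum_product', ← Finset.sum_product', mul_pow]
  have h1 := sq_sum_le_card_mul_sum_sq (s := S ×ˢ Finset.range par.K)
    (f := fun p => ‖localNoise q par p.1 x y (ξ p.1) p.2‖)
  rw [Finset.card_product, hS, Finset.card_range] at h1
  refine (mul_le_mul_of_nonneg_left h1 (by positivity)).trans_eq ?_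
  push_cast
  field_simp

end Round

/-! ### Squared error and descent in one round -/

/-- The random part of the decrease of the potential in one round. -/
def roundError (q : Problem M d₁ d₂ Ξ) (par : Params) (l σG Gy : ℝ) (x : E d₁) (y : E d₂)
    (S : Finset (Fin M)) (ξ : Fin M → ℕ → Ξ) : ℝ :=
  6 * ‖roundNoise q par x y S ξ‖ ^ 2
    + 24 * (l * (par.ηxl + par.ηyl)) ^ 2 * ((par.K / par.m : ℝ) * roundNoiseSq q par x y S ξ)
    + 24 * (l * par.K * ((par.ηxl + par.ηyl) * σG + par.ηyl * Gy)) ^ 2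

/-- The term in `‖∇_x f‖²` stays outside `roundError` because nothing bounds it; it must be absorbed
by the descent. -/
theorem norm_sq_roundGrad_sub_le {q : Problem M d₁ d₂ Ξ} {par : Params} {x : E d₁} {y : E d₂}
    {S : Finset (Fin M)} {ξ : Fin M → ℕ → Ξ} {l μ σG Gy : ℝ}
    (h : q.Regular l μ) (hls : q.LipschitzSmooth l)
    (hσG : 0 ≤ σG) (hhet : q.BoundedHeterogeneity σG) (hG : q.LipschitzInY Gy) (hGy : 0 ≤ Gy)
    (hy : y ∈ q.Y) (hηx : 0 ≤ par.ηxl) (hηy : 0 ≤ par.ηyl)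
    (hηK : (par.ηxl + par.ηyl) * l * par.K ≤ 1 / 2)
    (hm : 0 < par.m) (hK : 0 < par.K) (hS : S.card = par.m) (hfull : par.m = M ∨ σG = 0) :
    ‖roundGrad q par x y S ξ - grad q.obj x y‖ ^ 2 ≤ roundError q par l σG Gy x y S ξ
      + 8 * (par.ηxl * (l * par.K)) ^ 2 * ‖gradX q.obj x y‖ ^ 2 := by
  have h1 := norm_roundGrad_sub_le (ξ := ξ) (x := x) h hls hσG hhet hG hGy hy hηx hηy hηK hm hK hS
    hfull
  have h2 := sq_sum_noise_le (q := q) (par := par) (x := x) (y := y) (ξ := ξ) hm hS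
  set Z := (par.m : ℝ)⁻¹ * ∑ i ∈ S, ∑ k ∈ Finset.range par.K, ‖localNoise q par i x y (ξ i) k‖
  set A := ‖gradX q.obj x y‖
  set N := ‖roundNoise q par x y S ξ‖
  have h3 : ‖roundGrad q par x y S ξ - grad q.obj x y‖ ^ 2 ≤ (N + 2 * (l * (par.ηxl + par.ηyl)) * Z
      + 2 * (l * par.K * ((par.ηxl + par.ηyl) * σG + par.ηyl * Gy))
      + 2 * (par.ηxl * (l * par.K)) * A) ^ 2 :=
    pow_le_pow_left₀ (norm_nonneg _) (h1.trans_eq (by ring)) 2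
  have h4 := mul_le_mul_of_nonneg_left h2
    (show 0 ≤ 24 * (l * (par.ηxl + par.ηyl)) ^ 2 by positivity)
  unfold roundError
  generalize l * (par.ηxl + par.ηyl) = b at *
  generalize l * par.K * ((par.ηxl + par.ηyl) * σG + par.ηyl * Gy) = c at *
  generalize par.ηxl * (l * par.K) = e at *
  have h5 : (N + 2 * b * Z + 2 * c + 2 * e * A) ^ 2 ≤
      6 * N ^ 2 + 24 * b ^ 2 * Z ^ 2 + 24 * c ^ 2 + 8 * e ^ 2 * A ^ 2 := by
    linarith [sq_nonneg (N + 2 * b * Z + 2 * c - 2 * e * A), sq_nonneg (N - 2 * b * Z),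
      sq_nonneg (N - 2 * c), sq_nonneg (2 * b * Z - 2 * c)]
  linarith

/-- Decrease of the potential along one round of the algorithm. -/
theorem potential_run_succ_le {q : Problem M d₁ d₂ Ξ} {par : Params} {x₀ z₀ : E d₁} {y₀ : E d₂}
    {S : ℕ → Finset (Fin M)} {ξ : ℕ → Fin M → ℕ → Ξ} {l μ σG Gy : ℝ} {t : ℕ}
    (h : q.Regular l μ) (hls : q.LipschitzSmooth l)
    (hσG : 0 ≤ σG) (hhet : q.BoundedHeterogeneity σG) (hG : q.LipschitzInY Gy) (hGy : 0 ≤ Gy)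
    (hy : (run q par x₀ y₀ z₀ S ξ t).y ∈ q.Y) (hηx : 0 ≤ par.ηxl) (hηy : 0 ≤ par.ηyl)
    (hηK : (par.ηxl + par.ηyl) * l * par.K ≤ 1 / 2)
    (hηx2 : (par.ηxl * (l * par.K)) ^ 2 ≤ (μ / l) / 100000000000)
    (hm : 0 < par.m) (hK : 0 < par.K) (hS : (S t).card = par.m) (hfull : par.m = M ∨ σG = 0)
    (hp : par.p = 2 * l) {α : ℝ} (hα0 : 0 < α) (hα : par.ηxg * par.ηxl * par.K = α)
    (hαl : α * l ≤ 1 / 1000) (hηxy : par.ηyg * par.ηyl = par.ηxg * par.ηxl / 256)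
    (hβ : par.β = par.ηyg * par.ηyl * par.K * μ / 80000) :
    let s := run q par x₀ y₀ z₀ S ξ t
    let s' := run q par x₀ y₀ z₀ S ξ (t + 1)
    q.potential (2 * l) s'.x s'.y s'.z ≤ q.potential (2 * l) s.x s.y s.z
      - α * (1 / 1000000000 * (μ / l) * ‖gradX q.obj s.x s.y‖ ^ 2
        + residualY q.obj q.Y l s.x s.y ^ 2 / 2000)
      + 2 * α * roundError q par l σG Gy s.x s.y (S t) (ξ t) := by
  intro s s'
  have hαy : par.ηyg * par.ηyl * par.K = α / 256 := by rw [hηxy, ← hα]; ring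
  set g := roundGrad q par s.x s.y (S t) (ξ t) with hg
  have hx : s'.x = s.x - α • (gradX q.obj s.x s.y + (g - grad q.obj s.x s.y).fst
      + (2 * l) • (s.x - s.z)) := by
    rw [show gradX q.obj s.x s.y + (g - grad q.obj s.x s.y).fst = g.fst from
      add_sub_cancel (gradX q.obj s.x s.y) g.fst, ← hp, ← hα]
    exact server_step_x hm hK hS s.z
  have hy' : s'.y = proj q.Y (s.y + (α / 256) • (gradY q.obj s.x s.y
      + (g - grad q.obj s.x s.y).snd)) := by
    rw [show gradY q.obj s.x s.y + (g - grad q.obj s.x s.y).snd = g.snd from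
      add_sub_cancel (gradY q.obj s.x s.y) g.snd, ← hαy]
    exact congrArg (proj q.Y) (server_step_y hm hK hS)
  have hz : s'.z = s.z + (α / 256 * μ / 80000) • (s'.x - s.z) := by
    rw [← hαy, ← hβ]; rfl
  have h1 := h.potential_step hy hα0 hαl _ _ hx hy' hz
  rw [← WithLp.prod_norm_sq_eq_of_L2] at h1
  have h2 := norm_sq_roundGrad_sub_le (ξ := ξ t) (x := s.x) h hls hσG hhet hG hGy hy hηx hηy hηK hm
    hK hS hfull
  have h3 := mul_le_mul_of_nonneg_left h2 hα0.le
  -- The drift part costs at most `16 * 10⁻¹¹` times `α (μ / l) ‖∇_x f‖²`, which is covered by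
  -- lowering the coefficient from `1 / 500000000` to half of that.
  have h4 := mul_le_mul_of_nonneg_left (mul_le_mul_of_nonneg_right hηx2
    (sq_nonneg ‖gradX q.obj s.x s.y‖)) hα0.le
  have h5 : 0 ≤ α * (μ / l * ‖gradX q.obj s.x s.y‖ ^ 2) := by
    have := h.l_pos
    have := h.μ_pos
    positivity
  rw [← hg] at h3
  linarith

/-! ### Measurability of the iterates -/

section Measurability

variable {Ω : Type*} [mΩ : MeasurableSpace Ω] {q : Problem M d₁ d₂ Ξ} {par : Params} {l : ℝ}

theorem measurable_grad_loss (hwp : q.WellPosed) (i : Fin M) {x : Ω → E d₁} {y : Ω → E d₂}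
    {ζ : Ω → Ξ} (hx : Measurable x) (hy : Measurable y) (hyY : ∀ ω, y ω ∈ q.Y)
    (hζ : Measurable ζ) : Measurable fun ω => grad (q.loss i (ζ ω)) (x ω) (y ω) := by
  have hpt : Measurable fun ω => ((x ω, (⟨y ω, hyY ω⟩ : q.Y)), ζ ω) :=
    (hx.prodMk (hy.subtype_mk)).prodMk hζ
  exact (WithLp.measurable_toLp 2 _).comp
    (((hwp.measurable_gradX i).comp hpt).prodMk ((hwp.measurable_gradY i).comp hpt))

theorem measurable_grad_of_lipschitz {Y : Set (E d₂)} {g : E d₁ → E d₂ → ℝ}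
    (hg : ∀ x₁ x₂, ∀ y₁ ∈ Y, ∀ y₂ ∈ Y,
      ‖grad g x₁ y₁ - grad g x₂ y₂‖ ≤ l * (‖x₁ - x₂‖ + ‖y₁ - y₂‖))
    {x : Ω → E d₁} {y : Ω → E d₂} (hx : Measurable x) (hy : Measurable y) (hyY : ∀ ω, y ω ∈ Y) :
    Measurable fun ω => grad g (x ω) (y ω) := by
  have hcont : Continuous fun w : E d₁ × Y => grad g w.1 w.2 := by
    rw [continuous_iff_continuousAt]
    intro w
    rw [ContinuousAt, tendsto_iff_norm_sub_tendsto_zero]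
    refine squeeze_zero (fun _ => norm_nonneg _) (fun v => hg v.1 w.1 v.2 v.2.2 w.2 w.2.2) ?_
    have : Continuous fun v : E d₁ × Y => l * (‖v.1 - w.1‖ + ‖(v.2 : E d₂) - w.2‖) := by fun_prop
    simpa using this.tendsto w
  exact hcont.measurable.comp (hx.prodMk (hy.subtype_mk (h := hyY)))

theorem measurable_noise (hwp : q.WellPosed) (hls : q.LipschitzSmooth l) (i : Fin M)
    {x : Ω → E d₁} {y : Ω → E d₂} {ζ : Ω → Ξ} (hx : Measurable x) (hy : Measurable y)
    (hyY : ∀ ω, y ω ∈ q.Y) (hζ : Measurable ζ) :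
    Measurable fun ω => q.noise i (x ω) (y ω) (ζ ω) :=
  (measurable_grad_loss hwp i hx hy hyY hζ).sub
    (measurable_grad_of_lipschitz (hls.lipschitz i) hx hy hyY)

/-- The σ-algebra is arbitrary and only data of steps before `k` need be measurable. This permits
its use with the σ-algebra of the past, and not only with the ambient one. -/
theorem measurable_localRun (hwp : q.WellPosed) (hne : q.Y.Nonempty) (hc : IsCompact q.Y)
    (hconv : Convex ℝ q.Y) (i : Fin M) {x : Ω → E d₁} {y : Ω → E d₂} {ξ : Ω → ℕ → Ξ}
    (hx : Measurable x) (hy : Measurable y) (hyY : ∀ ω, y ω ∈ q.Y) (k : ℕ)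
    (hξ : ∀ j < k, Measurable fun ω => ξ ω j) :
    Measurable (fun ω => (localRun q par i (x ω) (y ω) (ξ ω) k).x) ∧
    Measurable (fun ω => (localRun q par i (x ω) (y ω) (ξ ω) k).y) ∧
    Measurable (fun ω => (localRun q par i (x ω) (y ω) (ξ ω) k).v) := by
  induction k with
  | zero => exact ⟨hx, hy, hy⟩
  | succ k ih =>
    obtain ⟨h1, h2, h3⟩ := ih fun j hj => hξ j (hj.trans (Nat.lt_succ_self k))
    have h4 := measurable_grad_loss hwp i h1 h2
      (fun ω => localRun_y_mem par i (x ω) (ξ ω) hne hc (hyY ω) k) (hξ k (Nat.lt_succ_self k))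
    have h5 := (WithLp.measurable_ofLp 2 _).comp h4
    exact ⟨h1.sub (h5.fst.const_smul par.ηxl),
      (continuous_proj hne hc hconv).measurable.comp (h2.add (h5.snd.const_smul par.ηyl)),
      h3.add (h5.snd.const_smul par.ηyl)⟩

theorem measurable_localNoise (hwp : q.WellPosed) (hls : q.LipschitzSmooth l)
    (hne : q.Y.Nonempty) (hc : IsCompact q.Y) (hconv : Convex ℝ q.Y) (i : Fin M) {x : Ω → E d₁}
    {y : Ω → E d₂} {ξ : Ω → ℕ → Ξ} (hx : Measurable x) (hy : Measurable y)
    (hyY : ∀ ω, y ω ∈ q.Y) (k : ℕ) (hξ : ∀ j ≤ k, Measurable fun ω => ξ ω j) :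
    Measurable fun ω => localNoise q par i (x ω) (y ω) (ξ ω) k := by
  obtain ⟨h1, h2, -⟩ := measurable_localRun (par := par) hwp hne hc hconv i hx hy hyY k
    fun j hj => hξ j hj.le
  exact measurable_noise hwp hls i h1 h2
    (fun ω => localRun_y_mem par i (x ω) (ξ ω) hne hc (hyY ω) k) (hξ k le_rfl)

theorem run_y_mem (hne : q.Y.Nonempty) (hc : IsCompact q.Y) {x₀ z₀ : E d₁} {y₀ : E d₂}
    (hy₀ : y₀ ∈ q.Y) (S : ℕ → Finset (Fin M)) (ξ : ℕ → Fin M → ℕ → Ξ) (t : ℕ) :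
    (run q par x₀ y₀ z₀ S ξ t).y ∈ q.Y := by
  cases t with
  | zero => exact hy₀
  | succ t => exact proj_mem hne hc _

theorem measurable_random_sum {F : Type*} [AddCommMonoid F] [MeasurableSpace F]
    [MeasurableAdd₂ F] {S : Ω → Finset (Fin M)} (hS : Measurable S) {g : Fin M → Ω → F}
    (hg : ∀ i, Measurable (g i)) : Measurable fun ω => ∑ i ∈ S ω, g i ω := by
  classical
  have : (fun ω => ∑ i ∈ S ω, g i ω) = fun ω => ∑ i, if i ∈ S ω then g i ω else 0 := by
    funext ω
    rw [Finset.sum_ite_mem, Finset.univ_inter]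
  rw [this]
  exact Finset.measurable_fun_sum _ fun i _ => Measurable.ite
    (hS (MeasurableSet.of_discrete (s := {s : Finset (Fin M) | i ∈ s}))) (hg i) measurable_const

theorem measurable_run (hwp : q.WellPosed) (hne : q.Y.Nonempty) (hc : IsCompact q.Y)
    (hconv : Convex ℝ q.Y) {x₀ z₀ : E d₁} {y₀ : E d₂} (hy₀ : y₀ ∈ q.Y)
    {S : ℕ → Ω → Finset (Fin M)} {ξ : ℕ → Fin M → ℕ → Ω → Ξ} (t : ℕ)
    (hS : ∀ r < t, Measurable (S r)) (hξ : ∀ r < t, ∀ i k, Measurable (ξ r i k)) :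
    Measurable (fun ω => (run q par x₀ y₀ z₀ (fun t => S t ω) (fun t i k => ξ t i k ω) t).x) ∧
    Measurable (fun ω => (run q par x₀ y₀ z₀ (fun t => S t ω) (fun t i k => ξ t i k ω) t).y) ∧
    Measurable (fun ω => (run q par x₀ y₀ z₀ (fun t => S t ω) (fun t i k => ξ t i k ω) t).z) := by
  induction t with
  | zero => exact ⟨measurable_const, measurable_const, measurable_const⟩
  | succ t ih =>
    obtain ⟨h1, h2, h3⟩ := ih (fun r hr => hS r (hr.trans (Nat.lt_succ_self t)))
      (fun r hr => hξ r (hr.trans (Nat.lt_succ_self t)))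
    have hloc : ∀ i, _ := fun i => measurable_localRun (par := par)
      (ξ := fun ω k => ξ t i k ω) hwp hne hc hconv i h1 h2
      (fun ω => run_y_mem hne hc hy₀ _ _ t) par.K
      (fun j _ => hξ t (Nat.lt_succ_self t) i j)
    have hSt := hS t (Nat.lt_succ_self t)
    have hX := measurable_random_sum hSt fun i => (hloc i).1
    have hV := measurable_random_sum hSt fun i => (hloc i).2.2
    have hx' : Measurable (fun ω =>
        (run q par x₀ y₀ z₀ (fun t => S t ω) (fun t i k => ξ t i k ω) (t + 1)).x) :=
      (h1.add (((hX.const_smul (par.m : ℝ)⁻¹).sub h1).const_smul par.ηxg)).sub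
        ((h1.sub h3).const_smul (par.ηxl * par.ηxg * par.K * par.p))
    exact ⟨hx', (continuous_proj hne hc hconv).measurable.comp
      (h2.add (((hV.const_smul (par.m : ℝ)⁻¹).sub h2).const_smul par.ηyg)),
      h3.add ((hx'.sub h3).const_smul par.β)⟩

end Measurability

/-! ### Moments of the noise -/

section Moments

variable {Ω 𝒳 : Type*} [MeasurableSpace Ω] [m𝒳 : MeasurableSpace 𝒳] {P : Measure Ω}
  [IsProbabilityMeasure P] {q : Problem M d₁ d₂ Ξ} {l σ : ℝ}

theorem integral_noise (hwp : q.WellPosed) (hbv : q.BoundedVariance σ) (i : Fin M) (x : E d₁)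
    {y : E d₂} (hy : y ∈ q.Y) : ∫ ξ, q.noise i x y ξ ∂(q.D i) = 0 := by
  have := hwp.prob i
  unfold Problem.noise
  rw [integral_sub (hbv.integrable i x y hy) (integrable_const _), hbv.unbiased i x y hy]
  simp

theorem integrable_noise (hwp : q.WellPosed) (hbv : q.BoundedVariance σ) (i : Fin M) (x : E d₁)
    {y : E d₂} (hy : y ∈ q.Y) : Integrable (q.noise i x y) (q.D i) := by
  have := hwp.prob i
  exact (hbv.integrable i x y hy).sub (integrable_const _)

variable {X : 𝒳 → E d₁} {Y : 𝒳 → E d₂} {A : Set 𝒳} {U : Ω → 𝒳} {ζ : Ω → Ξ} {i : Fin M}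

/-- Second moment of the noise at a point that is independent of the data. -/
theorem noise_sq_integral_le (hwp : q.WellPosed) (hls : q.LipschitzSmooth l)
    (hbv : q.BoundedVariance σ) (hX : Measurable X) (hY : Measurable Y) (hYY : ∀ a, Y a ∈ q.Y)
    (hA : MeasurableSet A) (hU : Measurable U) (hζ : Measurable ζ) (hind : IndepFun U ζ P)
    (hD : P.map ζ = q.D i) :
    MemLp (fun ω => A.indicator (fun a => q.noise i (X a) (Y a) (ζ ω)) (U ω)) 2 P ∧
    ∫ ω, ‖A.indicator (fun a => q.noise i (X a) (Y a) (ζ ω)) (U ω)‖ ^ 2 ∂P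
      ≤ σ ^ 2 * P.real (U ⁻¹' A) := by
  classical
  have := hwp.prob i
  have hPU : IsProbabilityMeasure (P.map U) := Measure.isProbabilityMeasure_map hU.aemeasurable
  set F : 𝒳 × Ξ → WithLp 2 (E d₁ × E d₂) :=
    fun p => A.indicator (fun a => q.noise i (X a) (Y a) p.2) p.1 with hF
  have hFm : Measurable F := by
    have h1 : Measurable fun p : 𝒳 × Ξ => q.noise i (X p.1) (Y p.1) p.2 :=
      measurable_noise hwp hls i (hX.comp measurable_fst) (hY.comp measurable_fst)
        (fun p => hYY p.1) measurable_snd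
    exact h1.indicator (measurable_fst hA)
  have hpair : Measurable fun ω => (U ω, ζ ω) := hU.prodMk hζ
  -- Independence makes the joint law a product. Fubini then freezes the point and applies the
  -- variance bound to the fresh data alone, without conditional expectations.
  have hmap : P.map (fun ω => (U ω, ζ ω)) = (P.map U).prod (q.D i) := by
    rw [← hD]
    exact (indepFun_iff_map_prod_eq_prod_map_map hU.aemeasurable hζ.aemeasurable).1 hind
  have hsec : ∀ a, (Integrable (fun ξ => ‖F (a, ξ)‖ ^ 2) (q.D i)) ∧
      ∫ ξ, ‖F (a, ξ)‖ ^ 2 ∂(q.D i) ≤ A.indicator (fun _ => σ ^ 2) a := by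
    intro a
    by_cases ha : a ∈ A
    · simp only [hF, Set.indicator_of_mem ha]
      exact ⟨hbv.integrable_sq i _ _ (hYY a), hbv.variance i _ _ (hYY a)⟩
    · simp [hF, Set.indicator_of_notMem ha]
  have hsm : StronglyMeasurable fun p => ‖F p‖ ^ 2 := (hFm.norm.pow_const 2).stronglyMeasurable
  have hint : Integrable (fun p => ‖F p‖ ^ 2) ((P.map U).prod (q.D i)) := by
    refine (integrable_prod_iff hsm.aestronglyMeasurable).2
      ⟨Filter.Eventually.of_forall fun a => (hsec a).1, ?_⟩
    refine Integrable.mono' (g := A.indicator fun _ => σ ^ 2)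
      ((integrable_const _).indicator hA) hsm.norm.integral_prod_right.aestronglyMeasurable
      (Filter.Eventually.of_forall fun a => ?_)
    simp only [norm_pow, norm_norm]
    rw [Real.norm_of_nonneg (integral_nonneg fun _ => by positivity)]
    exact (hsec a).2
  have hint' : Integrable (fun ω => ‖F (U ω, ζ ω)‖ ^ 2) P := by
    rw [← hmap] at hint
    exact (integrable_map_measure hsm.aestronglyMeasurable hpair.aemeasurable).1 hint
  refine ⟨(memLp_two_iff_integrable_sq_norm
    (hFm.comp hpair).aestronglyMeasurable).2 hint', ?_⟩
  calc ∫ ω, ‖F (U ω, ζ ω)‖ ^ 2 ∂P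
      = ∫ p, ‖F p‖ ^ 2 ∂(P.map fun ω => (U ω, ζ ω)) :=
        (integral_map hpair.aemeasurable hsm.aestronglyMeasurable).symm
    _ = ∫ a, ∫ ξ, ‖F (a, ξ)‖ ^ 2 ∂(q.D i) ∂(P.map U) := by rw [hmap, integral_prod _ hint]
    _ ≤ ∫ a, A.indicator (fun _ => σ ^ 2) a ∂(P.map U) :=
        integral_mono hint.integral_prod_left ((integrable_const _).indicator hA)
          fun a => (hsec a).2
    _ = σ ^ 2 * P.real (U ⁻¹' A) := by
        rw [integral_indicator_const _ hA, map_measureReal_apply hU hA, smul_eq_mul, mul_comm]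

omit [IsProbabilityMeasure P] in
theorem integrable_inner_of_memLp {F : Type*} [NormedAddCommGroup F] [InnerProductSpace ℝ F]
    {f g : Ω → F} (hf : MemLp f 2 P) (hg : MemLp g 2 P) :
    Integrable (fun ω => inner ℝ (f ω) (g ω)) P := by
  refine Integrable.mono' (g := fun ω => ‖f ω‖ ^ 2 + ‖g ω‖ ^ 2)
    (((memLp_two_iff_integrable_sq_norm hf.1).1 hf).add
      ((memLp_two_iff_integrable_sq_norm hg.1).1 hg)) (hf.1.inner hg.1)
    (Filter.Eventually.of_forall fun ω => ?_)
  have := norm_inner_le_norm (𝕜 := ℝ) (f ω) (g ω)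
  nlinarith [sq_nonneg (‖f ω‖ - ‖g ω‖), sq_nonneg ‖f ω‖, sq_nonneg ‖g ω‖]

/-- The noise is orthogonal to everything that is independent of the data. -/
theorem integral_inner_noise (hwp : q.WellPosed) (hls : q.LipschitzSmooth l)
    (hbv : q.BoundedVariance σ) (hX : Measurable X) (hY : Measurable Y) (hYY : ∀ a, Y a ∈ q.Y)
    (hA : MeasurableSet A) (hU : Measurable U) (hζ : Measurable ζ) (hind : IndepFun U ζ P)
    (hD : P.map ζ = q.D i) {W : 𝒳 → WithLp 2 (E d₁ × E d₂)} (hW : Measurable W)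
    (hW2 : MemLp (fun ω => W (U ω)) 2 P) :
    ∫ ω, inner ℝ (W (U ω)) (A.indicator (fun a => q.noise i (X a) (Y a) (ζ ω)) (U ω)) ∂P = 0 := by
  classical
  have := hwp.prob i
  have hPU : IsProbabilityMeasure (P.map U) := Measure.isProbabilityMeasure_map hU.aemeasurable
  set F : 𝒳 × Ξ → WithLp 2 (E d₁ × E d₂) :=
    fun p => A.indicator (fun a => q.noise i (X a) (Y a) p.2) p.1 with hF
  have hFm : Measurable F := by
    have h1 : Measurable fun p : 𝒳 × Ξ => q.noise i (X p.1) (Y p.1) p.2 :=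
      measurable_noise hwp hls i (hX.comp measurable_fst) (hY.comp measurable_fst)
        (fun p => hYY p.1) measurable_snd
    exact h1.indicator (measurable_fst hA)
  have hpair : Measurable fun ω => (U ω, ζ ω) := hU.prodMk hζ
  have hmap : P.map (fun ω => (U ω, ζ ω)) = (P.map U).prod (q.D i) := by
    rw [← hD]
    exact (indepFun_iff_map_prod_eq_prod_map_map hU.aemeasurable hζ.aemeasurable).1 hind
  have hsm : StronglyMeasurable fun p : 𝒳 × Ξ => (inner ℝ (W p.1) (F p) : ℝ) :=
    ((hW.comp measurable_fst).inner hFm).stronglyMeasurable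
  have hint : Integrable (fun p : 𝒳 × Ξ => (inner ℝ (W p.1) (F p) : ℝ))
      ((P.map U).prod (q.D i)) := by
    rw [← hmap]
    refine (integrable_map_measure hsm.aestronglyMeasurable hpair.aemeasurable).2 ?_
    exact integrable_inner_of_memLp hW2
      (noise_sq_integral_le hwp hls hbv hX hY hYY hA hU hζ hind hD).1
  calc ∫ ω, inner ℝ (W (U ω)) (F (U ω, ζ ω)) ∂P
      = ∫ p, inner ℝ (W p.1) (F p) ∂(P.map fun ω => (U ω, ζ ω)) :=
        (integral_map hpair.aemeasurable hsm.aestronglyMeasurable).symm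
    _ = ∫ a, ∫ ξ, inner ℝ (W a) (F (a, ξ)) ∂(q.D i) ∂(P.map U) := by
        rw [hmap, integral_prod _ hint]
    _ = 0 := by
        refine integral_eq_zero_of_ae (Filter.Eventually.of_forall fun a => ?_)
        by_cases ha : a ∈ A
        · simp only [hF, Set.indicator_of_mem ha]
          rw [integral_inner (integrable_noise hwp hbv i (X a) (hYY a)),
            integral_noise hwp hbv i (X a) (hYY a), inner_zero_right]
          rfl
        · simp [hF, Set.indicator_of_notMem ha]

omit [IsProbabilityMeasure P] in
/-- Pythagoras for pairwise orthogonal random vectors. -/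
theorem integral_norm_sq_sum {ι F : Type*} [NormedAddCommGroup F] [InnerProductSpace ℝ F]
    (s : Finset ι) {f : ι → Ω → F} (hf : ∀ p ∈ s, MemLp (f p) 2 P)
    (horth : ∀ p ∈ s, ∀ r ∈ s, p ≠ r → ∫ ω, inner ℝ (f p ω) (f r ω) ∂P = 0) :
    ∫ ω, ‖∑ p ∈ s, f p ω‖ ^ 2 ∂P = ∑ p ∈ s, ∫ ω, ‖f p ω‖ ^ 2 ∂P := by
  have h1 : ∀ ω, ‖∑ p ∈ s, f p ω‖ ^ 2 = ∑ p ∈ s, ∑ r ∈ s, inner ℝ (f p ω) (f r ω) := by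
    intro ω
    rw [← real_inner_self_eq_norm_sq, sum_inner]
    simp only [inner_sum]
  simp only [h1]
  rw [integral_finsetSum _ fun p hp => integrable_finsetSum _ fun r hr =>
    integrable_inner_of_memLp (hf p hp) (hf r hr)]
  refine Finset.sum_congr rfl fun p hp => ?_
  rw [integral_finsetSum _ fun r hr => integrable_inner_of_memLp (hf p hp) (hf r hr),
    Finset.sum_eq_single p (fun r hr hne => horth p hp r hr hne.symm) (fun h => absurd hp h)]
  simp only [real_inner_self_eq_norm_sq]

/-- Regrouping of independent variables. -/
theorem indepFun_prod_left {α β γ : Type*} [MeasurableSpace α] [MeasurableSpace β]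
    [MeasurableSpace γ] {a : Ω → α} {b : Ω → β} {c : Ω → γ} (ha : Measurable a)
    (hb : Measurable b) (hc : Measurable c) (h : IndepFun a (fun ω => (b ω, c ω)) P)
    (h' : IndepFun b c P) : IndepFun (fun ω => (a ω, b ω)) c P := by
  have hbc : Measurable fun ω => (b ω, c ω) := hb.prodMk hc
  have hab : Measurable fun ω => (a ω, b ω) := ha.prodMk hb
  have h1 := (indepFun_iff_map_prod_eq_prod_map_map ha.aemeasurable hbc.aemeasurable).1 h
  have h2 := (indepFun_iff_map_prod_eq_prod_map_map hb.aemeasurable hc.aemeasurable).1 h'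
  have h3 := (indepFun_iff_map_prod_eq_prod_map_map ha.aemeasurable hb.aemeasurable).1
    (h.comp measurable_id measurable_fst)
  have ia := Measure.isProbabilityMeasure_map (μ := P) ha.aemeasurable
  have ib := Measure.isProbabilityMeasure_map (μ := P) hb.aemeasurable
  have ic := Measure.isProbabilityMeasure_map (μ := P) hc.aemeasurable
  rw [indepFun_iff_map_prod_eq_prod_map_map hab.aemeasurable hc.aemeasurable]
  -- Both sides are compared after reassociating the triple, where the law factors by `h1` and `h2`.
  rw [h3, ← MeasurableEquiv.prodAssoc.map_measurableEquiv_injective.eq_iff,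
    Measure.prodAssoc_prod, ← h2, ← h1,
    Measure.map_map MeasurableEquiv.prodAssoc.measurable (hab.prodMk hc)]
  rfl

end Moments

/-! ### The noise of a round -/

section RoundNoise

variable {Ω : Type*} [mΩ : MeasurableSpace Ω]

/-- Everything that happens before round `t`, the clients sampled in round `t`, and the data with
index in `J` of round `t`. -/
def past (S : ℕ → Ω → Finset (Fin M)) (ξ : ℕ → Fin M → ℕ → Ω → Ξ) (t : ℕ)
    (J : Finset (Fin M × ℕ)) (ω : Ω) :
    (Finset.range t → Finset (Fin M) × (Fin M → ℕ → Ξ)) × (Finset (Fin M) × (J → Ξ)) :=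
  (fun r => (S r ω, fun i k => ξ r i k ω), (S t ω, fun j => ξ t j.1.1 j.1.2 ω))

/-- The σ-algebra generated by `past`. -/
abbrev pastSpace (S : ℕ → Ω → Finset (Fin M)) (ξ : ℕ → Fin M → ℕ → Ω → Ξ) (t : ℕ)
    (J : Finset (Fin M × ℕ)) : MeasurableSpace Ω :=
  MeasurableSpace.comap (past S ξ t J) inferInstance

theorem IsSampling.measurable_past {P : Measure Ω} {q : Problem M d₁ d₂ Ξ} {m : ℕ}
    {S : ℕ → Ω → Finset (Fin M)} {ξ : ℕ → Fin M → ℕ → Ω → Ξ} (hs : IsSampling P q m S ξ) (t : ℕ)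
    (J : Finset (Fin M × ℕ)) : Measurable (past S ξ t J) := by
  have h1 := hs.measurable_set
  have h2 := hs.measurable_data
  unfold past
  fun_prop

/-- Independence is assembled in layers: among the data of a round, between its client set and its
data, and between rounds. `indepFun_prod_left` joins each layer to the next. -/
theorem IsSampling.indepFun_past {P : Measure Ω} [IsProbabilityMeasure P] {q : Problem M d₁ d₂ Ξ}
    {m : ℕ} {S : ℕ → Ω → Finset (Fin M)} {ξ : ℕ → Fin M → ℕ → Ω → Ξ}
    (hs : IsSampling P q m S ξ) (t : ℕ) {J : Finset (Fin M × ℕ)} {p : Fin M × ℕ} (hp : p ∉ J) :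
    IndepFun (past S ξ t J) (ξ t p.1 p.2) P := by
  have m1 := hs.measurable_set
  have m2 := hs.measurable_data
  have h1 : IndepFun (fun ω (j : J) => ξ t j.1.1 j.1.2 ω) (ξ t p.1 p.2) P :=
    ((hs.indep_data t).indepFun_finset J {p} (Finset.disjoint_singleton_right.2 hp)
      (fun j => m2 t j.1 j.2)).comp measurable_id
      (measurable_pi_apply (⟨p, Finset.mem_singleton_self p⟩ : ({p} : Finset (Fin M × ℕ))))
  have h2 : IndepFun (S t) (fun ω => ((fun (j : J) => ξ t j.1.1 j.1.2 ω), ξ t p.1 p.2 ω)) P :=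
    (hs.indep_set_data t).comp (ψ := fun d : Fin M → ℕ → Ξ =>
      ((fun j : J => d j.1.1 j.1.2), d p.1 p.2)) measurable_id (by fun_prop)
  have h3 := indepFun_prod_left (m1 t) (by fun_prop) (m2 t p.1 p.2) h2 h1
  have h4 : IndepFun (fun ω (r : Finset.range t) => (S r ω, fun i k => ξ r i k ω))
      (fun ω => ((S t ω, fun j : J => ξ t j.1.1 j.1.2 ω), ξ t p.1 p.2 ω)) P :=
    (hs.indep_rounds.indepFun_finset (Finset.range t) {t} (by simp) (by fun_prop)).comp
      (ψ := fun d : ({t} : Finset ℕ) → Finset (Fin M) × (Fin M → ℕ → Ξ) =>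
        (((d ⟨t, Finset.mem_singleton_self t⟩).1,
          fun j : J => (d ⟨t, Finset.mem_singleton_self t⟩).2 j.1.1 j.1.2),
          (d ⟨t, Finset.mem_singleton_self t⟩).2 p.1 p.2)) measurable_id (by fun_prop)
  exact indepFun_prod_left (by fun_prop) (by fun_prop) (m2 t p.1 p.2) h4 h3

/-- The sets drawn in the algorithm have `m` elements. -/
theorem IsSampling.ae_card {P : Measure Ω} {q : Problem M d₁ d₂ Ξ}
    {m : ℕ} {S : ℕ → Ω → Finset (Fin M)} {ξ : ℕ → Fin M → ℕ → Ω → Ξ}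
    (hs : IsSampling P q m S ξ) : ∀ᵐ ω ∂P, ∀ t, (S t ω).card = m := by
  rw [ae_all_iff]
  intro t
  have h1 : ∀ s : Finset (Fin M), ∀ᵐ ω ∂P, S t ω = s → s.card = m := by
    intro s
    by_cases hc : s.card = m
    · exact Filter.Eventually.of_forall fun _ _ => hc
    · have h2 := hs.set_law t s
      rw [if_neg hc] at h2
      rw [ae_iff]
      simpa [hc] using h2
  filter_upwards [ae_all_iff.2 h1] with ω hω using hω _ rfl

variable (q : Problem M d₁ d₂ Ξ) (par : Params) (x₀ z₀ : E d₁) (y₀ : E d₂)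
  (S : ℕ → Ω → Finset (Fin M)) (ξ : ℕ → Fin M → ℕ → Ω → Ξ) (t : ℕ)

/-- State before round `t`. -/
def stateAt (ω : Ω) : State M d₁ d₂ :=
  run q par x₀ y₀ z₀ (fun t => S t ω) (fun t i k => ξ t i k ω) t

/-- Noise of the local step `p.2` of client `p.1` in round `t`, zero for an idle client. -/
def maskedNoise (p : Fin M × ℕ) (ω : Ω) : WithLp 2 (E d₁ × E d₂) :=
  {ω | p.1 ∈ S t ω}.indicator (fun ω => localNoise q par p.1 (stateAt q par x₀ z₀ y₀ S ξ t ω).x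
    (stateAt q par x₀ z₀ y₀ S ξ t ω).y (fun k => ξ t p.1 k ω) p.2) ω

variable {q par x₀ z₀ y₀ S ξ t} {l σ : ℝ}

theorem measurable_maskedNoise (hwp : q.WellPosed) (hls : q.LipschitzSmooth l)
    (hne : q.Y.Nonempty) (hc : IsCompact q.Y) (hconv : Convex ℝ q.Y) (hy₀ : y₀ ∈ q.Y)
    (p : Fin M × ℕ) (hS : ∀ r ≤ t, Measurable (S r))
    (hξ : ∀ r < t, ∀ i k, Measurable (ξ r i k)) (hξt : ∀ j ≤ p.2, Measurable (ξ t p.1 j)) :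
    Measurable (maskedNoise q par x₀ z₀ y₀ S ξ t p) := by
  obtain ⟨h1, h2, -⟩ := measurable_run (par := par) (x₀ := x₀) (z₀ := z₀) hwp hne hc hconv hy₀ t
    (fun r hr => hS r hr.le) hξ
  exact (measurable_localNoise hwp hls hne hc hconv p.1 h1 h2
    (fun ω => run_y_mem hne hc hy₀ _ _ t) p.2 hξt).indicator
      (hS t le_rfl (MeasurableSet.of_discrete (s := {s : Finset (Fin M) | p.1 ∈ s})))

omit mΩ in
theorem measurable_past_set {J : Finset (Fin M × ℕ)} {r : ℕ} (hr : r ≤ t) :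
    Measurable[pastSpace S ξ t J] (S r) := by
  rcases hr.lt_or_eq with hr | rfl
  · have h : Measurable fun u : (Finset.range t → Finset (Fin M) × (Fin M → ℕ → Ξ)) ×
        (Finset (Fin M) × (J → Ξ)) => (u.1 ⟨r, Finset.mem_range.2 hr⟩).1 := by fun_prop
    exact h.comp (comap_measurable (past S ξ t J))
  · exact (measurable_fst.comp measurable_snd).comp (comap_measurable (past S ξ r J))

omit mΩ in
theorem measurable_past_data {J : Finset (Fin M × ℕ)} {r : ℕ} (hr : r < t) (i : Fin M) (k : ℕ) :
    Measurable[pastSpace S ξ t J] (ξ r i k) := by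
  have h : Measurable fun u : (Finset.range t → Finset (Fin M) × (Fin M → ℕ → Ξ)) ×
      (Finset (Fin M) × (J → Ξ)) => (u.1 ⟨r, Finset.mem_range.2 hr⟩).2 i k := by fun_prop
  exact h.comp (comap_measurable (past S ξ t J))

omit mΩ in
theorem measurable_past_current {J : Finset (Fin M × ℕ)} {p : Fin M × ℕ} (hp : p ∈ J) :
    Measurable[pastSpace S ξ t J] (ξ t p.1 p.2) := by
  have h : Measurable fun u : (Finset.range t → Finset (Fin M) × (Fin M → ℕ → Ξ)) ×
      (Finset (Fin M) × (J → Ξ)) => u.2.2 ⟨p, hp⟩ := by fun_prop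
  exact h.comp (comap_measurable (past S ξ t J))

variable {P : Measure Ω} [IsProbabilityMeasure P] {m : ℕ}

/-- All data of the round except the one drawn at `p` count as past. Relative to this past the
iterate at `p` is known and its data are fresh, and so is the noise at any `r` whose history avoids
`p`. -/
theorem maskedNoise_moments (hwp : q.WellPosed) (hls : q.LipschitzSmooth l)
    (hbv : q.BoundedVariance σ) (hne : q.Y.Nonempty) (hc : IsCompact q.Y) (hconv : Convex ℝ q.Y)
    (hy₀ : y₀ ∈ q.Y) (hs : IsSampling P q m S ξ) {K : ℕ} {p : Fin M × ℕ} (hp : p.2 < K) :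
    MemLp (maskedNoise q par x₀ z₀ y₀ S ξ t p) 2 P ∧
    ∫ ω, ‖maskedNoise q par x₀ z₀ y₀ S ξ t p ω‖ ^ 2 ∂P ≤ σ ^ 2 * P.real {ω | p.1 ∈ S t ω} ∧
    ∀ r : Fin M × ℕ, r.2 < K → (∀ j ≤ r.2, (r.1, j) ≠ p) →
      MemLp (maskedNoise q par x₀ z₀ y₀ S ξ t r) 2 P →
      ∫ ω, inner ℝ (maskedNoise q par x₀ z₀ y₀ S ξ t r ω)
        (maskedNoise q par x₀ z₀ y₀ S ξ t p ω) ∂P = 0 := by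
  set J : Finset (Fin M × ℕ) := (Finset.univ ×ˢ Finset.range K).erase p with hJ
  have hmemJ : ∀ r : Fin M × ℕ, r.2 < K → r ≠ p → r ∈ J := fun r hr hne =>
    Finset.mem_erase.2 ⟨hne, Finset.mem_product.2 ⟨Finset.mem_univ _, Finset.mem_range.2 hr⟩⟩
  have hle : (pastSpace S ξ t J) ≤ mΩ := (hs.measurable_past t J).comap_le
  -- The past is encoded as the identity map into `Ω` with the coarser σ-algebra, so the iterates
  -- need not be factored explicitly through `past`.
  have hid : Measurable[mΩ, (pastSpace S ξ t J)] (id : Ω → Ω) := fun s hs => hle s hs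
  have hind : @IndepFun Ω Ω Ξ mΩ (pastSpace S ξ t J) _ id (ξ t p.1 p.2) P := by
    have h1 := hs.indepFun_past t (Finset.notMem_erase p (Finset.univ ×ˢ Finset.range K))
    change Indep (MeasurableSpace.comap id (pastSpace S ξ t J))
      (MeasurableSpace.comap (ξ t p.1 p.2) inferInstance) P
    rw [MeasurableSpace.comap_id]
    exact h1
  obtain ⟨h1, h2, -⟩ := measurable_run (mΩ := (pastSpace S ξ t J)) (par := par) (x₀ := x₀) (z₀ := z₀) hwp hne hc
    hconv hy₀ t (S := S) (ξ := ξ) (fun r hr => measurable_past_set hr.le)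
    (fun r hr i k => measurable_past_data hr i k)
  obtain ⟨h3, h4, -⟩ := measurable_localRun (mΩ := (pastSpace S ξ t J)) (par := par) (ξ := fun ω k => ξ t p.1 k ω)
    hwp hne hc hconv p.1 h1 h2 (fun ω => run_y_mem hne hc hy₀ _ _ t) p.2 (fun j hj =>
      measurable_past_current (hmemJ (p.1, j) (hj.trans hp) fun h => hj.ne (congrArg Prod.snd h)))
  have hA : MeasurableSet[(pastSpace S ξ t J)] {ω | p.1 ∈ S t ω} :=
    (measurable_past_set le_rfl) (MeasurableSet.of_discrete (s := {s : Finset (Fin M) | p.1 ∈ s}))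
  have hY : ∀ ω, (localRun q par p.1 (stateAt q par x₀ z₀ y₀ S ξ t ω).x
      (stateAt q par x₀ z₀ y₀ S ξ t ω).y (fun k => ξ t p.1 k ω) p.2).y ∈ q.Y := fun ω =>
    localRun_y_mem par _ _ _ hne hc (run_y_mem hne hc hy₀ _ _ t) _
  have hζ := hs.measurable_data t p.1 p.2
  have hD := hs.data_law t p.1 p.2
  have key := noise_sq_integral_le (m𝒳 := (pastSpace S ξ t J)) hwp hls hbv h3 h4 hY hA hid hζ hind hD
  refine ⟨key.1, key.2, fun r hr hrp hr2 => ?_⟩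
  exact integral_inner_noise (m𝒳 := (pastSpace S ξ t J)) hwp hls hbv h3 h4 hY hA hid hζ hind hD
    (measurable_maskedNoise (mΩ := (pastSpace S ξ t J)) hwp hls hne hc hconv hy₀ r
      (fun r hr => measurable_past_set hr) (fun r hr i k => measurable_past_data hr i k)
      (fun j hj => measurable_past_current (hmemJ (r.1, j) (hj.trans_lt hr) (hrp j hj)))) hr2

omit mΩ in
theorem sum_sum_localNoise_eq (ω : Ω) :
    ∑ i ∈ S t ω, ∑ k ∈ Finset.range par.K,
      localNoise q par i (stateAt q par x₀ z₀ y₀ S ξ t ω).x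
        (stateAt q par x₀ z₀ y₀ S ξ t ω).y (fun k => ξ t i k ω) k
    = ∑ p ∈ Finset.univ ×ˢ Finset.range par.K, maskedNoise q par x₀ z₀ y₀ S ξ t p ω := by
  classical
  rw [Finset.sum_product]
  simp only [maskedNoise, Set.indicator_apply, Set.mem_ofPred_eq]
  rw [← Finset.sum_subset (Finset.subset_univ (S t ω))]
  · exact Finset.sum_congr rfl fun i hi => by simp [hi]
  · intro i _ hi
    simp [hi]

omit mΩ in
theorem roundNoiseSq_eq (ω : Ω) :
    roundNoiseSq q par (stateAt q par x₀ z₀ y₀ S ξ t ω).x (stateAt q par x₀ z₀ y₀ S ξ t ω).y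
      (S t ω) (fun i k => ξ t i k ω)
    = ∑ p ∈ Finset.univ ×ˢ Finset.range par.K, ‖maskedNoise q par x₀ z₀ y₀ S ξ t p ω‖ ^ 2 := by
  classical
  rw [Finset.sum_product, roundNoiseSq]
  simp only [maskedNoise, Set.indicator_apply, Set.mem_ofPred_eq]
  rw [← Finset.sum_subset (Finset.subset_univ (S t ω))]
  · exact Finset.sum_congr rfl fun i hi => by simp [hi]
  · intro i _ hi
    simp [hi]

/-- Double counting: almost surely the membership indicators sum to `|S_t| = m`. -/
theorem IsSampling.sum_prob_mem (hs : IsSampling P q m S ξ) :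
    ∑ i, P.real {ω | i ∈ S t ω} = m := by
  classical
  have hA : ∀ i, MeasurableSet {ω | i ∈ S t ω} := fun i =>
    hs.measurable_set t (MeasurableSet.of_discrete (s := {s : Finset (Fin M) | i ∈ s}))
  calc ∑ i, P.real {ω | i ∈ S t ω}
      = ∑ i, ∫ ω, {ω | i ∈ S t ω}.indicator (fun _ => (1 : ℝ)) ω ∂P := by
        refine Finset.sum_congr rfl fun i _ => ?_
        rw [integral_indicator_const _ (hA i), smul_eq_mul, mul_one]
    _ = ∫ ω, ∑ i, {ω | i ∈ S t ω}.indicator (fun _ => (1 : ℝ)) ω ∂P :=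
        (integral_finsetSum _ fun i _ => (integrable_const _).indicator (hA i)).symm
    _ = ∫ _, (m : ℝ) ∂P := by
        refine integral_congr_ae ?_
        filter_upwards [hs.ae_card] with ω hω
        simp [Set.indicator_apply, ← hω t]
    _ = m := by simp

/-- Expected error of a round. -/
theorem integral_roundError_le (hwp : q.WellPosed) (hls : q.LipschitzSmooth l)
    (hbv : q.BoundedVariance σ) (hne : q.Y.Nonempty) (hc : IsCompact q.Y) (hconv : Convex ℝ q.Y)
    (hy₀ : y₀ ∈ q.Y) (hs : IsSampling P q par.m S ξ) (hm : 0 < par.m) (hK : 0 < par.K)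
    (σG Gy : ℝ) :
    Integrable (fun ω => roundError q par l σG Gy (stateAt q par x₀ z₀ y₀ S ξ t ω).x
      (stateAt q par x₀ z₀ y₀ S ξ t ω).y (S t ω) (fun i k => ξ t i k ω)) P ∧
    ∫ ω, roundError q par l σG Gy (stateAt q par x₀ z₀ y₀ S ξ t ω).x
      (stateAt q par x₀ z₀ y₀ S ξ t ω).y (S t ω) (fun i k => ξ t i k ω) ∂P ≤
      6 * (σ ^ 2 / (par.m * par.K)) + 24 * (l * (par.ηxl + par.ηyl) * par.K) ^ 2 * σ ^ 2
        + 24 * (l * par.K * ((par.ηxl + par.ηyl) * σG + par.ηyl * Gy)) ^ 2 := by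
  have hm' : (0 : ℝ) < par.m := by exact_mod_cast hm
  have hK' : (0 : ℝ) < par.K := by exact_mod_cast hK
  set s : Finset (Fin M × ℕ) := Finset.univ ×ˢ Finset.range par.K with hsdef
  set f := maskedNoise q par x₀ z₀ y₀ S ξ t with hf
  have hlt : ∀ p ∈ s, p.2 < par.K := fun p hp => Finset.mem_range.1 (Finset.mem_product.1 hp).2
  have hmom := fun p (hp : p ∈ s) => maskedNoise_moments (par := par) (x₀ := x₀) (z₀ := z₀)
    (t := t) hwp hls hbv hne hc hconv hy₀ hs (hlt p hp)
  have hsum : ∑ p ∈ s, ∫ ω, ‖f p ω‖ ^ 2 ∂P ≤ par.m * par.K * σ ^ 2 := by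
    refine (Finset.sum_le_sum fun p hp => (hmom p hp).2.1).trans_eq ?_
    rw [hsdef, Finset.sum_product]
    simp only [Finset.sum_const, Finset.card_range, nsmul_eq_mul, ← Finset.mul_sum,
      hs.sum_prob_mem]
    ring
  have hpyth := integral_norm_sq_sum s (fun p hp => (hmom p hp).1) (by
    intro p hp r hr hpr
    -- If the history of `p` contains `r`, both belong to the same client and `r` is the earlier
    -- step; the roles are then exchanged and `p` supplies the fresh data.
    by_cases h1 : ∀ j ≤ p.2, (p.1, j) ≠ r
    · exact (hmom r hr).2.2 p (hlt p hp) h1 (hmom p hp).1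
    · push Not at h1
      obtain ⟨j, hj, rfl⟩ := h1
      refine (integral_congr_ae (.of_forall fun ω => real_inner_comm _ _)).trans ?_
      refine (hmom p hp).2.2 (p.1, j) (hlt _ hr) ?_ (hmom _ hr).1
      intro k hk hkp
      have hkj : p.2 ≤ j := (congrArg Prod.snd hkp).symm.trans_le hk
      exact hpr (Prod.ext rfl (le_antisymm hkj hj)))
  have hI1 : ∀ p ∈ s, Integrable (fun ω => ‖f p ω‖ ^ 2) P := fun p hp =>
    (memLp_two_iff_integrable_sq_norm (hmom p hp).1.1).1 (hmom p hp).1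
  have hI2 : Integrable (fun ω => ‖∑ p ∈ s, f p ω‖ ^ 2) P := by
    have := memLp_finsetSum s fun p hp => (hmom p hp).1
    exact (memLp_two_iff_integrable_sq_norm this.1).1 this
  have heq : ∀ ω, roundError q par l σG Gy (stateAt q par x₀ z₀ y₀ S ξ t ω).x
      (stateAt q par x₀ z₀ y₀ S ξ t ω).y (S t ω) (fun i k => ξ t i k ω) =
      6 * ((((par.m : ℝ) * par.K)⁻¹) ^ 2 * ‖∑ p ∈ s, f p ω‖ ^ 2)
      + 24 * (l * (par.ηxl + par.ηyl)) ^ 2 * ((par.K / par.m : ℝ) * ∑ p ∈ s, ‖f p ω‖ ^ 2)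
      + 24 * (l * par.K * ((par.ηxl + par.ηyl) * σG + par.ηyl * Gy)) ^ 2 := by
    intro ω
    rw [roundError, roundNoiseSq_eq, roundNoise, sum_sum_localNoise_eq, norm_smul, mul_pow,
      norm_inv, Real.norm_of_nonneg (by positivity)]
  simp only [heq]
  have hJ1 := (hI2.const_mul ((((par.m : ℝ) * par.K)⁻¹) ^ 2)).const_mul 6
  have hJ2 := ((integrable_finsetSum s hI1).const_mul (par.K / par.m : ℝ)).const_mul
    (24 * (l * (par.ηxl + par.ηyl)) ^ 2)
  have hJ := hJ1.add hJ2
  simp only [Pi.add_def] at hJ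
  refine ⟨hJ.add (integrable_const _), ?_⟩
  rw [integral_add hJ (integrable_const _), integral_add hJ1 hJ2, integral_const_mul,
    integral_const_mul, integral_const_mul, integral_const_mul, integral_finsetSum s hI1, hf, hpyth, ← hf,
    integral_const, probReal_univ, one_smul]
  have e1 : (((par.m : ℝ) * par.K)⁻¹) ^ 2 * (par.m * par.K * σ ^ 2) = σ ^ 2 / (par.m * par.K) := by
    field_simp
  have e2 : (par.K / par.m : ℝ) * (par.m * par.K * σ ^ 2) = par.K ^ 2 * σ ^ 2 := by field_simp
  have b1 := mul_le_mul_of_nonneg_left hsum (show 0 ≤ (((par.m : ℝ) * par.K)⁻¹) ^ 2 by positivity)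
  have b2 := mul_le_mul_of_nonneg_left (mul_le_mul_of_nonneg_left hsum
    (show 0 ≤ (par.K / par.m : ℝ) by positivity))
    (show 0 ≤ 24 * (l * (par.ηxl + par.ηyl)) ^ 2 by positivity)
  rw [e1] at b1
  rw [e2] at b2
  linarith

end RoundNoise

/-! ### Summing the rounds -/

section Convergence

variable {Ω : Type*} [MeasurableSpace Ω] {q : Problem M d₁ d₂ Ξ} {par : Params} {x₀ z₀ : E d₁}
  {y₀ : E d₂} {S : ℕ → Ω → Finset (Fin M)} {ξ : ℕ → Fin M → ℕ → Ω → Ξ} {l μ σ σG Gy : ℝ}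

/-- The stationarity measure controlled by the potential. -/
def gap (q : Problem M d₁ d₂ Ξ) (l μ : ℝ) (x : E d₁) (y : E d₂) : ℝ :=
  1 / 1000000000 * (μ / l) * ‖gradX q.obj x y‖ ^ 2 + residualY q.obj q.Y l x y ^ 2 / 2000

theorem measurable_gradX_stateAt (h : q.Regular l μ) (hwp : q.WellPosed) (hy₀ : y₀ ∈ q.Y)
    {P : Measure Ω} {m : ℕ} (hs : IsSampling P q m S ξ) (t : ℕ) :
    Measurable (fun ω => gradX q.obj (stateAt q par x₀ z₀ y₀ S ξ t ω).x
      (stateAt q par x₀ z₀ y₀ S ξ t ω).y) ∧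
    Measurable (fun ω => residualY q.obj q.Y l (stateAt q par x₀ z₀ y₀ S ξ t ω).x
      (stateAt q par x₀ z₀ y₀ S ξ t ω).y) := by
  obtain ⟨h1, h2, -⟩ := measurable_run (par := par) (x₀ := x₀) (z₀ := z₀) hwp h.nonempty
    h.compact h.convex hy₀ t (fun r _ => hs.measurable_set r) fun r _ => hs.measurable_data r
  have h3 := (WithLp.measurable_ofLp 2 _).comp (measurable_grad_of_lipschitz h.lipschitz h1 h2
    fun ω => run_y_mem h.nonempty h.compact hy₀ _ _ t)
  refine ⟨h3.fst, ?_⟩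
  exact ((((continuous_proj h.nonempty h.compact h.convex).measurable.comp
    (h2.add (h3.snd.const_smul (1 / l)))).sub h2).norm).const_mul l

theorem gap_nonneg (hl : 0 < l) (hμ : 0 < μ) (x : E d₁) (y : E d₂) : 0 ≤ gap q l μ x y := by
  unfold gap; positivity

/-- Total expected stationarity gap over `T` rounds. -/
theorem sum_integral_gap_le (h : q.Regular l μ) (hwp : q.WellPosed) (hls : q.LipschitzSmooth l)
    (hbv : q.BoundedVariance σ) (hσG : 0 ≤ σG) (hhet : q.BoundedHeterogeneity σG)
    (hG : q.LipschitzInY Gy) (hGy : 0 ≤ Gy) (hy₀ : y₀ ∈ q.Y)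
    {P : Measure Ω} [IsProbabilityMeasure P] (hs : IsSampling P q par.m S ξ)
    (hηx : 0 ≤ par.ηxl) (hηy : 0 ≤ par.ηyl)
    (hηK : (par.ηxl + par.ηyl) * l * par.K ≤ 1 / 2)
    (hηx2 : (par.ηxl * (l * par.K)) ^ 2 ≤ (μ / l) / 100000000000)
    (hm : 0 < par.m) (hK : 0 < par.K) (hfull : par.m = M ∨ σG = 0)
    (hp : par.p = 2 * l) {α : ℝ} (hα0 : 0 < α) (hα : par.ηxg * par.ηxl * par.K = α)
    (hαl : α * l ≤ 1 / 1000) (hηxy : par.ηyg * par.ηyl = par.ηxg * par.ηxl / 256)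
    (hβ : par.β = par.ηyg * par.ηyl * par.K * μ / 80000)
    {Φstar Δ ρ : ℝ} (hΦ : ∀ x, Φstar ≤ q.Phi x)
    (hΔ : q.potential (2 * l) x₀ y₀ z₀ - Φstar ≤ Δ)
    (hρ : 6 * (σ ^ 2 / (par.m * par.K)) + 24 * (l * (par.ηxl + par.ηyl) * par.K) ^ 2 * σ ^ 2
        + 24 * (l * par.K * ((par.ηxl + par.ηyl) * σG + par.ηyl * Gy)) ^ 2 ≤ ρ) (T : ℕ) :
    (∀ t < T, Integrable (fun ω => gap q l μ (stateAt q par x₀ z₀ y₀ S ξ t ω).x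
      (stateAt q par x₀ z₀ y₀ S ξ t ω).y) P) ∧
    ∑ t ∈ Finset.range T, ∫ ω, gap q l μ (stateAt q par x₀ z₀ y₀ S ξ t ω).x
      (stateAt q par x₀ z₀ y₀ S ξ t ω).y ∂P ≤ Δ / α + T * (2 * ρ) := by
  have hl := h.l_pos
  have hμ := h.μ_pos
  set st := stateAt q par x₀ z₀ y₀ S ξ with hst
  set Q : ℕ → Ω → ℝ := fun t ω => gap q l μ (st t ω).x (st t ω).y with hQ
  set R : ℕ → Ω → ℝ := fun t ω =>
    roundError q par l σG Gy (st t ω).x (st t ω).y (S t ω) (fun i k => ξ t i k ω) with hR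
  have hym : ∀ t ω, (st t ω).y ∈ q.Y := fun t ω => run_y_mem h.nonempty h.compact hy₀ _ _ t
  have hRm := fun t => integral_roundError_le (par := par) (x₀ := x₀) (z₀ := z₀) (t := t) hwp hls
    hbv h.nonempty h.compact h.convex hy₀ hs hm hK σG Gy
  have hQ0 : ∀ t ω, 0 ≤ Q t ω := fun t ω => gap_nonneg hl hμ _ _
  -- The telescoping is done pathwise, before any expectation, so integrability of the potential is
  -- never required.
  have hdesc : ∀ᵐ ω ∂P, ∑ t ∈ Finset.range T, Q t ω ≤
      Δ / α + ∑ t ∈ Finset.range T, 2 * R t ω := by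
    filter_upwards [hs.ae_card] with ω hω
    have hind : ∀ n, q.potential (2 * l) (st n ω).x (st n ω).y (st n ω).z
        + α * ∑ t ∈ Finset.range n, Q t ω ≤ q.potential (2 * l) x₀ y₀ z₀
        + α * ∑ t ∈ Finset.range n, 2 * R t ω := by
      intro n
      induction n with
      | zero => simp [hst, stateAt, run]
      | succ n ih =>
        have h1 := potential_run_succ_le (x₀ := x₀) (z₀ := z₀) (ξ := fun t i k => ξ t i k ω)
          h hls hσG hhet hG hGy (hym n ω) hηx hηy hηK hηx2 hm hK (hω n) hfull hp hα0 hα hαl hηxy hβ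
        simp only at h1
        have h2 : q.potential (2 * l) (st (n + 1) ω).x (st (n + 1) ω).y (st (n + 1) ω).z ≤
          q.potential (2 * l) (st n ω).x (st n ω).y (st n ω).z - α * Q n ω + 2 * α * R n ω := h1
        rw [Finset.sum_range_succ, Finset.sum_range_succ]
        linarith
    have h3 := hind T
    have h4 := h.le_potential hΦ (st T ω).x (st T ω).z (hym T ω)
    refine le_of_mul_le_mul_left ?_ hα0
    rw [mul_add, mul_div_cancel₀ _ hα0.ne']
    linarith
  have hHint : Integrable (fun ω => Δ / α + ∑ t ∈ Finset.range T, 2 * R t ω) P :=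
    (integrable_const _).add (integrable_finsetSum _ fun t _ => (hRm t).1.const_mul 2)
  -- Each nonnegative gap is dominated by the integrable right side of `hdesc`; no prior moment
  -- bound on the iterates is needed.
  have hQint : ∀ t < T, Integrable (Q t) P := by
    intro t ht
    obtain ⟨m1, m2⟩ := measurable_gradX_stateAt (par := par) (x₀ := x₀) (z₀ := z₀) h hwp hy₀ hs t
    refine Integrable.mono' hHint (((m1.norm.pow_const 2).const_mul _).add
      ((m2.pow_const 2).div_const _)).aestronglyMeasurable ?_
    filter_upwards [hdesc] with ω hω
    rw [Real.norm_of_nonneg (hQ0 t ω)]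
    exact (Finset.single_le_sum (f := fun t => Q t ω) (fun t _ => hQ0 t ω)
      (Finset.mem_range.2 ht)).trans hω
  refine ⟨hQint, ?_⟩
  calc ∑ t ∈ Finset.range T, ∫ ω, Q t ω ∂P
      = ∫ ω, ∑ t ∈ Finset.range T, Q t ω ∂P :=
        (integral_finsetSum _ fun t ht => hQint t (Finset.mem_range.1 ht)).symm
    _ ≤ ∫ ω, (Δ / α + ∑ t ∈ Finset.range T, 2 * R t ω) ∂P :=
        integral_mono_ae (integrable_finsetSum _ fun t ht => hQint t (Finset.mem_range.1 ht))
          hHint hdesc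
    _ = Δ / α + ∑ t ∈ Finset.range T, 2 * ∫ ω, R t ω ∂P := by
        rw [integral_add (integrable_const _)
          (integrable_finsetSum _ fun t _ => (hRm t).1.const_mul 2),
          integral_finsetSum _ fun t _ => (hRm t).1.const_mul 2]
        simp only [integral_const_mul, integral_const, probReal_univ, one_smul]
        rfl
    _ ≤ Δ / α + ∑ _t ∈ Finset.range T, 2 * ρ := by
        gcongr with t _
        exact (hRm t).2.trans hρ
    _ = _ := by simp

/-- Markov's inequality for the probability of stationarity. -/
theorem prob_stationary_ge {P : Measure Ω} [IsProbabilityMeasure P] {f : E d₁ → E d₂ → ℝ}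
    {Y : Set (E d₂)} {X : Ω → E d₁} {V : Ω → E d₂} {ε₁ ε₂ : ℝ}
    (hε₁ : 0 < ε₁) (hε₂ : 0 < ε₂)
    (h₁ : Integrable (fun ω => ‖gradX f (X ω) (V ω)‖ ^ 2) P)
    (h₂ : Integrable (fun ω => residualY f Y l (X ω) (V ω) ^ 2) P) :
    1 - (∫ ω, ‖gradX f (X ω) (V ω)‖ ^ 2 ∂P) / ε₁ ^ 2
      - (∫ ω, residualY f Y l (X ω) (V ω) ^ 2 ∂P) / ε₂ ^ 2
    ≤ P.real {ω | IsStationaryPoint f Y l ε₁ ε₂ (X ω) (V ω)} := by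
  set A := {ω | ε₁ ^ 2 ≤ ‖gradX f (X ω) (V ω)‖ ^ 2}
  set B := {ω | ε₂ ^ 2 ≤ residualY f Y l (X ω) (V ω) ^ 2}
  set C := {ω | IsStationaryPoint f Y l ε₁ ε₂ (X ω) (V ω)}
  have hA := mul_meas_ge_le_integral_of_nonneg (μ := P)
    (Filter.Eventually.of_forall fun ω => sq_nonneg ‖gradX f (X ω) (V ω)‖) h₁ (ε₁ ^ 2)
  have hB := mul_meas_ge_le_integral_of_nonneg (μ := P)
    (Filter.Eventually.of_forall fun ω => sq_nonneg (residualY f Y l (X ω) (V ω))) h₂ (ε₂ ^ 2)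
  -- A non-stationary point violates one of the two thresholds. Subadditivity suffices, so
  -- measurability of `C` plays no role.
  have hcover : Set.univ ⊆ C ∪ (A ∪ B) := by
    intro ω _
    by_cases h1 : ‖gradX f (X ω) (V ω)‖ ≤ ε₁
    · by_cases h2 : residualY f Y l (X ω) (V ω) ≤ ε₂
      · exact Or.inl ⟨h1, h2⟩
      · exact Or.inr (Or.inr (pow_le_pow_left₀ hε₂.le (not_le.1 h2).le 2))
    · exact Or.inr (Or.inl (pow_le_pow_left₀ hε₁.le (not_le.1 h1).le 2))
  have h3 : P.real Set.univ ≤ P.real C + (P.real A + P.real B) :=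
    (measureReal_mono hcover).trans ((measureReal_union_le _ _).trans
      (add_le_add le_rfl (measureReal_union_le _ _)))
  rw [probReal_univ] at h3
  have hA' : P.real A ≤ (∫ ω, ‖gradX f (X ω) (V ω)‖ ^ 2 ∂P) / ε₁ ^ 2 := by
    rw [le_div_iff₀ (by positivity), mul_comm]; exact hA
  have hB' : P.real B ≤ (∫ ω, residualY f Y l (X ω) (V ω) ^ 2 ∂P) / ε₂ ^ 2 := by
    rw [le_div_iff₀ (by positivity), mul_comm]; exact hB
  linarith

end Convergence

/-! ### Complexity -/

theorem run_comm (q : Problem M d₁ d₂ Ξ) (par : Params) (x₀ : E d₁) (y₀ : E d₂) (z₀ : E d₁)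
    (S : ℕ → Finset (Fin M)) (ξ : ℕ → Fin M → ℕ → Ξ) (t : ℕ) :
    (run q par x₀ y₀ z₀ S ξ t).comm = t := by
  induction t with
  | zero => rfl
  | succ t ih => exact congrArg (· + 1) ih

theorem run_samples_le (q : Problem M d₁ d₂ Ξ) (par : Params) (x₀ : E d₁) (y₀ : E d₂) (z₀ : E d₁)
    (S : ℕ → Finset (Fin M)) (ξ : ℕ → Fin M → ℕ → Ξ) (t : ℕ) (i : Fin M) :
    (run q par x₀ y₀ z₀ S ξ t).samples i ≤ t * par.K := by
  induction t with
  | zero => exact Nat.zero_le _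
  | succ t ih =>
    rw [Nat.succ_mul]
    refine Nat.add_le_add ih ?_
    split_ifs
    · exact (localRun_samples _ _ _ _ _ _ _).le
    · exact Nat.zero_le _

/-! ### Parameters -/

/-- Rounding up adds less than 1, which the extra unit in `a + 1` absorbs because both ratios are at
least 1. -/
theorem exists_loopLengths {a κ ε : ℝ} {m : ℕ} (ha : 0 < a) (hε : 0 < ε) (hm : 1 ≤ m)
    (hmε : m * ε ^ 2 ≤ κ) : ∃ T K : ℕ, LoopLengths a (a + 1) κ ε m T K := by
  have hm' : (1 : ℝ) ≤ m := by exact_mod_cast hm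
  have h1 : 1 ≤ κ / (m * ε ^ 2) := by rw [le_div_iff₀ (by positivity)]; linarith
  have h2 : 1 ≤ κ / ε ^ 2 := by
    rw [le_div_iff₀ (by positivity)]
    nlinarith [sq_nonneg ε]
  have hceil : ∀ r : ℝ, 1 ≤ r → a * r ≤ ⌈a * r⌉₊ ∧ (⌈a * r⌉₊ : ℝ) ≤ (a + 1) * r := fun r hr =>
    ⟨Nat.le_ceil _, by
      have := (Nat.ceil_lt_add_one (show 0 ≤ a * r by positivity)).le
      linarith⟩
  exact ⟨_, _, (hceil _ h2).1, (hceil _ h2).2, (hceil _ h1).1, (hceil _ h1).2⟩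

theorem LoopLengths.pos {a A κ ε : ℝ} {m T K : ℕ} (h : LoopLengths a A κ ε m T K) (ha : 0 < a)
    (hκ : 0 < κ) (hε : 0 < ε) (hm : 1 ≤ m) : 0 < T ∧ 0 < K := by
  have hm' : (0 : ℝ) < m := by exact_mod_cast hm
  have h1 : (0 : ℝ) < T := lt_of_lt_of_le (by positivity) h.T_lower
  have h2 : (0 : ℝ) < K := lt_of_lt_of_le (by positivity) h.K_lower
  exact ⟨by exact_mod_cast h1, by exact_mod_cast h2⟩

/-- The bounds involve the global rates only through the products `η_x`, `η_y`. These can be fixed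
first, then the local rates chosen small, and the global rates recovered by division. -/
theorem exists_stepRule {l μ Δ σ σG ε c : ℝ} {T K m : ℕ} (hl : 0 < l) (hμ : 0 < μ) (hΔ : 0 < Δ)
    (hσ : 0 < σ) (hε : 0 < ε) (hc : 0 < c) (hT : 0 < T) (hK : 0 < K) (hm : 0 < m) :
    ∃ par : Params, par.K = K ∧ par.m = m ∧ StepRule l μ Δ σ σG ε c T par := by
  have hT' : (0 : ℝ) < T := by exact_mod_cast hT
  have hK' : (0 : ℝ) < K := by exact_mod_cast hK
  have hm' : (0 : ℝ) < m := by exact_mod_cast hm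
  set ηx := min (1 / (1000 * K * l)) (√(m * Δ) / (σ * √(K * T * l))) with hηx
  have hηx0 : 0 < ηx := by rw [hηx]; positivity
  set β := ηx / 256 * K * μ / 80000 with hβ
  set B₁ := 2 * l * √(2 * (2 * (K : ℝ) - 1) * (K - 1)) with hB₁
  have hB₁0 : 0 ≤ B₁ := by positivity
  set B₃ := c * (ε * √((l / μ)⁻¹ * (σG ^ 2 + σ ^ 2)) * (K * l)⁻¹) with hB₃
  have hB₃0 : 0 < B₃ := by positivity
  set X₂ := √(β / (6144 * ηx * (2 * l) * l ^ 2 * K ^ 3)) with hX₂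
  have hX₂0 : 0 < X₂ := by positivity
  set Y₂ := √(ηx / 256 / (3072 * ηx * l ^ 2 * K ^ 2)) with hY₂
  have hY₂0 : 0 < Y₂ := by positivity
  -- The 1 in the denominator keeps the bound meaningful for `K = 1`, where `B₁ = 0`.
  have hfirst : ∀ r, (min (1 / (1 + B₁)) r) * B₁ ≤ 1 := fun r => by
    refine (mul_le_mul_of_nonneg_right (min_le_left _ _) hB₁0).trans ?_
    rw [one_div_mul_eq_div, div_le_one (by positivity)]
    linarith
  set ηxl := min (1 / (1 + B₁)) (min X₂ B₃) with hηxl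
  set ηyl := min (1 / (1 + B₁)) (min Y₂ B₃) with hηyl
  have hηxl0 : 0 < ηxl := by rw [hηxl]; positivity
  have hηyl0 : 0 < ηyl := by rw [hηyl]; positivity
  have ex : ηx / ηxl * ηxl = ηx := div_mul_cancel₀ _ hηxl0.ne'
  have ey : ηx / 256 / ηyl * ηyl = ηx / 256 := div_mul_cancel₀ _ hηyl0.ne'
  refine ⟨⟨ηxl, ηyl, ηx / ηxl, ηx / 256 / ηyl, β, 2 * l, K, m⟩, rfl, rfl, ?_⟩
  constructor
  · exact hηxl0
  · exact hηyl0
  · rfl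
  · exact ex
  · simp only [ex, ey]
  · simp only [ey, hβ]
  · exact hfirst _
  · simp only [ex]
    exact (min_le_right _ _).trans (min_le_left _ _)
  · exact (min_le_right _ _).trans (min_le_right _ _)
  · exact hfirst _
  · simp only [ex, ey]
    exact (min_le_right _ _).trans (min_le_left _ _)
  · exact (min_le_right _ _).trans (min_le_right _ _)

namespace StepRule

variable {l μ Δ σ σG ε c : ℝ} {T : ℕ} {par : Params} (hr : StepRule l μ Δ σ σG ε c T par)
  (hl : 0 < l) (hμ : 0 < μ) (hK : 0 < par.K)

include hr hl hK

theorem ηx_pos (hΔ : 0 < Δ) (hσ : 0 < σ) (hT : 0 < T) (hm : 0 < par.m) :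
    0 < par.ηxg * par.ηxl := by
  have hT' : (0 : ℝ) < T := by exact_mod_cast hT
  have hK' : (0 : ℝ) < par.K := by exact_mod_cast hK
  have hm' : (0 : ℝ) < par.m := by exact_mod_cast hm
  rw [hr.ηx_eq]
  positivity

theorem ηx_mul_le : par.ηxg * par.ηxl * par.K * l ≤ 1 / 1000 := by
  have hK' : (0 : ℝ) < par.K := by exact_mod_cast hK
  rw [hr.ηx_eq]
  calc _ ≤ 1 / (1000 * par.K * l) * par.K * l := by gcongr; exact min_le_left _ _
    _ = 1 / 1000 := by field_simp

theorem sq_ηxl_le (hμ : 0 < μ) (hηx : 0 < par.ηxg * par.ηxl) :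
    (par.ηxl * (l * par.K)) ^ 2 ≤ (μ / l) / 100000000000 := by
  have hK' : (0 : ℝ) < par.K := by exact_mod_cast hK
  have h1 := hr.ηxl_le₂
  rw [hr.β_eq, hr.ηy_eq, hr.p_eq] at h1
  generalize par.ηxg * par.ηxl = e at *
  have h2 := pow_le_pow_left₀ hr.ηxl_pos.le h1 2
  rw [Real.sq_sqrt (by positivity)] at h2
  calc (par.ηxl * (l * par.K)) ^ 2 = par.ηxl ^ 2 * (l * par.K) ^ 2 := by ring
    _ ≤ e / 256 * par.K * μ / 80000 / (6144 * e * (2 * l) * l ^ 2 * par.K ^ 3)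
        * (l * par.K) ^ 2 := by gcongr
    -- `β` is proportional to `η_x`, which therefore cancels; the remaining constant exceeds `10¹¹`.
    _ = μ / l / (256 * 80000 * 6144 * 2) := by field_simp
    _ ≤ _ := by gcongr; norm_num

theorem sq_ηyl_le (hηx : 0 < par.ηxg * par.ηxl) :
    (par.ηyl * (l * par.K)) ^ 2 ≤ 1 / 16 := by
  have hK' : (0 : ℝ) < par.K := by exact_mod_cast hK
  have h1 := hr.ηyl_le₂
  rw [hr.ηy_eq] at h1
  generalize par.ηxg * par.ηxl = e at *
  have h2 := pow_le_pow_left₀ hr.ηyl_pos.le h1 2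
  rw [Real.sq_sqrt (by positivity)] at h2
  calc (par.ηyl * (l * par.K)) ^ 2 = par.ηyl ^ 2 * (l * par.K) ^ 2 := by ring
    _ ≤ e / 256 / (3072 * e * l ^ 2 * par.K ^ 2) * (l * par.K) ^ 2 := by gcongr
    _ = 1 / (256 * 3072) := by field_simp
    _ ≤ _ := by norm_num

theorem ηl_mul_le (hμ : 0 < μ) (hμl : μ ≤ l) (hηx : 0 < par.ηxg * par.ηxl) :
    (par.ηxl + par.ηyl) * l * par.K ≤ 1 / 2 := by
  have h1 := hr.sq_ηxl_le hl hK hμ hηx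
  have h2 := hr.sq_ηyl_le hl hK hηx
  have h3 : μ / l ≤ 1 := (div_le_one hl).2 hμl
  have h4 : par.ηxl * (l * par.K) ≤ 1 / 4 := le_of_sq_le_sq (by linarith) (by norm_num)
  have h5 : par.ηyl * (l * par.K) ≤ 1 / 4 := le_of_sq_le_sq (by linarith) (by norm_num)
  linarith

/-- The third bounds on the local rates. -/
theorem local_le : par.ηxl * (l * par.K) ≤ c * (ε * √((l / μ)⁻¹ * (σG ^ 2 + σ ^ 2))) ∧
    par.ηyl * (l * par.K) ≤ c * (ε * √((l / μ)⁻¹ * (σG ^ 2 + σ ^ 2))) := by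
  have hK' : (0 : ℝ) < par.K := by exact_mod_cast hK
  have h1 := hr.ηxl_le₃
  have h2 := hr.ηyl_le₃
  rw [← mul_assoc, ← div_eq_mul_inv, le_div_iff₀ (by positivity), mul_comm (par.K : ℝ)] at h1 h2
  exact ⟨h1, h2⟩

/-- Lower bound for the total step length `η_x K T`. -/
theorem le_total_step {a A : ℝ} (hΔ : 0 < Δ) (hσ : 0 < σ) (ha : 0 < a) (hε : 0 < ε)
    (hμ : 0 < μ) (hm : 0 < par.m) (hL : LoopLengths a A (l / μ) ε par.m T par.K) :
    a * (l / μ / ε ^ 2) ≤ (1000 * l + σ * √(l / Δ)) * (par.ηxg * par.ηxl * par.K * T) := by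
  have hK' : (0 : ℝ) < par.K := by exact_mod_cast hK
  have hm' : (0 : ℝ) < par.m := by exact_mod_cast hm
  set R := a * (l / μ / ε ^ 2) with hR
  have hR0 : 0 < R := by positivity
  have hT' : (0 : ℝ) < T := hR0.trans_le hL.T_lower
  -- Both `mK` and `T` are at least `R`. This serves the branch where the second entry of the
  -- minimum defines `η_x`; in the other branch `T ≥ R` is enough.
  have h1 : R ≤ √(par.m * par.K * T) := by
    refine Real.le_sqrt_of_sq_le ?_
    have h2 : R ≤ par.m * par.K := by
      have := mul_le_mul_of_nonneg_left hL.K_lower hm'.le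
      calc R = par.m * (a * (l / μ / (par.m * ε ^ 2))) := by rw [hR]; field_simp
        _ ≤ _ := this
    rw [sq]
    exact mul_le_mul h2 hL.T_lower hR0.le (by positivity)
  have hD0 : 0 ≤ σ * √(l / Δ) := by positivity
  rw [hr.ηx_eq]
  rcases min_choice (1 / (1000 * (par.K : ℝ) * l)) (√(par.m * Δ) / (σ * √(par.K * T * l)))
    with hc | hc <;> rw [hc]
  · have h2 : 1 / (1000 * (par.K : ℝ) * l) * par.K * T = T / (1000 * l) := by field_simp
    rw [h2]
    calc R ≤ T := hL.T_lower
      _ = 1000 * l * (T / (1000 * l)) := by field_simp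
      _ ≤ _ := by gcongr; linarith
  · have h2 : √(par.m * Δ) / (σ * √(par.K * T * l)) * par.K * T
        = √(par.m * par.K * T) / (σ * √(l / Δ)) := by
      rw [Real.sqrt_mul hm'.le, Real.sqrt_mul (by positivity), Real.sqrt_mul (by positivity),
        Real.sqrt_mul (by positivity), Real.sqrt_mul hm'.le, Real.sqrt_div hl.le]
      have hKs := Real.mul_self_sqrt hK'.le
      have hTs := Real.mul_self_sqrt hT'.le
      have a1 := Real.sqrt_pos.2 hK'
      have a2 := Real.sqrt_pos.2 hT'
      have a3 := Real.sqrt_pos.2 hΔ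
      have a4 := Real.sqrt_pos.2 hl
      rw [div_mul_eq_mul_div, div_mul_eq_mul_div, div_eq_div_iff (by positivity) (by positivity)]
      generalize √(par.K : ℝ) = u at *
      generalize √(T : ℝ) = v at *
      rw [← hKs, ← hTs]
      field_simp
    rw [h2]
    calc R ≤ √(par.m * par.K * T) := h1
      _ = σ * √(l / Δ) * (√(par.m * par.K * T) / (σ * √(l / Δ))) := by
        have := Real.sqrt_pos.2 (div_pos hl hΔ)
        field_simp
      _ ≤ _ := by gcongr; linarith

end StepRule

/-! ### Averaged bounds and choice of constants -/

/-- The averaged expected gap is a small multiple of `ε² / κ`. -/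
theorem average_gap_le {Ω : Type*} [MeasurableSpace Ω] {q : Problem M d₁ d₂ Ξ} {par : Params}
    {x₀ z₀ : E d₁} {y₀ : E d₂} {S : ℕ → Ω → Finset (Fin M)} {ξ : ℕ → Fin M → ℕ → Ω → Ξ}
    {l μ Δ σ σG Gy ε a A c Φstar : ℝ} {T : ℕ}
    (h : q.Regular l μ) (hwp : q.WellPosed) (hls : q.LipschitzSmooth l)
    (hbv : q.BoundedVariance σ) (hσG : 0 ≤ σG) (hhet : q.BoundedHeterogeneity σG)
    (hG : q.LipschitzInY Gy) (hGy : 0 ≤ Gy) (hy₀ : y₀ ∈ q.Y)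
    {P : Measure Ω} [IsProbabilityMeasure P] (hs : IsSampling P q par.m S ξ)
    (hm : 0 < par.m) (hfull : par.m = M ∨ σG = 0) (hΦ : ∀ x, Φstar ≤ q.Phi x)
    (hpot : q.potential (2 * l) x₀ y₀ z₀ - Φstar ≤ Δ)
    (hΔ : 0 < Δ) (hσ : 0 < σ) (hε : 0 < ε) (hc : 0 < c) (ha0 : 0 < a)
    (hL : LoopLengths a A (l / μ) ε par.m T par.K) (hr : StepRule l μ Δ σ σG ε c T par)
    (hac : Δ * (1000 * l + σ * √(l / Δ)) / a + 12 * σ ^ 2 / a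
      + 48 * (c ^ 2 * ((σG ^ 2 + σ ^ 2) * (4 * σ ^ 2 + (2 * σG + Gy) ^ 2))) ≤ 1 / 4000000000) :
    (∀ t < T, Integrable (fun ω => gap q l μ (stateAt q par x₀ z₀ y₀ S ξ t ω).x
      (stateAt q par x₀ z₀ y₀ S ξ t ω).y) P) ∧
    (T : ℝ)⁻¹ * ∑ t ∈ Finset.range T, ∫ ω, gap q l μ (stateAt q par x₀ z₀ y₀ S ξ t ω).x
      (stateAt q par x₀ z₀ y₀ S ξ t ω).y ∂P ≤ ε ^ 2 * (μ / l) / 4000000000 := by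
  have hl := h.l_pos
  have hμ := h.μ_pos
  obtain ⟨hT, hK⟩ := hL.pos ha0 (div_pos hl hμ) hε hm
  have hT' : (0 : ℝ) < T := by exact_mod_cast hT
  have hK' : (0 : ℝ) < par.K := by exact_mod_cast hK
  have hm' : (0 : ℝ) < par.m := by exact_mod_cast hm
  have hηx := hr.ηx_pos hl hK hΔ hσ hT hm
  set α := par.ηxg * par.ηxl * par.K with hα
  have hα0 : 0 < α := by positivity
  set D₀ := 1000 * l + σ * √(l / Δ) with hD₀
  have hD₀0 : 0 < D₀ := by positivity
  set E₀ := ε ^ 2 * (μ / l) with hE₀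
  have hE₀0 : 0 < E₀ := by positivity
  set B := c * (ε * √((l / μ)⁻¹ * (σG ^ 2 + σ ^ 2))) with hB
  have hB0 : 0 ≤ B := by positivity
  have hB2 : B ^ 2 = E₀ * (c ^ 2 * (σG ^ 2 + σ ^ 2)) := by
    rw [hB, mul_pow, mul_pow, Real.sq_sqrt (by positivity), inv_div]; ring
  obtain ⟨hBx, hBy⟩ := hr.local_le hl hK
  have hx0 := hr.ηxl_pos.le
  have hy0 := hr.ηyl_pos.le
  -- The first part comes from `mK ≥ a κ / ε²`, the second from the third bounds on the local rates,
  -- whose squares carry the factor `E₀ = ε² / κ`.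
  set ρ := E₀ * (6 * σ ^ 2 / a
    + 24 * (c ^ 2 * ((σG ^ 2 + σ ^ 2) * (4 * σ ^ 2 + (2 * σG + Gy) ^ 2)))) with hρdef
  have hρ : 6 * (σ ^ 2 / (par.m * par.K)) + 24 * (l * (par.ηxl + par.ηyl) * par.K) ^ 2 * σ ^ 2
      + 24 * (l * par.K * ((par.ηxl + par.ηyl) * σG + par.ηyl * Gy)) ^ 2 ≤ ρ := by
    have h1 : σ ^ 2 / (par.m * par.K) ≤ E₀ * (σ ^ 2 / a) := by
      have h2 : a * (l / μ / ε ^ 2) ≤ par.m * par.K := by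
        have := mul_le_mul_of_nonneg_left hL.K_lower hm'.le
        calc _ = par.m * (a * (l / μ / (par.m * ε ^ 2))) := by field_simp
          _ ≤ _ := this
      calc σ ^ 2 / (par.m * par.K) ≤ σ ^ 2 / (a * (l / μ / ε ^ 2)) := by gcongr
        _ = _ := by rw [hE₀]; field_simp
    have h2 : (l * (par.ηxl + par.ηyl) * par.K) ^ 2 ≤ (2 * B) ^ 2 := by
      refine pow_le_pow_left₀ (by positivity) ?_ 2
      linarith
    have h3 : (l * par.K * ((par.ηxl + par.ηyl) * σG + par.ηyl * Gy)) ^ 2 ≤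
        (B * (2 * σG + Gy)) ^ 2 := by
      refine pow_le_pow_left₀ (by positivity) ?_ 2
      linarith [mul_le_mul_of_nonneg_right hBx hσG, mul_le_mul_of_nonneg_right hBy hσG,
        mul_le_mul_of_nonneg_right hBy hGy]
    rw [mul_pow 2 B, hB2] at h2
    rw [mul_pow B, hB2] at h3
    have h4 := mul_le_mul_of_nonneg_right h2 (sq_nonneg σ)
    rw [hρdef, mul_add E₀]
    have h5 : E₀ * (6 * σ ^ 2 / a) = 6 * (E₀ * (σ ^ 2 / a)) := by ring
    rw [h5]
    linarith
  have hmain := sum_integral_gap_le (x₀ := x₀) (z₀ := z₀) h hwp hls hbv hσG hhet hG hGy hy₀ hs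
    hx0 hy0 (hr.ηl_mul_le hl hK hμ h.μ_le hηx) (hr.sq_ηxl_le hl hK hμ hηx) hm hK hfull hr.p_eq hα0
    hα.symm (hr.ηx_mul_le hl hK) hr.ηy_eq hr.β_eq hΦ hpot hρ T
  refine ⟨hmain.1, ?_⟩
  have htot := hr.le_total_step hl hK hΔ hσ ha0 hε hμ hm hL
  rw [← hα, ← hD₀] at htot
  have hfirst : (T : ℝ)⁻¹ * (Δ / α) ≤ E₀ * (Δ * D₀ / a) := by
    have h1 : (T : ℝ)⁻¹ * (Δ / α) = Δ * D₀ / (D₀ * (α * T)) := by field_simp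
    rw [h1]
    calc Δ * D₀ / (D₀ * (α * T)) ≤ Δ * D₀ / (a * (l / μ / ε ^ 2)) := by gcongr
      _ = _ := by rw [hE₀]; field_simp
  calc _ ≤ (T : ℝ)⁻¹ * (Δ / α + T * (2 * ρ)) := by gcongr; exact hmain.2
    _ = (T : ℝ)⁻¹ * (Δ / α) + 2 * ρ := by field_simp
    _ ≤ E₀ * (Δ * D₀ / a) + 2 * ρ := by gcongr
    _ = E₀ * (Δ * D₀ / a + 12 * σ ^ 2 / a
      + 48 * (c ^ 2 * ((σG ^ 2 + σ ^ 2) * (4 * σ ^ 2 + (2 * σG + Gy) ^ 2)))) := by rw [hρdef]; ring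
    _ ≤ E₀ * (1 / 4000000000) := by gcongr
    _ = _ := by ring

/-- The averaged stationarity measures, with a factor `4` to spare for Markov's inequality. -/
theorem average_stationarity_le {Ω : Type*} [MeasurableSpace Ω] {q : Problem M d₁ d₂ Ξ}
    {par : Params} {x₀ z₀ : E d₁} {y₀ : E d₂} {S : ℕ → Ω → Finset (Fin M)}
    {ξ : ℕ → Fin M → ℕ → Ω → Ξ} {l μ ε : ℝ} {T m : ℕ}
    (h : q.Regular l μ) (hwp : q.WellPosed) (hy₀ : y₀ ∈ q.Y)
    {P : Measure Ω} [IsProbabilityMeasure P] (hs : IsSampling P q m S ξ)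
    (hint : ∀ t < T, Integrable (fun ω => gap q l μ (stateAt q par x₀ z₀ y₀ S ξ t ω).x
      (stateAt q par x₀ z₀ y₀ S ξ t ω).y) P)
    (hle : (T : ℝ)⁻¹ * ∑ t ∈ Finset.range T, ∫ ω, gap q l μ (stateAt q par x₀ z₀ y₀ S ξ t ω).x
      (stateAt q par x₀ z₀ y₀ S ξ t ω).y ∂P ≤ ε ^ 2 * (μ / l) / 4000000000) :
    (∀ t < T,
      Integrable (fun ω => ‖gradX q.obj (stateAt q par x₀ z₀ y₀ S ξ t ω).x
        (stateAt q par x₀ z₀ y₀ S ξ t ω).y‖ ^ 2) P ∧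
      Integrable (fun ω => residualY q.obj q.Y l (stateAt q par x₀ z₀ y₀ S ξ t ω).x
        (stateAt q par x₀ z₀ y₀ S ξ t ω).y ^ 2) P) ∧
    (T : ℝ)⁻¹ * ∑ t ∈ Finset.range T, ∫ ω, ‖gradX q.obj (stateAt q par x₀ z₀ y₀ S ξ t ω).x
        (stateAt q par x₀ z₀ y₀ S ξ t ω).y‖ ^ 2 ∂P ≤ ε ^ 2 / 4 ∧
    (T : ℝ)⁻¹ * ∑ t ∈ Finset.range T, ∫ ω, residualY q.obj q.Y l
        (stateAt q par x₀ z₀ y₀ S ξ t ω).x (stateAt q par x₀ z₀ y₀ S ξ t ω).y ^ 2 ∂P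
      ≤ ε ^ 2 * (μ / l) / 4 := by
  have hl := h.l_pos
  have hμ := h.μ_pos
  have hρ : 0 < μ / l := by positivity
  have hX : ∀ x y, ‖gradX q.obj x y‖ ^ 2 ≤ 1000000000 / (μ / l) * gap q l μ x y := by
    intro x y
    unfold gap
    rw [div_mul_eq_mul_div, le_div_iff₀ hρ]
    nlinarith [sq_nonneg (residualY q.obj q.Y l x y)]
  have hY : ∀ x y, residualY q.obj q.Y l x y ^ 2 ≤ 2000 * gap q l μ x y := by
    intro x y
    unfold gap
    have : 0 ≤ μ / l * ‖gradX q.obj x y‖ ^ 2 := by positivity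
    linarith
  have hI : ∀ t < T,
      Integrable (fun ω => ‖gradX q.obj (stateAt q par x₀ z₀ y₀ S ξ t ω).x
        (stateAt q par x₀ z₀ y₀ S ξ t ω).y‖ ^ 2) P ∧
      Integrable (fun ω => residualY q.obj q.Y l (stateAt q par x₀ z₀ y₀ S ξ t ω).x
        (stateAt q par x₀ z₀ y₀ S ξ t ω).y ^ 2) P := by
    intro t ht
    obtain ⟨m1, m2⟩ := measurable_gradX_stateAt (par := par) (x₀ := x₀) (z₀ := z₀) h hwp hy₀ hs t
    constructor
    · refine ((hint t ht).const_mul (1000000000 / (μ / l))).mono'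
        (m1.norm.pow_const 2).aestronglyMeasurable (Filter.Eventually.of_forall fun ω => ?_)
      rw [Real.norm_of_nonneg (by positivity)]
      exact hX _ _
    · refine ((hint t ht).const_mul 2000).mono'
        (m2.pow_const 2).aestronglyMeasurable (Filter.Eventually.of_forall fun ω => ?_)
      rw [Real.norm_of_nonneg (by positivity)]
      exact hY _ _
  refine ⟨hI, ?_, ?_⟩
  · have h1 : ∑ t ∈ Finset.range T, ∫ ω, ‖gradX q.obj (stateAt q par x₀ z₀ y₀ S ξ t ω).x
        (stateAt q par x₀ z₀ y₀ S ξ t ω).y‖ ^ 2 ∂P ≤ 1000000000 / (μ / l) *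
        ∑ t ∈ Finset.range T, ∫ ω, gap q l μ (stateAt q par x₀ z₀ y₀ S ξ t ω).x
          (stateAt q par x₀ z₀ y₀ S ξ t ω).y ∂P := by
      rw [Finset.mul_sum]
      refine Finset.sum_le_sum fun t ht => ?_
      rw [← integral_const_mul]
      exact integral_mono (hI t (Finset.mem_range.1 ht)).1
        ((hint t (Finset.mem_range.1 ht)).const_mul _) fun ω => hX _ _
    have h2 := mul_le_mul_of_nonneg_left hle (show 0 ≤ 1000000000 / (μ / l) by positivity)
    have h3 := mul_le_mul_of_nonneg_left h1 (show 0 ≤ (T : ℝ)⁻¹ by positivity)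
    calc _ ≤ _ := h3
      _ = _ := by ring
      _ ≤ _ := h2
      _ = _ := by field_simp; ring
  · have h1 : ∑ t ∈ Finset.range T, ∫ ω, residualY q.obj q.Y l
        (stateAt q par x₀ z₀ y₀ S ξ t ω).x (stateAt q par x₀ z₀ y₀ S ξ t ω).y ^ 2 ∂P ≤ 2000 *
        ∑ t ∈ Finset.range T, ∫ ω, gap q l μ (stateAt q par x₀ z₀ y₀ S ξ t ω).x
          (stateAt q par x₀ z₀ y₀ S ξ t ω).y ∂P := by
      rw [Finset.mul_sum]
      refine Finset.sum_le_sum fun t ht => ?_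
      rw [← integral_const_mul]
      exact integral_mono (hI t (Finset.mem_range.1 ht)).2
        ((hint t (Finset.mem_range.1 ht)).const_mul _) fun ω => hY _ _
    have h3 := mul_le_mul_of_nonneg_left h1 (show 0 ≤ (T : ℝ)⁻¹ by positivity)
    have h4 : 0 ≤ ε ^ 2 * (μ / l) := by positivity
    linarith

/-- Constants for which the averaged gap is small. -/
theorem exists_constants {l Δ σ σG Gy : ℝ} (hl : 0 < l) (hΔ : 0 < Δ) (hσ : 0 < σ) :
    ∃ a c : ℝ, 0 < a ∧ 0 < c ∧ Δ * (1000 * l + σ * √(l / Δ)) / a + 12 * σ ^ 2 / a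
      + 48 * (c ^ 2 * ((σG ^ 2 + σ ^ 2) * (4 * σ ^ 2 + (2 * σG + Gy) ^ 2))) ≤ 1 / 4000000000 := by
  set p := Δ * (1000 * l + σ * √(l / Δ)) + 12 * σ ^ 2 with hp
  set r := 48 * ((σG ^ 2 + σ ^ 2) * (4 * σ ^ 2 + (2 * σG + Gy) ^ 2)) with hr
  have hp0 : 0 < p := by positivity
  have hr0 : 0 ≤ r := by positivity
  -- The first two terms become exactly `10⁻¹⁰`; the last is at most `10⁻¹⁰` since `r ≤ (1 + r)²`.
  -- The sum stays below `2.5 * 10⁻¹⁰`.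
  refine ⟨10000000000 * p, 1 / (100000 * (1 + r)), by positivity, by positivity, ?_⟩
  have h1 : Δ * (1000 * l + σ * √(l / Δ)) / (10000000000 * p) + 12 * σ ^ 2 / (10000000000 * p)
      = 1 / 10000000000 := by
    rw [← add_div, ← hp]; field_simp
  have h2 : 48 * ((1 / (100000 * (1 + r))) ^ 2 * ((σG ^ 2 + σ ^ 2) *
      (4 * σ ^ 2 + (2 * σG + Gy) ^ 2))) = (1 / (100000 * (1 + r))) ^ 2 * r := mul_left_comm _ _ _
  have h3 : (1 / (100000 * (1 + r))) ^ 2 * r ≤ 1 / 10000000000 := by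
    clear_value r
    rw [div_pow, div_mul_eq_mul_div, div_le_iff₀ (by positivity)]
    nlinarith
  rw [h1, h2]
  linarith

end FedMinimax

end

/-! ### Assembly of the theorem -/

theorem mainTheorem8
    (l Δ σ σG Gy : ℝ) (hl : 0 < l) (hΔ : 0 < Δ) (hσ : 0 < σ) (hσG : 0 ≤ σG) (hGy : 0 ≤ Gy) :
    -- the constants depend on `l, Δ, σ, σG, Gy` only
    ∃ a A c C : ℝ, 0 < a ∧ a ≤ A ∧ 0 < c ∧ 0 < C ∧
      ∀ (M m d₁ d₂ : ℕ) (Ξ : Type*) [MeasurableSpace Ξ] (q : FedMinimax.Problem M d₁ d₂ Ξ)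
        (μ Φstar ε : ℝ) (x₀ : FedMinimax.E d₁) (y₀ : FedMinimax.E d₂) (z₀ : FedMinimax.E d₁),
        1 ≤ m → m ≤ M → 0 < μ → μ ≤ l → 0 < ε →
        q.WellPosed →
        q.LipschitzSmooth l →
        q.BoundedVariance σ →
        q.BoundedHeterogeneity σG →
        (∀ x, Φstar ≤ q.Phi x) →
        Convex ℝ q.Y → IsCompact q.Y →
        q.LipschitzInY Gy →
        q.StronglyConcaveInY μ →
        y₀ ∈ q.Y →
        q.potential (2 * l) x₀ y₀ z₀ - Φstar ≤ Δ →
        (m = M ∨ σG = 0) →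
        -- admissible loop lengths exist
        (m * ε ^ 2 ≤ l / μ → ∃ T K : ℕ, FedMinimax.LoopLengths a A (l / μ) ε m T K) ∧
        ∀ T K : ℕ, FedMinimax.LoopLengths a A (l / μ) ε m T K →
          -- admissible step sizes exist
          (∃ par : FedMinimax.Params, par.K = K ∧ par.m = m ∧
            FedMinimax.StepRule l μ Δ σ σG ε c T par) ∧
          ∀ par : FedMinimax.Params, par.K = K → par.m = m →
            FedMinimax.StepRule l μ Δ σ σG ε c T par →
            ∀ (Ω : Type*) [MeasurableSpace Ω] (P : MeasureTheory.Measure Ω)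
              [MeasureTheory.IsProbabilityMeasure P]
              (S : ℕ → Ω → Finset (Fin M)) (ξ : ℕ → Fin M → ℕ → Ω → Ξ)
              (s : ℕ → Ω → FedMinimax.State M d₁ d₂),
              FedMinimax.IsSampling P q m S ξ →
              (∀ t ω, s t ω = FedMinimax.run q par x₀ y₀ z₀
                (fun t => S t ω) (fun t i k => ξ t i k ω) t) →
              -- the squared stationarity measures have finite expectation
              (∀ t < T,
                MeasureTheory.Integrable
                  (fun ω => ‖FedMinimax.gradX q.obj (s t ω).x (s t ω).y‖ ^ 2) P ∧
                MeasureTheory.Integrable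
                  (fun ω => FedMinimax.residualY q.obj q.Y l (s t ω).x (s t ω).y ^ 2) P) ∧
              -- a uniformly drawn iterate is stationary in expectation
              (T : ℝ)⁻¹ * ∑ t ∈ Finset.range T,
                ∫ ω, ‖FedMinimax.gradX q.obj (s t ω).x (s t ω).y‖ ^ 2 ∂P ≤ ε ^ 2 ∧
              (T : ℝ)⁻¹ * ∑ t ∈ Finset.range T,
                ∫ ω, FedMinimax.residualY q.obj q.Y l (s t ω).x (s t ω).y ^ 2 ∂P
                  ≤ (ε / √(l / μ)) ^ 2 ∧
              -- and it is a stationary point with probability at least one half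
              1 / 2 ≤ (T : ℝ)⁻¹ * ∑ t ∈ Finset.range T,
                P.real {ω | FedMinimax.IsStationaryPoint q.obj q.Y l ε (ε / √(l / μ))
                  (s t ω).x (s t ω).y} ∧
              -- per-client sample complexity and communication complexity
              (∀ ω i, ((s T ω).samples i : ℝ) ≤ C * ((l / μ) ^ 2 * (m : ℝ)⁻¹ * (ε ^ 4)⁻¹)) ∧
              (∀ ω, ((s T ω).comm : ℝ) ≤ C * ((l / μ) * (ε ^ 2)⁻¹)) := by
  obtain ⟨a, c, ha, hc, hac⟩ :=
    FedMinimax.exists_constants (σG := σG) (Gy := Gy) hl hΔ hσ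
  -- The sum serves as one `C` for both counts: `TK` needs `A²` and `T` needs `A`, with `A = a + 1`.
  refine ⟨a, a + 1, c, (a + 1) ^ 2 + (a + 1), ha, by linarith, hc, by positivity, ?_⟩
  intro M m d₁ d₂ Ξ _ q μ Φstar ε x₀ y₀ z₀ hm hmM hμ hμl hε hwp hls hbv hhet hΦ hconv hcomp hG hsc
    hy₀ hpot hfull
  have hκ : 0 < l / μ := div_pos hl hμ
  have h : q.Regular l μ :=
    hls.regular (hm.trans hmM) hl hμ hμl ⟨y₀, hy₀⟩ hconv hcomp hsc
  refine ⟨fun hmε => FedMinimax.exists_loopLengths ha hε hm hmε, fun T K hL => ?_⟩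
  obtain ⟨hT, hK⟩ := hL.pos ha hκ hε hm
  have hT' : (0 : ℝ) < T := by exact_mod_cast hT
  have hm' : (0 : ℝ) < m := by exact_mod_cast hm
  refine ⟨FedMinimax.exists_stepRule hl hμ hΔ hσ hε hc hT hK hm, ?_⟩
  rintro par rfl rfl hr Ω _ P _ S ξ s hs hrun
  obtain rfl : s = FedMinimax.stateAt q par x₀ z₀ y₀ S ξ := by
    funext t ω
    exact hrun t ω
  obtain ⟨hint, hle⟩ := FedMinimax.average_gap_le (x₀ := x₀) (z₀ := z₀) h hwp hls hbv hσG hhet hG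
    hGy hy₀ hs hm hfull hΦ hpot hΔ hσ hε hc ha hL hr hac
  obtain ⟨hI, hX, hY⟩ := FedMinimax.average_stationarity_le h hwp hy₀ hs hint hle
  have hε2 : (ε / √(l / μ)) ^ 2 = ε ^ 2 * (μ / l) := by
    rw [div_pow, Real.sq_sqrt hκ.le]
    field_simp
  have hE0 : 0 < ε ^ 2 * (μ / l) := by positivity
  refine ⟨hI, ?_, ?_, ?_, ?_, ?_⟩
  · have := sq_nonneg ε
    linarith
  · rw [hε2]
    linarith
  -- Markov's inequality is averaged over `t`; each failure contributes at most `1/4` because the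
  -- means are a quarter of the thresholds.
  · have hprob := Finset.sum_le_sum fun t (ht : t ∈ Finset.range T) =>
      FedMinimax.prob_stationary_ge (l := l) (P := P) hε (show 0 < ε / √(l / μ) by positivity)
        (hI t (Finset.mem_range.1 ht)).1 (hI t (Finset.mem_range.1 ht)).2
    rw [Finset.sum_sub_distrib, Finset.sum_sub_distrib, ← Finset.sum_div, ← Finset.sum_div, hε2,
      Finset.sum_const, Finset.card_range, nsmul_eq_mul, mul_one] at hprob
    refine le_trans ?_ (mul_le_mul_of_nonneg_left hprob (inv_nonneg.2 hT'.le))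
    rw [mul_sub, mul_sub, inv_mul_cancel₀ hT'.ne', ← mul_div_assoc, ← mul_div_assoc]
    have b1 := div_le_div_of_nonneg_right hX (sq_nonneg ε)
    have b2 := div_le_div_of_nonneg_right hY hE0.le
    have e1 : ε ^ 2 / 4 / ε ^ 2 = 1 / 4 := by field_simp
    have e2 : ε ^ 2 * (μ / l) / 4 / (ε ^ 2 * (μ / l)) = 1 / 4 := by field_simp
    rw [e1] at b1
    rw [e2] at b2
    linarith
  · intro ω i
    have h1 : ((FedMinimax.stateAt q par x₀ z₀ y₀ S ξ T ω).samples i : ℝ) ≤ T * par.K := by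
      exact_mod_cast FedMinimax.run_samples_le q par x₀ y₀ z₀ _ _ T i
    have h2 : (T : ℝ) * par.K ≤ ((a + 1) * (l / μ / ε ^ 2)) *
        ((a + 1) * (l / μ / (par.m * ε ^ 2))) := by
      gcongr
      · exact hL.T_upper
      · exact hL.K_upper
    have h3 : ((a + 1) * (l / μ / ε ^ 2)) * ((a + 1) * (l / μ / (par.m * ε ^ 2))) =
        (a + 1) ^ 2 * ((l / μ) ^ 2 * (par.m : ℝ)⁻¹ * (ε ^ 4)⁻¹) := by field_simp
    have h4 : 0 ≤ (a + 1) * ((l / μ) ^ 2 * (par.m : ℝ)⁻¹ * (ε ^ 4)⁻¹) := by positivity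
    linarith
  · intro ω
    have h1 : ((FedMinimax.stateAt q par x₀ z₀ y₀ S ξ T ω).comm : ℝ) = T := by
      exact_mod_cast FedMinimax.run_comm q par x₀ y₀ z₀ _ _ T
    have h2 := hL.T_upper
    have h3 : (a + 1) * (l / μ / ε ^ 2) = (a + 1) * ((l / μ) * (ε ^ 2)⁻¹) := by
      rw [div_eq_mul_inv (l / μ)]
    have h4 : 0 ≤ (a + 1) ^ 2 * ((l / μ) * (ε ^ 2)⁻¹) := by positivity
    rw [h1]
    linarith
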